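/- All manifolds are finite-dimensional, Hausdorff and $C^\infty$, and all principal bundles, Lie groups, maps and actions are smooth. Let $m\ge 0$, let $M$ be an $m$-dimensional manifold, and let $\pi\colon Q\to M$ be a principal bundle with structure Lie group $H$ (acting on the right). **Reductive $G$-structure.** Let $G\subset H$ be a Lie subgroup that is reductive, i.e. $\mathfrak h=\mathfrak g\oplus\mathfrak m$ for a linear subspace $\mathfrak m$ with $\mathrm{Ad}_a(\mathfrak m)\subset\mathfrak m$ for all $a\in G$, and let $i\colon P\to Q$ be a principal subbundle over $\mathrm{id}_M$ with structure group $G$. For $u\in P$ let $\mathcal M_u\subset T_{i(u)}Q$ be the space of fundamental vectors $\frac{d}{ds}\big|_{s=0}\,i(u)\cdot\exp(sv)$, $v\in\mathfrak m$. A (generalized) *Kosmann vector field* of a vector field $\Xi$ on $Q$ is a vector field $\Xi_K$ on $P$ with $\Xi(i(u))-T_ui\,(\Xi_K(u))\in\mathcal M_u$ for all $u\in P$. **Gauge-natural bundles.** For integers $k\ge h\ge 0$ let $W^{k,h}_mH$ be the group of pairs of jets $(j^k_0\alpha,j^h_0a)$, where $\alpha\colon\mathbb R^m\to\mathbb R^m$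 is locally invertible at $0$ with $\alpha(0)=0$ and $a\colon\mathbb R^m\to H$, with product $(j^k_0\alpha,j^h_0a)\odot(j^k_0\beta,j^h_0b)=(j^k_0(\alpha\circ\beta),j^h_0((a\circ\beta)\cdot b))$. Let $W^{k,h}Q\to M$ be the bundle whose elements over $x$ are the pairs $(j^k_0\varepsilon,j^h_x\sigma)$, where $\varepsilon\colon\mathbb R^m\to M$ is locally invertible at $0$ with $\varepsilon(0)=x$ and $\sigma$ is a local section of $Q$ around $x$; $W^{k,h}_mH$ acts on it on the right by $(j^k_0\varepsilon,j^h_x\sigma)\odot(j^k_0\alpha,j^h_0a)=(j^k_0(\varepsilon\circ\alpha),j^h_x(\sigma\cdot(a\circ\alpha^{-1}\circ\varepsilon^{-1})))$. For a smooth left action $\lambda$ of $W^{k,h}_mH$ on a manifold $F$, the associated bundle $Q_\lambda=W^{k,h}Q\times_\lambda F$, with elements $[w,f]_\lambda=[w\odot g,\lambda(g^{-1},f)]_\lambda$, is a *gauge-natural bundle* of order $(k,h)$. An $H$-equivariant diffeomorphism $\Phi\colon\pi^{-1}(U)\to\pi^{-1}(V)$ over a diffeomorphism $\varphi\colon U\to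 V$ of open subsets of $M$ induces the map $\Phi_\lambda\colon Q_\lambda|_U\to Q_\lambda|_V$, $$\Phi_\lambda\bigl([(j^k_0\varepsilon,j^h_x\sigma),f]_\lambda\bigr)=\bigl[(j^k_0(\varphi\circ\varepsilon),\,j^h_{\varphi(x)}(\Phi\circ\sigma\circ\varphi^{-1})),f\bigr]_\lambda .$$ **Statement.** Let $\Xi$ be a smooth $H$-invariant vector field on $Q$. Then $\Xi$ projects onto a unique vector field $\xi$ on $M$, it has a unique Kosmann vector field $\Xi_K$, both $\xi$ and $\Xi_K$ are smooth, and $\Xi_K$ is $G$-invariant and projects onto $\xi$. Let $\varphi_t$ and $(\Phi_K)_t$ be the maximal flows of $\xi$ and $\Xi_K$, and let $D\subset\mathbb R\times M$ be the domain of $\varphi$, $D_t=\{x:(t,x)\in D\}$. Then: 1. The maximal flow of $\Xi_K$ is defined at $(t,u)$ if and only if $(t,\pi(i(u)))\in D$, the maximal flow of $\Xi$ is defined at $(t,u)$ if and only if $(t,\pi(u))\in D$, and $(\Phi_K)_t$ covers $\varphi_t$. 2. For every $t$ there is one and only one $H$-equivariant diffeomorphism $\Phi_t$ of $\pi^{-1}(D_t)$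 onto the part of $Q$ over an open subset of $M$, covering a diffeomorphism of $D_t$ onto that subset, with $\Phi_t(i(u))=i((\Phi_K)_t(u))$ for all $u\in P$ over $D_t$. In particular the induced map $((\Phi_K)_t)_\lambda:=(\Phi_t)_\lambda$ of $Q_\lambda$ is well-defined. 3. For every gauge-natural bundle $Q_\lambda$ the maps $((\Phi_K)_t)_\lambda$ form a one-parameter group of automorphisms of $Q_\lambda$ over $\varphi_t$, defined on the whole fibres: the set $\{(t,q): (t,\pi_\lambda(q))\in D\}$ is open in $\mathbb R\times Q_\lambda$ and $(t,q)\mapsto((\Phi_K)_t)_\lambda(q)$ is smooth on it; $((\Phi_K)_t)_\lambda$ covers $\varphi_t$; $((\Phi_K)_0)_\lambda=\mathrm{id}$; if $((\Phi_K)_s)_\lambda$ is defined at $q$ and $((\Phi_K)_t)_\lambda$ at $((\Phi_K)_s)_\lambda(q)$, then $((\Phi_K)_{t+s})_\lambda$ is defined at $q$ and $((\Phi_K)_{t+s})_\lambda(q)=((\Phi_K)_t)_\lambda(((\Phi_K)_s)_\lambda(q))$; and $((\Phi_K)_{-t})_\lambda$ is the inverse of $((\Phi_K)_t)_\lambda$.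 If $\Xi_K$ is complete (equivalently, if $\xi$ or $\Xi$ is complete), then $D=\mathbb R\times M$, each $\Phi_t$ is an automorphism of the whole of $Q$, and each $((\Phi_K)_t)_\lambda$ is a diffeomorphism of $Q_\lambda$ onto itself, so that they form a global one-parameter group of automorphisms of $Q_\lambda$. 4. The projection $\pi_\lambda\colon Q_\lambda\to M$ and the generator $\Xi^K_\lambda(q)=\frac{d}{dt}\big|_{t=0}((\Phi_K)_t)_\lambda(q)$ are smooth, and the generalized $G$-reductive Lie derivative $$\tilde{\pounds}^G_\Xi\sigma\,(x)=\frac{\partial}{\partial t}\Big|_{t=0}\bigl(((\Phi_K)_{-t})_\lambda\circ\sigma\circ\varphi_t\bigr)(x)$$ of every smooth section $\sigma\colon U\to Q_\lambda$ over an open set $U\subset M$ is well-defined: for $x\in U$ the curve $t\mapsto(((\Phi_K)_{-t})_\lambda\circ\sigma\circ\varphi_t)(x)$ is smooth near $t=0$, passes through $\sigma(x)$ at $t=0$ and stays in the fibre over $x$ for small $t$; hence $\tilde{\pounds}^G_\Xi\sigma(x)$ is a vertical tangent vector at $\sigma(x)$; moreover $\tilde{\pounds}^G_\Xi\sigma=T\sigma\circ\xi-\Xi^K_\lambda\circ\sigma$,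 and $\tilde{\pounds}^G_\Xi\sigma$ is smooth on $U$. -/

import Mathlib

open scoped Manifold ContDiff Topology
open Set Filter

namespace GaugeNatural

noncomputable section

/-! ### Germs of smooth maps and their jets -/

section Jets

variable {E₁ E₂ E₃ : Type*} [NormedAddCommGroup E₁] [NormedSpace ℝ E₁]
  [NormedAddCommGroup E₂] [NormedSpace ℝ E₂] [NormedAddCommGroup E₃] [NormedSpace ℝ E₃]
  {H₁ H₂ H₃ : Type*} [TopologicalSpace H₁] [TopologicalSpace H₂] [TopologicalSpace H₃]
  (I : ModelWithCorners ℝ E₁ H₁) (J : ModelWithCorners ℝ E₂ H₂) (K : ModelWithCorners ℝ E₃ H₃)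
  {N₁ N₂ N₃ : Type*} [TopologicalSpace N₁] [ChartedSpace H₁ N₁]
  [TopologicalSpace N₂] [ChartedSpace H₂ N₂] [TopologicalSpace N₃] [ChartedSpace H₃ N₃]

/-- `f` is of class `C^∞` on a neighbourhood of `x`. -/
def SmoothNear (f : N₁ → N₂) (x : N₁) : Prop :=
  ∀ᶠ y in 𝓝 x, ContMDiffAt I J ∞ f y

/-- `f` and `g` have the same `r`-jet at `x`, that is `j^r_x f = j^r_x g`: they take the same value
at `x` and, in charts, all their derivatives of order at most `r` at `x` agree. -/
def JetEq (r : ℕ) (x : N₁) (f g : N₁ → N₂) : Prop :=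
  f x = g x ∧ ∀ j ≤ r,
    iteratedFDeriv ℝ j (writtenInExtChartAt I J x f) (extChartAt I x x) =
      iteratedFDeriv ℝ j (writtenInExtChartAt I J x g) (extChartAt I x x)

variable {I J K}

theorem SmoothNear.contMDiffAt {f : N₁ → N₂} {x : N₁} (h : SmoothNear I J f x) :
    ContMDiffAt I J ∞ f x := h.self_of_nhds

theorem SmoothNear.congr {f g : N₁ → N₂} {x : N₁} (h : SmoothNear I J f x) (e : g =ᶠ[𝓝 x] f) :
    SmoothNear I J g x := by
  filter_upwards [h, e.eventuallyEq_nhds] with y hy hy'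
  exact hy.congr_of_eventuallyEq hy'

theorem SmoothNear.comp {f : N₁ → N₂} {g : N₂ → N₃} {x : N₁} (hg : SmoothNear J K g (f x))
    (hf : SmoothNear I J f x) : SmoothNear I K (g ∘ f) x := by
  filter_upwards [hf, hf.contMDiffAt.continuousAt.eventually hg] with y hy hy'
  exact hy'.comp y hy

theorem SmoothNear.prodMk {f : N₁ → N₂} {g : N₁ → N₃} {x : N₁} (hf : SmoothNear I J f x)
    (hg : SmoothNear I K g x) : SmoothNear I (J.prod K) (fun y => (f y, g y)) x := by
  filter_upwards [hf, hg] with y hy hy'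
  exact hy.prodMk hy'

theorem _root_.ContMDiff.smoothNear {f : N₁ → N₂} (hf : ContMDiff I J ∞ f) (x : N₁) :
    SmoothNear I J f x := Eventually.of_forall fun y => hf y

theorem smoothNear_of_contMDiffOn {f : N₁ → N₂} {s : Set N₁} {x : N₁} (hs : s ∈ 𝓝 x)
    (hf : ContMDiffOn I J ∞ f s) : SmoothNear I J f x := by
  filter_upwards [eventually_eventually_nhds.2 hs] with y hy
  exact hf.contMDiffAt hy

theorem _root_.IsLocalDiffeomorphAt.smoothNear {f : N₁ → N₂} {x : N₁}
    (hf : IsLocalDiffeomorphAt I J ∞ f x) : SmoothNear I J f x := by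
  obtain ⟨Φ, hx, h⟩ := hf
  exact smoothNear_of_contMDiffOn (Φ.open_source.mem_nhds hx) (Φ.contMDiffOn_toFun.congr h)

theorem smoothNear_localInverse {f : N₁ → N₂} {x : N₁}
    (hf : IsLocalDiffeomorphAt I J ∞ f x) : SmoothNear J I hf.localInverse (f x) :=
  hf.localInverse_isLocalDiffeomorphAt.smoothNear

theorem localInverse_apply_self {f : N₁ → N₂} {x : N₁}
    (hf : IsLocalDiffeomorphAt I J ∞ f x) : hf.localInverse (f x) = x :=
  hf.localInverse_eventuallyEq_left.self_of_nhds

theorem JetEq.refl (r : ℕ) (x : N₁) (f : N₁ → N₂) : JetEq I J r x f f := ⟨rfl, fun _ _ => rfl⟩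

theorem JetEq.symm {r : ℕ} {x : N₁} {f g : N₁ → N₂} (h : JetEq I J r x f g) : JetEq I J r x g f :=
  ⟨h.1.symm, fun j hj => (h.2 j hj).symm⟩

theorem JetEq.trans {r : ℕ} {x : N₁} {f g k : N₁ → N₂} (h : JetEq I J r x f g)
    (h' : JetEq I J r x g k) : JetEq I J r x f k :=
  ⟨h.1.trans h'.1, fun j hj => (h.2 j hj).trans (h'.2 j hj)⟩

theorem JetEq.mono {r s : ℕ} (hs : s ≤ r) {x : N₁} {f g : N₁ → N₂} (h : JetEq I J r x f g) :
    JetEq I J s x f g := ⟨h.1, fun j hj => h.2 j (hj.trans hs)⟩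

theorem tendsto_extChartAt_symm (x : N₁) :
    Tendsto (extChartAt I x).symm (𝓝 (extChartAt I x x)) (𝓝 x) := by
  have := continuousAt_extChartAt_symm (I := I) x
  simpa [ContinuousAt] using this

theorem JetEq.of_eventuallyEq {r : ℕ} {x : N₁} {f g : N₁ → N₂} (h : f =ᶠ[𝓝 x] g) :
    JetEq I J r x f g := by
  refine ⟨h.self_of_nhds, fun j _ => (Filter.EventuallyEq.iteratedFDeriv ℝ ?_ j).self_of_nhds⟩
  filter_upwards [(tendsto_extChartAt_symm (I := I) x).eventually h] with y hy
  simp only [writtenInExtChartAt, Function.comp_apply, hy, h.self_of_nhds]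

theorem contDiffAt_written [I.Boundaryless] {n : WithTop ℕ∞} {x : N₁} {f : N₁ → N₂} (h : ContMDiffAt I J n f x) :
    ContDiffAt ℝ n (writtenInExtChartAt I J x f) (extChartAt I x x) := by
  have := (contMDiffAt_iff.1 h).2
  simpa [I.range_eq_univ, contDiffWithinAt_univ] using this

theorem JetEq.comp [I.Boundaryless] [J.Boundaryless] {r : ℕ} {x : N₁} {f f' : N₁ → N₂} {g g' : N₂ → N₃}
    (hf : JetEq I J r x f f') (hg : JetEq J K r (f x) g g')
    (sf : ContMDiffAt I J ∞ f x) (sf' : ContMDiffAt I J ∞ f' x)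
    (sg : ContMDiffAt J K ∞ g (f x)) (sg' : ContMDiffAt J K ∞ g' (f x)) :
    JetEq I K r x (g ∘ f) (g' ∘ f') := by
  refine ⟨by simp [hg.1, ← hf.1], fun j hj => ?_⟩
  have key : ∀ (f : N₁ → N₂) (g : N₂ → N₃), ContMDiffAt I J ∞ f x → ContMDiffAt J K ∞ g (f x) →
      iteratedFDeriv ℝ j (writtenInExtChartAt I K x (g ∘ f)) (extChartAt I x x) =
      (ftaylorSeries ℝ (writtenInExtChartAt J K (f x) g) (extChartAt J (f x) (f x))).taylorComp
        (ftaylorSeries ℝ (writtenInExtChartAt I J x f) (extChartAt I x x)) j := by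
    intro f g sf sg
    have e : writtenInExtChartAt I K x (g ∘ f) =ᶠ[𝓝 (extChartAt I x x)]
        writtenInExtChartAt J K (f x) g ∘ writtenInExtChartAt I J x f := by
      have h1 := (tendsto_extChartAt_symm (I := I) x).eventually
        (sf.continuousAt.eventually (extChartAt_source_mem_nhds (I := J) (f x)))
      filter_upwards [h1] with y hy
      simp only [writtenInExtChartAt, Function.comp_apply, (extChartAt J (f x)).left_inv hy]
    rw [(Filter.EventuallyEq.iteratedFDeriv ℝ e j).self_of_nhds]
    have hv : writtenInExtChartAt I J x f (extChartAt I x x) = extChartAt J (f x) (f x) := by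
      simp [writtenInExtChartAt]
    rw [iteratedFDeriv_comp (n := ∞) (hv ▸ contDiffAt_written sg) (contDiffAt_written sf)
      (by exact_mod_cast le_top), hv]
  rw [key f g sf sg, key f' g' sf' (hf.1 ▸ sg'), ← hf.1]
  simp only [FormalMultilinearSeries.taylorComp]
  refine Finset.sum_congr rfl fun c _ => ?_
  have hc : c.length ≤ r := c.length_le.trans hj
  have hp : ∀ i, c.partSize i ≤ r := fun i => (c.partSize_le i).trans hj
  ext v
  simp only [FormalMultilinearSeries.compAlongOrderedFinpartition_apply]
  have e1 : ftaylorSeries ℝ (writtenInExtChartAt J K (f x) g) (extChartAt J (f x) (f x)) c.length =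
      ftaylorSeries ℝ (writtenInExtChartAt J K (f x) g') (extChartAt J (f x) (f x)) c.length :=
    hg.2 _ hc
  have e2 : (fun m => ftaylorSeries ℝ (writtenInExtChartAt I J x f) (extChartAt I x x)
        (c.partSize m)) =
      fun m => ftaylorSeries ℝ (writtenInExtChartAt I J x f') (extChartAt I x x)
        (c.partSize m) := funext fun m => hf.2 _ (hp m)
  rw [e1, e2]

theorem JetEq.prodMk [I.Boundaryless] {r : ℕ} {x : N₁} {f f' : N₁ → N₂} {g g' : N₁ → N₃}
    (hf : JetEq I J r x f f') (hg : JetEq I K r x g g')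
    (sf : ContMDiffAt I J ∞ f x) (sf' : ContMDiffAt I J ∞ f' x)
    (sg : ContMDiffAt I K ∞ g x) (sg' : ContMDiffAt I K ∞ g' x) :
    JetEq I (J.prod K) r x (fun y => (f y, g y)) (fun y => (f' y, g' y)) := by
  refine ⟨Prod.ext hf.1 hg.1, fun j hj => ?_⟩
  have key : ∀ (f : N₁ → N₂) (g : N₁ → N₃),
      writtenInExtChartAt I (J.prod K) x (fun y => (f y, g y)) =
      fun z => (writtenInExtChartAt I J x f z, writtenInExtChartAt I K x g z) := by
    intro f g
    ext z <;> simp [writtenInExtChartAt]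
  rw [key, key]
  have hn : (j : WithTop ℕ∞) ≤ ∞ := by exact_mod_cast le_top
  rw [iteratedFDeriv_prodMk (contDiffAt_written sf) (contDiffAt_written sg) hn,
    iteratedFDeriv_prodMk (contDiffAt_written sf') (contDiffAt_written sg') hn,
    hf.2 j hj, hg.2 j hj]

/-- Local inverses of local diffeomorphisms with the same `r`-jet have the same `r`-jet. -/
theorem JetEq.localInverse [I.Boundaryless] [J.Boundaryless] {r : ℕ} {x : N₁} {f f' : N₁ → N₂}
    (h : JetEq I J r x f f') (hf : IsLocalDiffeomorphAt I J ∞ f x)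
    (hf' : IsLocalDiffeomorphAt I J ∞ f' x) :
    JetEq J I r (f x) hf.localInverse hf'.localInverse := by
  have s1 := (smoothNear_localInverse hf).contMDiffAt
  have s2 : ContMDiffAt J I ∞ hf'.localInverse (f x) := h.1 ▸ (smoothNear_localInverse hf').contMDiffAt
  have v2 : hf'.localInverse (f x) = x := h.1 ▸ localInverse_apply_self hf'
  have r2 : f' ∘ hf'.localInverse =ᶠ[𝓝 (f x)] id := h.1 ▸ hf'.localInverse_eventuallyEq_right
  have e1 : JetEq J I r (f x) hf.localInverse ((hf.localInverse ∘ f') ∘ hf'.localInverse) := by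
    apply JetEq.of_eventuallyEq
    filter_upwards [r2] with y hy
    simp only [Function.comp_apply, id] at hy ⊢
    rw [hy]
  have e2 : JetEq I I r x (hf.localInverse ∘ f') id :=
    (JetEq.comp h.symm (JetEq.refl _ _ _) hf'.contMDiffAt hf.contMDiffAt
      (h.1 ▸ s1) (h.1 ▸ s1)).trans (JetEq.of_eventuallyEq hf.localInverse_eventuallyEq_left)
  refine e1.trans ?_
  refine JetEq.comp (g' := id) (JetEq.refl _ _ _) (by rw [v2]; exact e2) s2 s2 ?_ contMDiffAt_id
  rw [v2]
  exact ContMDiffAt.comp x (h.1 ▸ s1) hf'.contMDiffAt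

end Jets

/-! ### The jet group `W^{k,h}_m H` -/

/-- The model space `ℝ^m`. -/
abbrev Eu (m : ℕ) : Type := EuclideanSpace ℝ (Fin m)

/-- The order `(k,h)` of a principal prolongation, with `k ≥ h`. -/
structure GaugeOrder where
  k : ℕ
  h : ℕ
  h_le_k : h ≤ k

section JetGroup

variable (m : ℕ) (r : GaugeOrder) (EH : Type*) [NormedAddCommGroup EH] [NormedSpace ℝ EH]
  (H : Type*) [TopologicalSpace H] [ChartedSpace EH H]

/-- Representatives `(α, a)` of elements of `W^{k,h}_m H`: `α` is a map `ℝ^m → ℝ^m` which is locally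
invertible at `0` and maps `0` to `0`, and `a` is a map `ℝ^m → H` which is smooth near `0`. -/
structure GaugeGerm where
  α : Eu m → Eu m
  α_zero : α 0 = 0
  α_diffeo : IsLocalDiffeomorphAt 𝓘(ℝ, Eu m) 𝓘(ℝ, Eu m) ∞ α 0
  a : Eu m → H
  a_smooth : SmoothNear 𝓘(ℝ, Eu m) 𝓘(ℝ, EH) a 0

/-- Two pairs represent the same element of `W^{k,h}_m H` when `j^k_0 α = j^k_0 α'` and
`j^h_0 a = j^h_0 a'`. -/
def GaugeGerm.setoid : Setoid (GaugeGerm m EH H) where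
  r g g' := JetEq 𝓘(ℝ, Eu m) 𝓘(ℝ, Eu m) r.k 0 g.α g'.α ∧ JetEq 𝓘(ℝ, Eu m) 𝓘(ℝ, EH) r.h 0 g.a g'.a
  iseqv := ⟨fun _ => ⟨.refl _ _ _, .refl _ _ _⟩, fun h => ⟨h.1.symm, h.2.symm⟩,
    fun h h' => ⟨h.1.trans h'.1, h.2.trans h'.2⟩⟩

/-- The group `W^{k,h}_m H = G^k_m ⋊ T^h_m H` of jets `(j^k_0 α, j^h_0 a)`. -/
def JetGroup : Type _ := Quotient (GaugeGerm.setoid m r EH H)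

variable {m EH H}

/-- The element `(j^k_0 α, j^h_0 a)` of `W^{k,h}_m H`. -/
def JetGroup.mk (g : GaugeGerm m EH H) : JetGroup m r EH H := Quotient.mk _ g

variable {r}

theorem JetGroup.exists_rep (w : JetGroup m r EH H) : ∃ g, JetGroup.mk r g = w :=
  Quotient.exists_rep w

theorem JetGroup.mk_eq {g g' : GaugeGerm m EH H} (h₁ : g.α =ᶠ[𝓝 0] g'.α) (h₂ : g.a =ᶠ[𝓝 0] g'.a) :
    JetGroup.mk r g = JetGroup.mk r g' :=
  Quotient.sound ⟨.of_eventuallyEq h₁, .of_eventuallyEq h₂⟩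

/-- The local inverse of `α` fixes the origin. -/
theorem GaugeGerm.inv_zero (g : GaugeGerm m EH H) : g.α_diffeo.localInverse 0 = 0 := by
  have := localInverse_apply_self g.α_diffeo
  rwa [g.α_zero] at this

theorem GaugeGerm.inv_diffeo (g : GaugeGerm m EH H) :
    IsLocalDiffeomorphAt 𝓘(ℝ, Eu m) 𝓘(ℝ, Eu m) ∞ g.α_diffeo.localInverse 0 := by
  have := g.α_diffeo.localInverse_isLocalDiffeomorphAt
  rwa [g.α_zero] at this

theorem GaugeGerm.right_inv (g : GaugeGerm m EH H) :
    g.α ∘ g.α_diffeo.localInverse =ᶠ[𝓝 0] id := by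
  have := g.α_diffeo.localInverse_eventuallyEq_right
  rwa [g.α_zero] at this

theorem GaugeGerm.tendsto_α (g : GaugeGerm m EH H) : Tendsto g.α (𝓝 0) (𝓝 0) := by
  have := g.α_diffeo.contMDiffAt.continuousAt.tendsto
  rwa [g.α_zero] at this

theorem GaugeGerm.tendsto_inv (g : GaugeGerm m EH H) :
    Tendsto g.α_diffeo.localInverse (𝓝 0) (𝓝 0) := by
  have := g.inv_diffeo.contMDiffAt.continuousAt.tendsto
  rwa [g.inv_zero] at this

variable [Group H] [LieGroup 𝓘(ℝ, EH) ∞ H]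

theorem smoothNear_mul {E₁ N₁ H₁ : Type*} [NormedAddCommGroup E₁] [NormedSpace ℝ E₁]
    [TopologicalSpace H₁] {I : ModelWithCorners ℝ E₁ H₁} [TopologicalSpace N₁] [ChartedSpace H₁ N₁]
    {a b : N₁ → H} {x : N₁} (ha : SmoothNear I 𝓘(ℝ, EH) a x) (hb : SmoothNear I 𝓘(ℝ, EH) b x) :
    SmoothNear I 𝓘(ℝ, EH) (fun y => a y * b y) x := by
  filter_upwards [ha, hb] with y h h' using h.mul h'

theorem smoothNear_inv {E₁ N₁ H₁ : Type*} [NormedAddCommGroup E₁] [NormedSpace ℝ E₁]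
    [TopologicalSpace H₁] {I : ModelWithCorners ℝ E₁ H₁} [TopologicalSpace N₁] [ChartedSpace H₁ N₁]
    {a : N₁ → H} {x : N₁} (ha : SmoothNear I 𝓘(ℝ, EH) a x) :
    SmoothNear I 𝓘(ℝ, EH) (fun y => (a y)⁻¹) x := by
  filter_upwards [ha] with y h using h.inv

/-- The product `(α, a) ⊙ (β, b) = (α ∘ β, (a ∘ β) · b)`. -/
def GaugeGerm.mul (g g' : GaugeGerm m EH H) : GaugeGerm m EH H where
  α := g.α ∘ g'.α
  α_zero := by simp [g.α_zero, g'.α_zero]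
  α_diffeo := IsLocalDiffeomorphAt.comp (K := 𝓘(ℝ, Eu m)) (P := Eu m) g'.α_diffeo
    (by rw [g'.α_zero]; exact g.α_diffeo)
  a y := g.a (g'.α y) * g'.a y
  a_smooth := smoothNear_mul
    (SmoothNear.comp (by rw [g'.α_zero]; exact g.a_smooth) g'.α_diffeo.smoothNear) g'.a_smooth

/-- The unit `(id, e)`. -/
def GaugeGerm.one : GaugeGerm m EH H where
  α := id
  α_zero := rfl
  α_diffeo := (Diffeomorph.refl 𝓘(ℝ, Eu m) (Eu m) ∞).isLocalDiffeomorph 0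
  a _ := 1
  a_smooth := Eventually.of_forall fun _ => contMDiffAt_const

/-- The inverse `(α⁻¹, (a ∘ α⁻¹)⁻¹)`. -/
def GaugeGerm.inv (g : GaugeGerm m EH H) : GaugeGerm m EH H where
  α := g.α_diffeo.localInverse
  α_zero := g.inv_zero
  α_diffeo := g.inv_diffeo
  a y := (g.a (g.α_diffeo.localInverse y))⁻¹
  a_smooth := smoothNear_inv
    (SmoothNear.comp (by rw [g.inv_zero]; exact g.a_smooth) g.inv_diffeo.smoothNear)

theorem JetEq.mul {E₁ N₁ H₁ : Type*} [NormedAddCommGroup E₁] [NormedSpace ℝ E₁]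
    [TopologicalSpace H₁] {I : ModelWithCorners ℝ E₁ H₁} [I.Boundaryless]
    [TopologicalSpace N₁] [ChartedSpace H₁ N₁] {s : ℕ} {x : N₁} {a a' b b' : N₁ → H}
    (ha : JetEq I 𝓘(ℝ, EH) s x a a') (hb : JetEq I 𝓘(ℝ, EH) s x b b')
    (sa : ContMDiffAt I 𝓘(ℝ, EH) ∞ a x) (sa' : ContMDiffAt I 𝓘(ℝ, EH) ∞ a' x)
    (sb : ContMDiffAt I 𝓘(ℝ, EH) ∞ b x) (sb' : ContMDiffAt I 𝓘(ℝ, EH) ∞ b' x) :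
    JetEq I 𝓘(ℝ, EH) s x (fun y => a y * b y) (fun y => a' y * b' y) :=
  JetEq.comp (g := fun p : H × H => p.1 * p.2) (g' := fun p : H × H => p.1 * p.2)
    (ha.prodMk hb sa sa' sb sb') (.refl _ _ _) (sa.prodMk sb) (sa'.prodMk sb')
    (contMDiff_mul _ _).contMDiffAt (contMDiff_mul _ _).contMDiffAt

theorem GaugeGerm.mul_rel {g₁ g₁' g₂ g₂' : GaugeGerm m EH H}
    (h₁ : (GaugeGerm.setoid m r EH H).r g₁ g₁') (h₂ : (GaugeGerm.setoid m r EH H).r g₂ g₂') :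
    (GaugeGerm.setoid m r EH H).r (g₁.mul g₂) (g₁'.mul g₂') := by
  have d₂ := g₂.α_diffeo.contMDiffAt
  have d₂' := g₂'.α_diffeo.contMDiffAt
  have d₁ : ContMDiffAt 𝓘(ℝ, Eu m) 𝓘(ℝ, Eu m) ∞ g₁.α (g₂.α 0) := by
    rw [g₂.α_zero]; exact g₁.α_diffeo.contMDiffAt
  have d₁' : ContMDiffAt 𝓘(ℝ, Eu m) 𝓘(ℝ, Eu m) ∞ g₁'.α (g₂.α 0) := by
    rw [g₂.α_zero]; exact g₁'.α_diffeo.contMDiffAt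
  have s₁ : ContMDiffAt 𝓘(ℝ, Eu m) 𝓘(ℝ, EH) ∞ g₁.a (g₂.α 0) := by
    rw [g₂.α_zero]; exact g₁.a_smooth.contMDiffAt
  have s₁' : ContMDiffAt 𝓘(ℝ, Eu m) 𝓘(ℝ, EH) ∞ g₁'.a (g₂.α 0) := by
    rw [g₂.α_zero]; exact g₁'.a_smooth.contMDiffAt
  refine ⟨h₂.1.comp (by rw [g₂.α_zero]; exact h₁.1) d₂ d₂' d₁ d₁', ?_⟩
  refine JetEq.mul (JetEq.comp (h₂.1.mono r.h_le_k) (by rw [g₂.α_zero]; exact h₁.2) d₂ d₂' s₁ s₁')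
    h₂.2 (s₁.comp 0 d₂) (ContMDiffAt.comp 0 (by rw [← h₂.1.1]; exact s₁') d₂')
    g₂.a_smooth.contMDiffAt g₂'.a_smooth.contMDiffAt

instance JetGroup.instMul : Mul (JetGroup m r EH H) :=
  ⟨Quotient.map₂ GaugeGerm.mul fun _ _ h₁ _ _ h₂ => GaugeGerm.mul_rel h₁ h₂⟩

instance JetGroup.instOne : One (JetGroup m r EH H) := ⟨JetGroup.mk r GaugeGerm.one⟩

instance JetGroup.instInv : Inv (JetGroup m r EH H) := ⟨fun w => JetGroup.mk r (Quotient.out w).inv⟩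

theorem JetGroup.mk_mul (g g' : GaugeGerm m EH H) :
    JetGroup.mk r g * JetGroup.mk r g' = JetGroup.mk r (g.mul g') := rfl

instance JetGroup.instGroup : Group (JetGroup m r EH H) :=
  Group.ofLeftAxioms
    (by
      intro u v w
      obtain ⟨a, rfl⟩ := u.exists_rep
      obtain ⟨b, rfl⟩ := v.exists_rep
      obtain ⟨c, rfl⟩ := w.exists_rep
      simp only [mk_mul]
      exact mk_eq (.of_eq rfl) (.of_eq (funext fun y => mul_assoc _ _ _)))
    (by
      intro u
      obtain ⟨a, rfl⟩ := u.exists_rep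
      exact (mk_mul _ _).trans (mk_eq (.of_eq rfl) (.of_eq (funext fun y => one_mul _))))
    (by
      intro u
      have hu : JetGroup.mk r (Quotient.out u) = u := Quotient.out_eq u
      have : u⁻¹ = JetGroup.mk r (Quotient.out u).inv := rfl
      rw [this]
      nth_rw 2 [← hu]
      rw [mk_mul]
      have e := (Quotient.out u).α_diffeo.localInverse_eventuallyEq_left
      refine mk_eq e ?_
      filter_upwards [e] with y hy
      simp only [Function.comp_apply, id] at hy
      simp [GaugeGerm.mul, GaugeGerm.inv, GaugeGerm.one, hy])

variable (m r EH H) in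
/-- A smooth left action `λ` of the Lie group `W^{k,h}_m H` on a manifold `F`. The manifold
structure of the jet space `W^{k,h}_m H` is the one for which a jet depends smoothly on parameters
exactly when it locally has representatives depending smoothly on the parameters (the polynomial
representatives in charts give its local coordinates), so smoothness of `λ` is expressed through
smooth families of representatives. -/
structure JetAction (EF : Type*) [NormedAddCommGroup EF] [NormedSpace ℝ EF]
    (F : Type*) [TopologicalSpace F] [ChartedSpace EF F] where
  smul : JetGroup m r EH H → F → F
  one_smul : ∀ f, smul 1 f = f
  mul_smul : ∀ w w' f, smul (w * w') f = smul w (smul w' f)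
  smooth : ∀ (V : Type) [NormedAddCommGroup V] [NormedSpace ℝ V] [FiniteDimensional ℝ V]
    (g : V → GaugeGerm m EH H) (c : V),
    SmoothNear 𝓘(ℝ, V × Eu m) 𝓘(ℝ, Eu m) (fun p : V × Eu m => (g p.1).α p.2) (c, 0) →
    SmoothNear 𝓘(ℝ, V × Eu m) 𝓘(ℝ, EH) (fun p : V × Eu m => (g p.1).a p.2) (c, 0) →
    ∀ f : F, ContMDiffAt (𝓘(ℝ, V).prod 𝓘(ℝ, EF)) 𝓘(ℝ, EF) ∞
      (fun p : V × F => smul (JetGroup.mk r (g p.1)) p.2) (c, f)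

end JetGroup

/-! ### Principal bundles and their principal prolongations -/

section Principal

variable (m : ℕ) (EH EQ : Type*) [NormedAddCommGroup EH] [NormedSpace ℝ EH]
  [NormedAddCommGroup EQ] [NormedSpace ℝ EQ]
  (M : Type*) [TopologicalSpace M] [ChartedSpace (Eu m) M]
  (H : Type*) [TopologicalSpace H] [ChartedSpace EH H] [Group H]
  (Q : Type*) [TopologicalSpace Q] [ChartedSpace EQ Q]

/-- A smooth principal bundle `π : Q → M` with structure group `H` acting freely on the right, the
fibres being the orbits, locally trivial through smooth equivariant trivializations. -/
structure PrincipalBundle where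
  proj : Q → M
  act : Q → H → Q
  act_one : ∀ u, act u 1 = u
  act_mul : ∀ u a b, act u (a * b) = act (act u a) b
  contMDiff_act : ContMDiff (𝓘(ℝ, EQ).prod 𝓘(ℝ, EH)) 𝓘(ℝ, EQ) ∞ (fun p : Q × H => act p.1 p.2)
  free : ∀ u a, act u a = u → a = 1
  contMDiff_proj : ContMDiff 𝓘(ℝ, EQ) 𝓘(ℝ, Eu m) ∞ proj
  proj_surjective : Function.Surjective proj
  proj_eq_iff : ∀ u v, proj u = proj v ↔ ∃ a, act u a = v
  locally_trivial : ∀ x : M, ∃ e : Bundle.Trivialization H proj, x ∈ e.baseSet ∧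
    ContMDiffOn 𝓘(ℝ, EQ) (𝓘(ℝ, Eu m).prod 𝓘(ℝ, EH)) ∞ e e.source ∧
    ContMDiffOn (𝓘(ℝ, Eu m).prod 𝓘(ℝ, EH)) 𝓘(ℝ, EQ) ∞ e.toOpenPartialHomeomorph.symm e.target ∧
    ∀ u ∈ e.source, ∀ a, (e (act u a)).2 = (e u).2 * a

variable {m EH EQ M H Q}

namespace PrincipalBundle

variable (B : PrincipalBundle m EH EQ M H Q)

theorem proj_act (u : Q) (a : H) : B.proj (B.act u a) = B.proj u :=
  ((B.proj_eq_iff _ _).2 ⟨a, rfl⟩).symm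

theorem act_injective (u : Q) {a b : H} (h : B.act u a = B.act u b) : a = b := by
  have : B.act u (a * b⁻¹) = u := by rw [B.act_mul, h, ← B.act_mul, mul_inv_cancel, B.act_one]
  exact mul_inv_eq_one.1 (B.free _ _ this)

open Classical in
/-- For `u`, `v` in the same fibre, the unique `a ∈ H` with `u · a = v`. -/
def div (u v : Q) : H := if h : ∃ a, B.act u a = v then h.choose else 1

theorem act_div {u v : Q} (h : B.proj u = B.proj v) : B.act u (B.div u v) = v := by
  have h' := (B.proj_eq_iff u v).1 h
  rw [div, dif_pos h']
  exact h'.choose_spec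

theorem div_act (u : Q) (a : H) : B.div u (B.act u a) = a :=
  B.act_injective u (B.act_div (B.proj_act u a).symm)

/-- A trivialization of `Q` around `x₀`. -/
def trivAt (x₀ : M) :
    Bundle.Trivialization H B.proj := (B.locally_trivial x₀).choose

/-- The corresponding local section `x ↦ (x, e)` of `Q`. -/
def sectionAt (x₀ x : M) : Q :=
  (B.trivAt x₀).toOpenPartialHomeomorph.symm (x, 1)

/-- The domain of a chart of `M` around `x₀` over which `Q` is trivialized. -/
def dom (x₀ : M) : Set M :=
  (chartAt (Eu m) x₀).source ∩ (B.trivAt x₀).baseSet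

theorem mem_dom (x₀ : M) : x₀ ∈ B.dom x₀ :=
  ⟨mem_chart_source _ _, (B.locally_trivial x₀).choose_spec.1⟩

theorem isOpen_dom (x₀ : M) :
    IsOpen (B.dom x₀) :=
  (chartAt (Eu m) x₀).open_source.inter (B.trivAt x₀).open_baseSet

theorem sectionAt_smooth {x₀ x : M}
    (hx : x ∈ B.dom x₀) : SmoothNear 𝓘(ℝ, Eu m) 𝓘(ℝ, EQ) (B.sectionAt x₀) x := by
  have h := (B.locally_trivial x₀).choose_spec.2.2.1
  have hm : (x, (1 : H)) ∈ (B.trivAt x₀).target := (B.trivAt x₀).mem_target.2 hx.2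
  have h' := smoothNear_of_contMDiffOn ((B.trivAt x₀).open_target.mem_nhds hm) h
  exact SmoothNear.comp (f := fun y : M => (y, (1 : H))) h'
    ((contMDiff_id.prodMk contMDiff_const).smoothNear x)

theorem sectionAt_proj {x₀ x : M}
    (hx : x ∈ B.dom x₀) : B.proj (B.sectionAt x₀ x) = x :=
  (B.trivAt x₀).proj_symm_apply' hx.2

section Smooth

variable {E₁ N₁ H₁ : Type*} [NormedAddCommGroup E₁] [NormedSpace ℝ E₁]
    [TopologicalSpace H₁] {I : ModelWithCorners ℝ E₁ H₁} [TopologicalSpace N₁] [ChartedSpace H₁ N₁]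

theorem smoothNear_act {f : N₁ → Q} {a : N₁ → H} {x : N₁} (hf : SmoothNear I 𝓘(ℝ, EQ) f x)
    (ha : SmoothNear I 𝓘(ℝ, EH) a x) : SmoothNear I 𝓘(ℝ, EQ) (fun y => B.act (f y) (a y)) x :=
  SmoothNear.comp (g := fun p : Q × H => B.act p.1 p.2) (B.contMDiff_act.smoothNear _)
    (hf.prodMk ha)

theorem smoothNear_div [LieGroup 𝓘(ℝ, EH) ∞ H] {f g : N₁ → Q} {x : N₁}
    (hf : SmoothNear I 𝓘(ℝ, EQ) f x) (hg : SmoothNear I 𝓘(ℝ, EQ) g x)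
    (h : ∀ᶠ y in 𝓝 x, B.proj (f y) = B.proj (g y)) :
    SmoothNear I 𝓘(ℝ, EH) (fun y => B.div (f y) (g y)) x := by
  obtain ⟨e, hx, h1, -, h3⟩ := B.locally_trivial (B.proj (f x))
  have hfx : f x ∈ e.source := e.mem_source.2 hx
  have hgx : g x ∈ e.source := e.mem_source.2 (h.self_of_nhds ▸ hx)
  have hs := e.open_source
  have s1 : ∀ {f : N₁ → Q}, SmoothNear I 𝓘(ℝ, EQ) f x → f x ∈ e.source →
      SmoothNear I 𝓘(ℝ, EH) (fun y => (e (f y)).2) x := by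
    intro f hf hfx
    have a1 : SmoothNear 𝓘(ℝ, EQ) (𝓘(ℝ, Eu m).prod 𝓘(ℝ, EH)) e (f x) :=
      smoothNear_of_contMDiffOn (hs.mem_nhds hfx) h1
    exact SmoothNear.comp (g := Prod.snd) (contMDiff_snd.smoothNear _) (a1.comp hf)
  refine (smoothNear_mul (smoothNear_inv (s1 hf hfx)) (s1 hg hgx)).congr ?_
  filter_upwards [h, hf.contMDiffAt.continuousAt.eventually (hs.mem_nhds hfx)] with y hy hy'
  have : (e (g y)).2 = (e (f y)).2 * B.div (f y) (g y) := by
    rw [← h3 _ hy', B.act_div hy]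
  rw [this, inv_mul_cancel_left]

theorem jetEq_div [LieGroup 𝓘(ℝ, EH) ∞ H] [I.Boundaryless] {s : ℕ} {f g : N₁ → Q} {x : N₁}
    (hf : SmoothNear I 𝓘(ℝ, EQ) f x) (hg : SmoothNear I 𝓘(ℝ, EQ) g x)
    (h : ∀ᶠ y in 𝓝 x, B.proj (f y) = B.proj (g y)) (hj : JetEq I 𝓘(ℝ, EQ) s x f g) :
    JetEq I 𝓘(ℝ, EH) s x (fun y => B.div (f y) (g y)) (fun _ => 1) := by
  obtain ⟨e, hx, h1, -, h3⟩ := B.locally_trivial (B.proj (f x))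
  have hfx : f x ∈ e.source := e.mem_source.2 hx
  have a1 : ContMDiffAt 𝓘(ℝ, EQ) 𝓘(ℝ, EH) ∞ (fun u => (e u).2) (f x) :=
    contMDiffAt_snd.comp (f x) (h1.contMDiffAt (e.open_source.mem_nhds hfx))
  have sf := a1.comp x hf.contMDiffAt
  have sg : ContMDiffAt I 𝓘(ℝ, EH) ∞ ((fun u => (e u).2) ∘ g) x :=
    ContMDiffAt.comp x (hj.1 ▸ a1) hg.contMDiffAt
  have j1 := JetEq.comp hj (.refl _ _ _) hf.contMDiffAt hg.contMDiffAt a1 a1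
  have si := sf.inv
  have j2 := JetEq.mul (JetEq.refl s x _) j1.symm si si sg sf
  refine (JetEq.of_eventuallyEq ?_).trans (j2.trans (JetEq.of_eventuallyEq ?_))
  · filter_upwards [h, hf.contMDiffAt.continuousAt.eventually (e.open_source.mem_nhds hfx)]
      with y hy hy'
    have : (e (g y)).2 = (e (f y)).2 * B.div (f y) (g y) := by
      rw [← h3 _ hy', B.act_div hy]
    simp only [Function.comp_apply, this, inv_mul_cancel_left]
  · exact .of_eq (funext fun y => inv_mul_cancel _)

theorem _root_.GaugeNatural.JetEq.act [I.Boundaryless] {s : ℕ} {x : N₁} {f f' : N₁ → Q}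
    {a a' : N₁ → H} (hf : JetEq I 𝓘(ℝ, EQ) s x f f') (ha : JetEq I 𝓘(ℝ, EH) s x a a')
    (sf : ContMDiffAt I 𝓘(ℝ, EQ) ∞ f x) (sf' : ContMDiffAt I 𝓘(ℝ, EQ) ∞ f' x)
    (sa : ContMDiffAt I 𝓘(ℝ, EH) ∞ a x) (sa' : ContMDiffAt I 𝓘(ℝ, EH) ∞ a' x) :
    JetEq I 𝓘(ℝ, EQ) s x (fun y => B.act (f y) (a y)) (fun y => B.act (f' y) (a' y)) :=
  JetEq.comp (g := fun p : Q × H => B.act p.1 p.2) (g' := fun p : Q × H => B.act p.1 p.2)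
    (hf.prodMk ha sf sf' sa sa') (.refl _ _ _) (sf.prodMk sa) (sf'.prodMk sa')
    B.contMDiff_act.contMDiffAt B.contMDiff_act.contMDiffAt

end Smooth

end PrincipalBundle

/-- Representatives `(ε, σ)` of the elements over `x` of the principal prolongation `W^{k,h} Q`:
`ε : ℝ^m → M` is locally invertible at `0` with `ε(0) = x`, and `σ` is a smooth local section of `Q`
around `x`. -/
structure FrameGerm (B : PrincipalBundle m EH EQ M H Q) (x : M) where
  ε : Eu m → M
  ε_zero : ε 0 = x
  ε_diffeo : IsLocalDiffeomorphAt 𝓘(ℝ, Eu m) 𝓘(ℝ, Eu m) ∞ ε 0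
  σ : M → Q
  σ_smooth : SmoothNear 𝓘(ℝ, Eu m) 𝓘(ℝ, EQ) σ x
  σ_section : ∀ᶠ y in 𝓝 x, B.proj (σ y) = y

section Prolongation

variable (B : PrincipalBundle m EH EQ M H Q) (r : GaugeOrder)

/-- Two pairs represent the same element of `W^{k,h} Q` when `j^k_0 ε = j^k_0 ε'` and
`j^h_x σ = j^h_x σ'`. -/
def FrameGerm.setoid (x : M) : Setoid (FrameGerm B x) where
  r w w' := JetEq 𝓘(ℝ, Eu m) 𝓘(ℝ, Eu m) r.k 0 w.ε w'.ε ∧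
    JetEq 𝓘(ℝ, Eu m) 𝓘(ℝ, EQ) r.h x w.σ w'.σ
  iseqv := ⟨fun _ => ⟨.refl _ _ _, .refl _ _ _⟩, fun h => ⟨h.1.symm, h.2.symm⟩,
    fun h h' => ⟨h.1.trans h'.1, h.2.trans h'.2⟩⟩

/-- The fibre over `x` of the principal prolongation `W^{k,h} Q = L^k M ×_M J^h Q`, whose elements
are the pairs of jets `(j^k_0 ε, j^h_x σ)`. -/
def WFiber (x : M) : Type _ := Quotient (FrameGerm.setoid B r x)

variable {B}

/-- The element `(j^k_0 ε, j^h_x σ)` of `W^{k,h} Q`. -/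
def WFiber.mk {x : M} (w : FrameGerm B x) : WFiber B r x := Quotient.mk _ w

variable {r}

theorem WFiber.exists_rep {x : M} (w : WFiber B r x) : ∃ g, WFiber.mk r g = w :=
  Quotient.exists_rep w

theorem WFiber.mk_eq {x : M} {w w' : FrameGerm B x} (h₁ : w.ε =ᶠ[𝓝 0] w'.ε)
    (h₂ : w.σ =ᶠ[𝓝 x] w'.σ) : WFiber.mk r w = WFiber.mk r w' :=
  Quotient.sound ⟨.of_eventuallyEq h₁, .of_eventuallyEq h₂⟩

namespace FrameGerm

variable {x : M} (w : FrameGerm B x)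

/-- The local inverse `ε⁻¹`. -/
def inv : M → Eu m := w.ε_diffeo.localInverse

theorem inv_base : w.inv x = 0 := by
  have := localInverse_apply_self w.ε_diffeo
  rwa [w.ε_zero] at this

theorem inv_smooth : SmoothNear 𝓘(ℝ, Eu m) 𝓘(ℝ, Eu m) w.inv x := by
  have := smoothNear_localInverse w.ε_diffeo
  rwa [w.ε_zero] at this

theorem inv_diffeo : IsLocalDiffeomorphAt 𝓘(ℝ, Eu m) 𝓘(ℝ, Eu m) ∞ w.inv x := by
  have := w.ε_diffeo.localInverse_isLocalDiffeomorphAt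
  rwa [w.ε_zero] at this

theorem inv_left : ∀ᶠ y in 𝓝 0, w.inv (w.ε y) = y := w.ε_diffeo.localInverse_eventuallyEq_left

theorem inv_right : ∀ᶠ y in 𝓝 x, w.ε (w.inv y) = y := by
  have := w.ε_diffeo.localInverse_eventuallyEq_right
  rwa [w.ε_zero] at this

theorem tendsto_ε : Tendsto w.ε (𝓝 0) (𝓝 x) := by
  have := w.ε_diffeo.contMDiffAt.continuousAt.tendsto
  rwa [w.ε_zero] at this

theorem tendsto_inv : Tendsto w.inv (𝓝 x) (𝓝 0) := by
  have := w.inv_smooth.contMDiffAt.continuousAt.tendsto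
  rwa [w.inv_base] at this

/-- Uniqueness of germs of local inverses. -/
theorem inv_unique {f : M → Eu m} (hf : Tendsto f (𝓝 x) (𝓝 0))
    (h : ∀ᶠ y in 𝓝 x, w.ε (f y) = y) : f =ᶠ[𝓝 x] w.inv := by
  filter_upwards [h, hf.eventually w.inv_left] with y h1 h2
  rw [← h2, h1]

theorem inv_jetEq {w w' : FrameGerm B x} {s : ℕ}
    (h : JetEq 𝓘(ℝ, Eu m) 𝓘(ℝ, Eu m) s 0 w.ε w'.ε) :
    JetEq 𝓘(ℝ, Eu m) 𝓘(ℝ, Eu m) s x w.inv w'.inv := by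
  have := h.localInverse w.ε_diffeo w'.ε_diffeo
  rwa [w.ε_zero] at this

end FrameGerm

/-- The right action
`(ε, σ) ⊙ (α, a) = (ε ∘ α, σ · (a ∘ α⁻¹ ∘ ε⁻¹))`. -/
def FrameGerm.act {x : M} (w : FrameGerm B x) (g : GaugeGerm m EH H) : FrameGerm B x where
  ε := w.ε ∘ g.α
  ε_zero := by simp [g.α_zero, w.ε_zero]
  ε_diffeo := IsLocalDiffeomorphAt.comp (K := 𝓘(ℝ, Eu m)) (P := M) g.α_diffeo
    (by rw [g.α_zero]; exact w.ε_diffeo)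
  σ y := B.act (w.σ y) (g.a (g.α_diffeo.localInverse (w.inv y)))
  σ_smooth := B.smoothNear_act w.σ_smooth
    (SmoothNear.comp (f := fun y => g.α_diffeo.localInverse (w.inv y))
      (by rw [w.inv_base, g.inv_zero]; exact g.a_smooth)
      (SmoothNear.comp (by rw [w.inv_base]; exact g.inv_diffeo.smoothNear) w.inv_smooth))
  σ_section := by
    filter_upwards [w.σ_section] with y hy
    rw [B.proj_act, hy]

/-- The local inverse of `ε ∘ α` is `α⁻¹ ∘ ε⁻¹`. -/
theorem FrameGerm.act_inv {x : M} (w : FrameGerm B x) (g : GaugeGerm m EH H) :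
    (fun y => g.α_diffeo.localInverse (w.inv y)) =ᶠ[𝓝 x] (w.act g).inv := by
  refine (w.act g).inv_unique (g.tendsto_inv.comp w.tendsto_inv) ?_
  filter_upwards [w.inv_right, w.tendsto_inv.eventually g.right_inv] with y h1 h2
  simp only [Function.comp_apply, id] at h2
  simp only [FrameGerm.act, Function.comp_apply, h2, h1]

/-- The section component of `(ε, σ) ⊙ (α, a)` in terms of the inverse of `ε ∘ α`. -/
theorem FrameGerm.act_σ {x : M} (w : FrameGerm B x) (g : GaugeGerm m EH H) :
    (w.act g).σ =ᶠ[𝓝 x] fun y => B.act (w.σ y) (g.a ((w.act g).inv y)) := by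
  filter_upwards [w.act_inv g] with y hy
  rw [← hy]
  rfl

theorem FrameGerm.act_rel {x : M} {w w' : FrameGerm B x} {g g' : GaugeGerm m EH H}
    (h₁ : (FrameGerm.setoid B r x).r w w') (h₂ : (GaugeGerm.setoid m r EH H).r g g') :
    (FrameGerm.setoid B r x).r (w.act g) (w'.act g') := by
  have d := g.α_diffeo.contMDiffAt
  have d' := g'.α_diffeo.contMDiffAt
  have e : ContMDiffAt 𝓘(ℝ, Eu m) 𝓘(ℝ, Eu m) ∞ w.ε (g.α 0) := by
    rw [g.α_zero]; exact w.ε_diffeo.contMDiffAt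
  have e' : ContMDiffAt 𝓘(ℝ, Eu m) 𝓘(ℝ, Eu m) ∞ w'.ε (g.α 0) := by
    rw [g.α_zero]; exact w'.ε_diffeo.contMDiffAt
  have k : JetEq 𝓘(ℝ, Eu m) 𝓘(ℝ, Eu m) r.k 0 (w.act g).ε (w'.act g').ε :=
    h₂.1.comp (by rw [g.α_zero]; exact h₁.1) d d' e e'
  refine ⟨k, ?_⟩
  have i := (FrameGerm.inv_jetEq k).mono r.h_le_k
  have s : ∀ (w : FrameGerm B x) (g : GaugeGerm m EH H),
      ContMDiffAt 𝓘(ℝ, Eu m) 𝓘(ℝ, EH) ∞ g.a (w.inv x) := fun w g => by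
    rw [w.inv_base]; exact g.a_smooth.contMDiffAt
  have j : JetEq 𝓘(ℝ, Eu m) 𝓘(ℝ, EH) r.h x (g.a ∘ (w.act g).inv) (g'.a ∘ (w'.act g').inv) :=
    i.comp (by rw [FrameGerm.inv_base]; exact h₂.2) (w.act g).inv_smooth.contMDiffAt
      (w'.act g').inv_smooth.contMDiffAt (s _ _) (by rw [(w.act g).inv_base, ← (w'.act g').inv_base]; exact s _ _)
  have q := JetEq.act B h₁.2 j w.σ_smooth.contMDiffAt w'.σ_smooth.contMDiffAt
    ((s _ _).comp x (w.act g).inv_smooth.contMDiffAt)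
    ((s _ _).comp x (w'.act g').inv_smooth.contMDiffAt)
  exact ((JetEq.of_eventuallyEq (w.act_σ g)).trans q).trans
    (JetEq.of_eventuallyEq (w'.act_σ g')).symm

/-- The right action of `W^{k,h}_m H` on the fibres of `W^{k,h} Q`. -/
def WFiber.act {x : M} : WFiber B r x → JetGroup m r EH H → WFiber B r x :=
  Quotient.map₂ FrameGerm.act fun _ _ h₁ _ _ h₂ => FrameGerm.act_rel h₁ h₂

theorem WFiber.mk_act {x : M} (w : FrameGerm B x) (g : GaugeGerm m EH H) :
    (WFiber.mk r w).act (JetGroup.mk r g) = WFiber.mk r (w.act g) := rfl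

theorem WFiber.act_one [LieGroup 𝓘(ℝ, EH) ∞ H] {x : M} (w : WFiber B r x) : w.act 1 = w := by
  obtain ⟨w, rfl⟩ := w.exists_rep
  refine (mk_act w GaugeGerm.one).trans (mk_eq (.of_eq rfl) (.of_eq ?_))
  funext y
  exact B.act_one _

variable [LieGroup 𝓘(ℝ, EH) ∞ H]

theorem WFiber.act_mul {x : M} (w : WFiber B r x) (g g' : JetGroup m r EH H) :
    w.act (g * g') = (w.act g).act g' := by
  obtain ⟨w, rfl⟩ := w.exists_rep
  obtain ⟨g, rfl⟩ := g.exists_rep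
  obtain ⟨g', rfl⟩ := g'.exists_rep
  rw [JetGroup.mk_mul, mk_act, mk_act, mk_act]
  refine mk_eq (.of_eq rfl) ?_
  have e : (w.act (g.mul g')).inv =ᶠ[𝓝 x] ((w.act g).act g').inv :=
    ((w.act g).act g').inv_unique (w.act (g.mul g')).tendsto_inv (w.act (g.mul g')).inv_right
  filter_upwards [w.act_σ (g.mul g'), (w.act g).act_σ g', w.act_σ g, (w.act g).act_inv g', e,
    (w.act g).tendsto_inv.eventually g'.right_inv] with y h1 h2 h3 h4 h5 h6
  simp only [Function.comp_apply, id] at h6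
  rw [h1, h2, h3, h5, ← B.act_mul, ← h4]
  simp only [GaugeGerm.mul, h6]

/-- `W^{k,h}_m H` acts transitively on the fibres of `W^{k,h} Q`: the germ `g` with `w ⊙ g = w'`. -/
def FrameGerm.ratio {x : M} (w w' : FrameGerm B x) : GaugeGerm m EH H where
  α := w.inv ∘ w'.ε
  α_zero := by simp [w'.ε_zero, w.inv_base]
  α_diffeo := IsLocalDiffeomorphAt.comp (K := 𝓘(ℝ, Eu m)) (P := Eu m) w'.ε_diffeo (by rw [w'.ε_zero]; exact w.inv_diffeo)
  a y := B.div (w.σ (w'.ε y)) (w'.σ (w'.ε y))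
  a_smooth := B.smoothNear_div
    (SmoothNear.comp (by rw [w'.ε_zero]; exact w.σ_smooth) w'.ε_diffeo.smoothNear)
    (SmoothNear.comp (by rw [w'.ε_zero]; exact w'.σ_smooth) w'.ε_diffeo.smoothNear)
    (w'.tendsto_ε.eventually (by
      filter_upwards [w.σ_section, w'.σ_section] with y h h' using h.trans h'.symm))

theorem WFiber.act_ratio {x : M} (w w' : FrameGerm B x) :
    (WFiber.mk r w).act (JetGroup.mk r (w.ratio w')) = WFiber.mk r w' := by
  have h : (w.act (w.ratio w')).ε =ᶠ[𝓝 0] w'.ε := by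
    filter_upwards [w'.tendsto_ε.eventually w.inv_right] with y hy using hy
  have hi : (w.act (w.ratio w')).inv =ᶠ[𝓝 x] w'.inv := by
    refine w'.inv_unique (w.act (w.ratio w')).tendsto_inv ?_
    filter_upwards [(w.act (w.ratio w')).inv_right,
      (w.act (w.ratio w')).tendsto_inv.eventually h] with y h1 h2
    rw [← h2, h1]
  rw [mk_act]
  refine mk_eq h ?_
  filter_upwards [w.act_σ (w.ratio w'), hi, w'.inv_right, w.σ_section, w'.σ_section]
    with y h1 h2 h3 h4 h5
  rw [h1, h2]
  simp only [FrameGerm.ratio, h3]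
  exact B.act_div (h4.trans h5.symm)

theorem WFiber.act_free {x : M} (w : WFiber B r x) {g : JetGroup m r EH H} (h : w.act g = w) :
    g = 1 := by
  obtain ⟨w, rfl⟩ := w.exists_rep
  obtain ⟨g, rfl⟩ := g.exists_rep
  rw [mk_act] at h
  obtain ⟨h1, h2⟩ : (FrameGerm.setoid B r x).r (w.act g) w := Quotient.exact h
  have sα := g.α_diffeo.contMDiffAt
  have si : ContMDiffAt 𝓘(ℝ, Eu m) 𝓘(ℝ, Eu m) ∞ w.inv x := w.inv_smooth.contMDiffAt
  refine Quotient.sound ⟨?_, ?_⟩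
  · have e1 : JetEq 𝓘(ℝ, Eu m) 𝓘(ℝ, Eu m) r.k 0 (w.inv ∘ (w.act g).ε) (w.inv ∘ w.ε) :=
      JetEq.comp h1 (.refl _ _ _) (w.act g).ε_diffeo.contMDiffAt w.ε_diffeo.contMDiffAt
        (by rw [(w.act g).ε_zero]; exact si)
        (by rw [(w.act g).ε_zero]; exact si)
    refine (JetEq.of_eventuallyEq ?_).trans (e1.trans (JetEq.of_eventuallyEq w.inv_left))
    filter_upwards [g.tendsto_α.eventually w.inv_left] with y hy using hy.symm
  · have sec : ∀ w w' : FrameGerm B x, ∀ᶠ y in 𝓝 x, B.proj (w.σ y) = B.proj (w'.σ y) := by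
      intro w w'
      filter_upwards [w.σ_section, w'.σ_section] with y h h' using h.trans h'.symm
    have j1 := B.jetEq_div w.σ_smooth (w.act g).σ_smooth (sec _ _) h2.symm
    have sd := (B.smoothNear_div w.σ_smooth (w.act g).σ_smooth (sec _ _)).contMDiffAt
    have e0 := (w.act g).ε_zero
    have se := (w.act g).ε_diffeo.contMDiffAt
    have j2 := JetEq.comp (JetEq.refl r.h 0 (w.act g).ε) (by rw [e0]; exact j1) se se
      (by rw [e0]; exact sd) contMDiffAt_const
    refine (JetEq.of_eventuallyEq ?_).trans j2
    filter_upwards [(w.act g).inv_left, (w.act g).tendsto_ε.eventually (w.act_σ g)] with y h3 h4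
    simp only [Function.comp_apply]
    rw [h4, B.div_act, h3]

end Prolongation
end Principal

/-! ### Gauge-natural bundles -/

section GaugeNaturalBundle

variable {m : ℕ} {EH EQ EF : Type*} [NormedAddCommGroup EH] [NormedSpace ℝ EH]
  [NormedAddCommGroup EQ] [NormedSpace ℝ EQ] [NormedAddCommGroup EF] [NormedSpace ℝ EF]
  {M : Type*} [TopologicalSpace M] [ChartedSpace (Eu m) M]
  {H : Type*} [TopologicalSpace H] [ChartedSpace EH H] [Group H] [LieGroup 𝓘(ℝ, EH) ∞ H]
  {Q : Type*} [TopologicalSpace Q] [ChartedSpace EQ Q]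
  {F : Type*} [TopologicalSpace F] [ChartedSpace EF F]
  (B : PrincipalBundle m EH EQ M H Q) {r : GaugeOrder} (lam : JetAction m r EH H EF F)

/-- The equivalence relation `(w, f) ∼ (w ⊙ g, g⁻¹ · f)`. -/
def gaugeSetoid (x : M) : Setoid (WFiber B r x × F) where
  r p q := ∃ g : JetGroup m r EH H, q.1 = p.1.act g ∧ p.2 = lam.smul g q.2
  iseqv := by
    refine ⟨fun p => ⟨1, (WFiber.act_one _).symm, (lam.one_smul _).symm⟩, ?_, ?_⟩
    · rintro p q ⟨g, h1, h2⟩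
      refine ⟨g⁻¹, ?_, ?_⟩
      · rw [h1, ← WFiber.act_mul, mul_inv_cancel, WFiber.act_one]
      · rw [h2, ← lam.mul_smul, inv_mul_cancel, lam.one_smul]
    · rintro p q s ⟨g, h1, h2⟩ ⟨g', h1', h2'⟩
      exact ⟨g * g', by rw [h1', h1, WFiber.act_mul], by rw [h2, h2', lam.mul_smul]⟩

/-- The fibre over `x` of the associated bundle `W^{k,h} Q ×_λ F`. -/
def GaugeFiber (x : M) : Type _ := Quotient (gaugeSetoid B lam x)

/-- The gauge-natural bundle `Q_λ = W^{k,h} Q ×_λ F` of order `(k,h)` associated with `Q`. -/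
structure GaugeNaturalBundle where
  /-- The projection `Q_λ → M`. -/
  proj : M
  fibre : GaugeFiber B lam proj

variable {B}

/-- The class `[w, f]_λ` in the fibre over `x`. -/
def GaugeFiber.mk {x : M} (w : WFiber B r x) (f : F) : GaugeFiber B lam x := Quotient.mk _ (w, f)

variable {lam}

theorem GaugeFiber.mk_act {x : M} (w : WFiber B r x) (g : JetGroup m r EH H) (f : F) :
    GaugeFiber.mk lam (w.act g) f = GaugeFiber.mk lam w (lam.smul g f) :=
  (Quotient.sound (s := gaugeSetoid B lam x) ⟨g, rfl, rfl⟩).symm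

theorem GaugeFiber.mk_inj {x : M} {w : WFiber B r x} {f f' : F}
    (h : GaugeFiber.mk lam w f = GaugeFiber.mk lam w f') : f = f' := by
  obtain ⟨g, h1, h2⟩ : (gaugeSetoid B lam x).r (w, f) (w, f') := Quotient.exact h
  have : g = 1 := w.act_free h1.symm
  simpa [this, lam.one_smul] using h2

theorem GaugeFiber.exists_mk {x : M} (w : WFiber B r x) (q : GaugeFiber B lam x) :
    ∃ f, GaugeFiber.mk lam w f = q := by
  obtain ⟨⟨w', f⟩, rfl⟩ := Quotient.exists_rep q
  obtain ⟨w, rfl⟩ := w.exists_rep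
  obtain ⟨w', rfl⟩ := w'.exists_rep
  refine ⟨lam.smul (JetGroup.mk r (w.ratio w')) f, ?_⟩
  rw [← GaugeFiber.mk_act, WFiber.act_ratio]
  rfl

/-! #### The manifold structure of a gauge-natural bundle -/

variable [IsManifold 𝓘(ℝ, Eu m) ∞ M]

theorem translation_diffeo (c y : Eu m) :
    IsLocalDiffeomorphAt 𝓘(ℝ, Eu m) 𝓘(ℝ, Eu m) ∞ (fun z : Eu m => c + z) y :=
  ⟨⟨(Equiv.addLeft c).toPartialEquiv, isOpen_univ, isOpen_univ,
    (contMDiff_const.add contMDiff_id).contMDiffOn, (contMDiff_const.add contMDiff_id).contMDiffOn⟩,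
    trivial, fun _ _ => rfl⟩

theorem chart_diffeo {x₀ x : M} (hx : x ∈ (chartAt (Eu m) x₀).source) :
    IsLocalDiffeomorphAt 𝓘(ℝ, Eu m) 𝓘(ℝ, Eu m) ∞ (chartAt (Eu m) x₀) x :=
  ⟨⟨(chartAt (Eu m) x₀).toPartialEquiv, (chartAt (Eu m) x₀).open_source,
    (chartAt (Eu m) x₀).open_target, contMDiffOn_chart, contMDiffOn_chart_symm⟩,
    hx, fun _ _ => rfl⟩

theorem chart_symm_diffeo {x₀ : M} {y : Eu m} (hy : y ∈ (chartAt (Eu m) x₀).target) :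
    IsLocalDiffeomorphAt 𝓘(ℝ, Eu m) 𝓘(ℝ, Eu m) ∞ (chartAt (Eu m) x₀).symm y :=
  ⟨⟨(chartAt (Eu m) x₀).symm.toPartialEquiv, (chartAt (Eu m) x₀).open_target,
    (chartAt (Eu m) x₀).open_source, contMDiffOn_chart_symm, contMDiffOn_chart⟩,
    hy, fun _ _ => rfl⟩

/-- The element of `W^{k,h} Q` over `x` given by a chart of `M` centred at `x` and a local section
of `Q`. -/
def PrincipalBundle.frameGermAt (B : PrincipalBundle m EH EQ M H Q) {x₀ x : M}
    (hx : x ∈ B.dom x₀) : FrameGerm B x where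
  ε y := (chartAt (Eu m) x₀).symm (chartAt (Eu m) x₀ x + y)
  ε_zero := by simp [(chartAt (Eu m) x₀).left_inv hx.1]
  ε_diffeo := IsLocalDiffeomorphAt.comp (K := 𝓘(ℝ, Eu m)) (P := M)
    (g := (chartAt (Eu m) x₀).symm) (translation_diffeo _ _)
    (chart_symm_diffeo (by simpa using (chartAt (Eu m) x₀).map_source hx.1))
  σ := B.sectionAt x₀
  σ_smooth := B.sectionAt_smooth hx
  σ_section := by
    filter_upwards [(B.isOpen_dom x₀).mem_nhds hx] with y hy using B.sectionAt_proj hy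

/-- The coordinate `f ∈ F` of the point `[w, f]_λ`, for `w` the frame given by a chart of `M` and a
local section of `Q`. -/
def GaugeFiber.coord {x₀ x : M} (hx : x ∈ B.dom x₀) (q : GaugeFiber B lam x) : F :=
  (GaugeFiber.exists_mk (WFiber.mk r (B.frameGermAt hx)) q).choose

theorem GaugeFiber.mk_coord {x₀ x : M} (hx : x ∈ B.dom x₀) (q : GaugeFiber B lam x) :
    GaugeFiber.mk lam (WFiber.mk r (B.frameGermAt hx)) (q.coord hx) = q :=
  (GaugeFiber.exists_mk (WFiber.mk r (B.frameGermAt hx)) q).choose_spec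

theorem GaugeFiber.coord_mk {x₀ x : M} (hx : x ∈ B.dom x₀) (f : F) :
    (GaugeFiber.mk lam (WFiber.mk r (B.frameGermAt hx)) f).coord hx = f :=
  GaugeFiber.mk_inj (GaugeFiber.mk_coord hx _)

open Classical in
/-- The change of coordinates in the fibre over `x`. -/
def coordChange (B : PrincipalBundle m EH EQ M H Q) (lam : JetAction m r EH H EF F) (x₀ x₁ x : M)
    (f : F) : F :=
  if h : x ∈ B.dom x₀ ∧ x ∈ B.dom x₁ then
    (GaugeFiber.mk lam (WFiber.mk r (B.frameGermAt h.1)) f).coord h.2 else f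

/-- The change of frames in `W^{k,h} Q` between the frames given by two charts of `M` and local
sections of `Q`. -/
def PrincipalBundle.transGerm (B : PrincipalBundle m EH EQ M H Q) {x₀ x₁ x : M}
    (h₀ : x ∈ B.dom x₀) (h₁ : x ∈ B.dom x₁) : GaugeGerm m EH H where
  α y := -chartAt (Eu m) x₁ x + chartAt (Eu m) x₁ ((B.frameGermAt h₀).ε y)
  α_zero := by rw [(B.frameGermAt h₀).ε_zero, neg_add_cancel]
  α_diffeo := by
    have h : IsLocalDiffeomorphAt 𝓘(ℝ, Eu m) 𝓘(ℝ, Eu m) ∞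
        (chartAt (Eu m) x₁ ∘ (B.frameGermAt h₀).ε) 0 :=
      IsLocalDiffeomorphAt.comp (K := 𝓘(ℝ, Eu m)) (P := Eu m) (B.frameGermAt h₀).ε_diffeo
        (by rw [(B.frameGermAt h₀).ε_zero]; exact chart_diffeo h₁.1)
    exact IsLocalDiffeomorphAt.comp (K := 𝓘(ℝ, Eu m)) (P := Eu m) h (translation_diffeo _ _)
  a := ((B.frameGermAt h₁).ratio (B.frameGermAt h₀)).a
  a_smooth := ((B.frameGermAt h₁).ratio (B.frameGermAt h₀)).a_smooth

theorem coordChange_eq {x₀ x₁ x : M} (h₀ : x ∈ B.dom x₀) (h₁ : x ∈ B.dom x₁) (f : F) :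
    coordChange B lam x₀ x₁ x f = lam.smul (JetGroup.mk r (B.transGerm h₀ h₁)) f := by
  have key : JetGroup.mk r (B.transGerm h₀ h₁) =
      JetGroup.mk r ((B.frameGermAt h₁).ratio (B.frameGermAt h₀)) := by
    refine JetGroup.mk_eq ?_ (.of_eq rfl)
    have e : (fun z => -chartAt (Eu m) x₁ x + chartAt (Eu m) x₁ z) =ᶠ[𝓝 x]
        (B.frameGermAt h₁).inv := by
      refine (B.frameGermAt h₁).inv_unique ?_ ?_
      · have := (((chartAt (Eu m) x₁).continuousAt h₁.1).tendsto).const_add (-chartAt (Eu m) x₁ x)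
        rwa [neg_add_cancel] at this
      · filter_upwards [(chartAt (Eu m) x₁).open_source.mem_nhds h₁.1] with z hz
        simp [PrincipalBundle.frameGermAt, (chartAt (Eu m) x₁).left_inv hz]
    filter_upwards [(B.frameGermAt h₀).tendsto_ε.eventually e] with y hy using hy
  rw [coordChange, dif_pos ⟨h₀, h₁⟩, ← WFiber.act_ratio (B.frameGermAt h₁) (B.frameGermAt h₀),
    GaugeFiber.mk_act, GaugeFiber.coord_mk, key]

/-- The changes of coordinates in the fibres are smooth. -/
theorem contMDiffOn_coordChange (x₀ x₁ : M) :
    ContMDiffOn (𝓘(ℝ, Eu m).prod 𝓘(ℝ, EF)) 𝓘(ℝ, EF) ∞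
      (fun p : M × F => coordChange B lam x₀ x₁ p.1 p.2) ((B.dom x₀ ∩ B.dom x₁) ×ˢ univ) := by
  classical
  rintro ⟨x, f⟩ ⟨⟨h₀, h₁⟩, -⟩
  apply ContMDiffAt.contMDiffWithinAt
  set ψ₀ := chartAt (Eu m) x₀ with hψ₀
  set ψ₁ := chartAt (Eu m) x₁ with hψ₁
  have hO : IsOpen (B.dom x₀ ∩ B.dom x₁) := (B.isOpen_dom x₀).inter (B.isOpen_dom x₁)
  let g : Eu m → GaugeGerm m EH H := fun c =>
    if h : ψ₀.symm c ∈ B.dom x₀ ∧ ψ₀.symm c ∈ B.dom x₁ then B.transGerm h.1 h.2 else GaugeGerm.one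
  have hc0 : ψ₀ x ∈ ψ₀.target := ψ₀.map_source h₀.1
  have hsx : ψ₀.symm (ψ₀ x) = x := ψ₀.left_inv h₀.1
  have scs : SmoothNear 𝓘(ℝ, Eu m) 𝓘(ℝ, Eu m) ψ₀.symm (ψ₀ x) :=
    smoothNear_of_contMDiffOn (ψ₀.open_target.mem_nhds hc0) contMDiffOn_chart_symm
  have sc1 : SmoothNear 𝓘(ℝ, Eu m) 𝓘(ℝ, Eu m) ψ₁ x :=
    smoothNear_of_contMDiffOn (ψ₁.open_source.mem_nhds h₁.1) contMDiffOn_chart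
  have hgood : ∀ᶠ c in 𝓝 (ψ₀ x), (ψ₀.symm c ∈ B.dom x₀ ∧ ψ₀.symm c ∈ B.dom x₁) ∧ ψ₀ (ψ₀.symm c) = c := by
    refine Eventually.and ?_ ?_
    · exact scs.contMDiffAt.continuousAt.eventually (by rw [hsx]; exact hO.mem_nhds ⟨h₀, h₁⟩)
    · filter_upwards [ψ₀.open_target.mem_nhds hc0] with c hc using ψ₀.right_inv hc
  have hgood' : ∀ᶠ p : Eu m × Eu m in 𝓝 (ψ₀ x, 0),
      (ψ₀.symm p.1 ∈ B.dom x₀ ∧ ψ₀.symm p.1 ∈ B.dom x₁) ∧ ψ₀ (ψ₀.symm p.1) = p.1 :=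
    (continuous_fst.tendsto (ψ₀ x, (0 : Eu m))).eventually hgood
  have sadd : SmoothNear 𝓘(ℝ, Eu m × Eu m) 𝓘(ℝ, Eu m)
      (fun p : Eu m × Eu m => ψ₀.symm (p.1 + p.2)) (ψ₀ x, 0) :=
    SmoothNear.comp (f := fun p : Eu m × Eu m => p.1 + p.2) (by simpa using scs)
      ((contDiff_fst.add contDiff_snd).contMDiff.smoothNear _)
  have sfst : SmoothNear 𝓘(ℝ, Eu m × Eu m) 𝓘(ℝ, Eu m)
      (fun p : Eu m × Eu m => ψ₀.symm p.1) (ψ₀ x, 0) :=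
    SmoothNear.comp (f := fun p : Eu m × Eu m => p.1) scs (contDiff_fst.contMDiff.smoothNear _)
  have main := lam.smooth (Eu m) g (ψ₀ x) ?_ ?_ f
  · have hcomp : ContMDiffAt (𝓘(ℝ, Eu m).prod 𝓘(ℝ, EF)) (𝓘(ℝ, Eu m).prod 𝓘(ℝ, EF)) ∞
        (fun p : M × F => (ψ₀ p.1, p.2)) (x, f) :=
      ((contMDiffOn_chart.contMDiffAt (ψ₀.open_source.mem_nhds h₀.1)).comp (x, f)
        contMDiffAt_fst).prodMk contMDiffAt_snd
    refine (ContMDiffAt.comp (x, f) main hcomp).congr_of_eventuallyEq ?_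
    filter_upwards [continuousAt_fst.eventually (hO.mem_nhds ⟨h₀, h₁⟩)] with p hp
    have hp : p.1 ∈ B.dom x₀ ∧ p.1 ∈ B.dom x₁ := hp
    have hp' : ψ₀.symm (ψ₀ p.1) = p.1 := ψ₀.left_inv hp.1.1
    have e : ∀ x (hx : x = p.1), coordChange B lam x₀ x₁ x p.2 = lam.smul (JetGroup.mk r
        (if h : x ∈ B.dom x₀ ∧ x ∈ B.dom x₁ then B.transGerm h.1 h.2 else GaugeGerm.one)) p.2 := by
      rintro x rfl
      rw [dif_pos hp, coordChange_eq hp.1 hp.2]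
    have := e _ hp'
    rw [hp'] at this
    simp only [Function.comp_apply, g, hp']
    exact this
  · have sα : SmoothNear 𝓘(ℝ, Eu m × Eu m) 𝓘(ℝ, Eu m)
        (fun p : Eu m × Eu m => -ψ₁ (ψ₀.symm p.1) + ψ₁ (ψ₀.symm (p.1 + p.2))) (ψ₀ x, 0) := by
      have t1 := SmoothNear.comp (g := ψ₁) (by simpa [hsx] using sc1) sadd
      have t2 := SmoothNear.comp (g := ψ₁) (by simpa [hsx] using sc1) sfst
      filter_upwards [t1, t2] with p h1 h2
      exact h2.neg.add h1
    refine sα.congr ?_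
    filter_upwards [hgood'] with p hp
    simp only [g, dif_pos hp.1, PrincipalBundle.transGerm, PrincipalBundle.frameGermAt, ← hψ₀,
      ← hψ₁, hp.2]
  · have t0 := SmoothNear.comp (g := B.sectionAt x₀)
      (by simpa [hsx] using B.sectionAt_smooth h₀) sadd
    have t1 := SmoothNear.comp (g := B.sectionAt x₁)
      (by simpa [hsx] using B.sectionAt_smooth h₁) sadd
    have hadd : ∀ᶠ p : Eu m × Eu m in 𝓝 (ψ₀ x, 0),
        ψ₀.symm (p.1 + p.2) ∈ B.dom x₀ ∩ B.dom x₁ :=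
      sadd.contMDiffAt.continuousAt.eventually
        (by simpa [hsx] using hO.mem_nhds ⟨h₀, h₁⟩)
    refine (B.smoothNear_div t1 t0 ?_).congr ?_
    · filter_upwards [hadd] with p hp
      simp only [Function.comp_apply, B.sectionAt_proj hp.1, B.sectionAt_proj hp.2]
    · filter_upwards [hgood'] with p hp
      simp only [g, dif_pos hp.1, PrincipalBundle.transGerm, FrameGerm.ratio,
        PrincipalBundle.frameGermAt, ← hψ₀, hp.2, Function.comp_apply]

open Classical in
/-- The coordinate in `F` of a point of `Q_λ` over `dom x₀` (and `f₀` elsewhere). -/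
def GaugeNaturalBundle.coordAt (x₀ : M) (f₀ : F) (q : GaugeNaturalBundle B lam) : F :=
  if h : q.1 ∈ B.dom x₀ then q.2.coord h else f₀

open Classical in
/-- The point of `Q_λ` over `x ∈ dom x₀` with coordinate `f`. -/
def GaugeNaturalBundle.ofCoord (B : PrincipalBundle m EH EQ M H Q) (lam : JetAction m r EH H EF F)
    (x₀ : M) (f₀ : F) (x : M) (f : F) : GaugeNaturalBundle B lam :=
  if h : x ∈ B.dom x₀ then ⟨x, GaugeFiber.mk lam (WFiber.mk r (B.frameGermAt h)) f⟩
  else ⟨x₀, GaugeFiber.mk lam (WFiber.mk r (B.frameGermAt (B.mem_dom x₀))) f₀⟩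

theorem GaugeNaturalBundle.ofCoord_fst {x₀ x : M} (f₀ f : F) (hx : x ∈ B.dom x₀) :
    (ofCoord B lam x₀ f₀ x f).1 = x := by rw [ofCoord, dif_pos hx]

theorem GaugeNaturalBundle.coordAt_ofCoord {x₀ x₁ x : M} (f₀ f₁ f : F) (h₀ : x ∈ B.dom x₀)
    (h₁ : x ∈ B.dom x₁) :
    coordAt x₁ f₁ (ofCoord B lam x₀ f₀ x f) = coordChange B lam x₀ x₁ x f := by
  rw [coordChange, dif_pos ⟨h₀, h₁⟩, ofCoord, dif_pos h₀, coordAt, dif_pos]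

theorem GaugeNaturalBundle.coordAt_ofCoord_self {x₀ x : M} (f₀ f : F) (h₀ : x ∈ B.dom x₀) :
    coordAt x₀ f₀ (ofCoord B lam x₀ f₀ x f) = f := by
  rw [ofCoord, dif_pos h₀, coordAt, dif_pos h₀, GaugeFiber.coord_mk]

theorem GaugeNaturalBundle.ofCoord_coordAt {x₀ : M} (f₀ : F) (q : GaugeNaturalBundle B lam)
    (h₀ : q.1 ∈ B.dom x₀) : ofCoord B lam x₀ f₀ q.1 (coordAt x₀ f₀ q) = q := by
  rw [ofCoord, dif_pos h₀, coordAt, dif_pos h₀, GaugeFiber.mk_coord]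

/-- The chart `[w_x, f]_λ ↦ (x, f)` of `Q_λ`, read in a chart of `M` around `x₀` and in a chart of
`F` around `f₀`, where `w_x` is the frame at `x` given by the chart of `M` and a local section of
`Q`. -/
def gaugeChart (B : PrincipalBundle m EH EQ M H Q) (lam : JetAction m r EH H EF F)
    (x₀ : M) (f₀ : F) : PartialEquiv (GaugeNaturalBundle B lam) (Eu m × EF) where
  toFun q := (chartAt (Eu m) x₀ q.1, chartAt EF f₀ (q.coordAt x₀ f₀))
  invFun p := GaugeNaturalBundle.ofCoord B lam x₀ f₀ ((chartAt (Eu m) x₀).symm p.1)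
    ((chartAt EF f₀).symm p.2)
  source := {q | q.1 ∈ B.dom x₀ ∧ q.coordAt x₀ f₀ ∈ (chartAt EF f₀).source}
  target := {p | (p.1 ∈ (chartAt (Eu m) x₀).target ∧ (chartAt (Eu m) x₀).symm p.1 ∈ B.dom x₀) ∧
    p.2 ∈ (chartAt EF f₀).target}
  map_source' q hq := by
    refine ⟨⟨(chartAt (Eu m) x₀).map_source hq.1.1, ?_⟩, (chartAt EF f₀).map_source hq.2⟩
    rw [(chartAt (Eu m) x₀).left_inv hq.1.1]
    exact hq.1
  map_target' p hp := by
    refine ⟨?_, ?_⟩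
    · rw [GaugeNaturalBundle.ofCoord_fst _ _ hp.1.2]
      exact hp.1.2
    · rw [GaugeNaturalBundle.coordAt_ofCoord_self _ _ hp.1.2]
      exact (chartAt EF f₀).map_target hp.2
  left_inv' q hq := by
    rw [(chartAt (Eu m) x₀).left_inv hq.1.1, (chartAt EF f₀).left_inv hq.2,
      GaugeNaturalBundle.ofCoord_coordAt _ _ hq.1]
  right_inv' p hp := by
    rw [GaugeNaturalBundle.ofCoord_fst _ _ hp.1.2,
      GaugeNaturalBundle.coordAt_ofCoord_self _ _ hp.1.2, (chartAt (Eu m) x₀).right_inv hp.1.1,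
      (chartAt EF f₀).right_inv hp.2]

variable [IsManifold 𝓘(ℝ, EF) ∞ F]

/-- The changes of charts of `Q_λ` have open domains and are smooth. -/
theorem gaugeChart_transition (x₀ x₁ : M) (f₀ f₁ : F) :
    IsOpen ((gaugeChart B lam x₀ f₀).symm.trans (gaugeChart B lam x₁ f₁)).source ∧
    ContDiffOn ℝ ∞ ((gaugeChart B lam x₀ f₀).symm.trans (gaugeChart B lam x₁ f₁))
      ((gaugeChart B lam x₀ f₀).symm.trans (gaugeChart B lam x₁ f₁)).source := by
  set ψ₀ := chartAt (Eu m) x₀ with hψ₀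
  set ψ₁ := chartAt (Eu m) x₁ with hψ₁
  set χ₀ := chartAt EF f₀ with hχ₀
  set χ₁ := chartAt EF f₁ with hχ₁
  let I := 𝓘(ℝ, Eu m × EF)
  let D : Set (M × F) := (B.dom x₀ ∩ B.dom x₁) ×ˢ univ
  have hD : IsOpen D := ((B.isOpen_dom x₀).inter (B.isOpen_dom x₁)).prod isOpen_univ
  let T : M × F → F := fun p => coordChange B lam x₀ x₁ p.1 p.2
  have hT : ContMDiffOn (𝓘(ℝ, Eu m).prod 𝓘(ℝ, EF)) 𝓘(ℝ, EF) ∞ T D := contMDiffOn_coordChange x₀ x₁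
  let W : Set (M × F) := D ∩ T ⁻¹' χ₁.source
  have hW : IsOpen W := hT.continuousOn.isOpen_inter_preimage hD χ₁.open_source
  let S : Eu m × EF → M × F := fun p => (ψ₀.symm p.1, χ₀.symm p.2)
  let A : Set (Eu m × EF) := ψ₀.target ×ˢ χ₀.target
  have hA : IsOpen A := ψ₀.open_target.prod χ₀.open_target
  have hS : ContMDiffOn I (𝓘(ℝ, Eu m).prod 𝓘(ℝ, EF)) ∞ S A := by
    refine ContMDiffOn.prodMk ?_ ?_
    · exact (contMDiffOn_chart_symm (I := 𝓘(ℝ, Eu m)) (x := x₀)).comp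
        contDiff_fst.contMDiff.contMDiffOn (fun p hp => hp.1)
    · exact (contMDiffOn_chart_symm (I := 𝓘(ℝ, EF)) (x := f₀)).comp
        contDiff_snd.contMDiff.contMDiffOn (fun p hp => hp.2)
  have hsrc : ((gaugeChart B lam x₀ f₀).symm.trans (gaugeChart B lam x₁ f₁)).source =
      A ∩ S ⁻¹' W := by
    ext p
    simp only [PartialEquiv.trans_source, PartialEquiv.symm_source, mem_inter_iff, mem_preimage]
    constructor
    · rintro ⟨⟨⟨h1, h2⟩, h3⟩, h4, h5⟩
      have h4' : ψ₀.symm p.1 ∈ B.dom x₁ := by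
        have := GaugeNaturalBundle.ofCoord_fst (B := B) (lam := lam) f₀ (χ₀.symm p.2) h2
        rw [← this]; exact h4
      refine ⟨⟨h1, h3⟩, ⟨⟨h2, h4'⟩, trivial⟩, ?_⟩
      have := GaugeNaturalBundle.coordAt_ofCoord (B := B) (lam := lam) f₀ f₁ (χ₀.symm p.2) h2 h4'
      show coordChange B lam x₀ x₁ (ψ₀.symm p.1) (χ₀.symm p.2) ∈ χ₁.source
      rw [← this]; exact h5
    · rintro ⟨⟨h1, h3⟩, ⟨⟨h2, h4⟩, -⟩, h5⟩
      refine ⟨⟨⟨h1, h2⟩, h3⟩, ?_, ?_⟩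
      · have := GaugeNaturalBundle.ofCoord_fst (B := B) (lam := lam) f₀ (χ₀.symm p.2) h2
        show (GaugeNaturalBundle.ofCoord B lam x₀ f₀ (ψ₀.symm p.1) (χ₀.symm p.2)).1 ∈ B.dom x₁
        rw [this]; exact h4
      · have := GaugeNaturalBundle.coordAt_ofCoord (B := B) (lam := lam) f₀ f₁ (χ₀.symm p.2) h2 h4
        show GaugeNaturalBundle.coordAt x₁ f₁
          (GaugeNaturalBundle.ofCoord B lam x₀ f₀ (ψ₀.symm p.1) (χ₀.symm p.2)) ∈ χ₁.source
        rw [this]; exact h5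
  have hopen : IsOpen (A ∩ S ⁻¹' W) := hS.continuousOn.isOpen_inter_preimage hA hW
  rw [hsrc]
  refine ⟨hopen, ?_⟩
  rw [← contMDiffOn_iff_contDiffOn]
  have hSW : ContMDiffOn I (𝓘(ℝ, Eu m).prod 𝓘(ℝ, EF)) ∞ S (A ∩ S ⁻¹' W) :=
    hS.mono inter_subset_left
  have hTW : ContMDiffOn I 𝓘(ℝ, EF) ∞ (χ₁ ∘ T ∘ S) (A ∩ S ⁻¹' W) :=
    (contMDiffOn_chart (I := 𝓘(ℝ, EF)) (x := f₁)).comp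
      (hT.comp hSW (fun p hp => hp.2.1)) (fun p hp => hp.2.2)
  have hMW : ContMDiffOn I 𝓘(ℝ, Eu m) ∞ (fun p => ψ₁ (S p).1) (A ∩ S ⁻¹' W) :=
    (contMDiffOn_chart (I := 𝓘(ℝ, Eu m)) (x := x₁)).comp
      (contMDiff_fst.comp_contMDiffOn hSW) (fun p hp => hp.2.1.1.2.1)
  refine (hMW.prodMk_space hTW).congr ?_
  rintro p ⟨-, ⟨⟨h2, h4⟩, -⟩, -⟩
  have e1 := GaugeNaturalBundle.ofCoord_fst (B := B) (lam := lam) f₀ (χ₀.symm p.2) h2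
  have e2 := GaugeNaturalBundle.coordAt_ofCoord (B := B) (lam := lam) f₀ f₁ (χ₀.symm p.2) h2 h4
  exact Prod.ext (congrArg ψ₁ e1) (congrArg χ₁ e2)

/-- The charts of `Q_λ`. -/
def gaugeCore (B : PrincipalBundle m EH EQ M H Q) (lam : JetAction m r EH H EF F) :
    ChartedSpaceCore (Eu m × EF) (GaugeNaturalBundle B lam) where
  atlas := {e | ∃ x₀ f₀, e = gaugeChart B lam x₀ f₀}
  chartAt q := gaugeChart B lam q.1 (q.2.coord (B.mem_dom q.1))
  mem_chart_source q := by
    refine ⟨B.mem_dom q.1, ?_⟩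
    rw [GaugeNaturalBundle.coordAt, dif_pos (B.mem_dom q.1)]
    exact mem_chart_source _ _
  chart_mem_atlas q := ⟨_, _, rfl⟩
  open_source := by
    rintro _ _ ⟨x₀, f₀, rfl⟩ ⟨x₁, f₁, rfl⟩
    exact (gaugeChart_transition x₀ x₁ f₀ f₁).1
  continuousOn_toFun := by
    rintro _ _ ⟨x₀, f₀, rfl⟩ ⟨x₁, f₁, rfl⟩
    exact (gaugeChart_transition x₀ x₁ f₀ f₁).2.continuousOn

instance GaugeNaturalBundle.instTopologicalSpace : TopologicalSpace (GaugeNaturalBundle B lam) :=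
  (gaugeCore B lam).toTopologicalSpace

instance GaugeNaturalBundle.instChartedSpace :
    ChartedSpace (Eu m × EF) (GaugeNaturalBundle B lam) :=
  (gaugeCore B lam).toChartedSpace

instance GaugeNaturalBundle.instIsManifold :
    IsManifold 𝓘(ℝ, Eu m × EF) ∞ (GaugeNaturalBundle B lam) := by
  apply isManifold_of_contDiffOn
  intro e e' he he'
  obtain ⟨_, ⟨x₀, f₀, rfl⟩, rfl⟩ : ∃ c, ∃ hc : c ∈ (gaugeCore B lam).atlas,
      e = (gaugeCore B lam).openPartialHomeomorph c hc := by
    simpa [atlas, ChartedSpace.atlas, ChartedSpaceCore.toChartedSpace] using he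
  obtain ⟨_, ⟨x₁, f₁, rfl⟩, rfl⟩ : ∃ c, ∃ hc : c ∈ (gaugeCore B lam).atlas,
      e' = (gaugeCore B lam).openPartialHomeomorph c hc := by
    simpa [atlas, ChartedSpace.atlas, ChartedSpaceCore.toChartedSpace] using he'
  have h := (gaugeChart_transition (B := B) (lam := lam) x₀ x₁ f₀ f₁).2
  simp only [modelWithCornersSelf_coe, modelWithCornersSelf_coe_symm, Function.comp_id,
    Function.id_comp, preimage_id, range_id, inter_univ]
  exact h

end GaugeNaturalBundle

/-! ### Automorphisms and the maps they induce on gauge-natural bundles -/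

section Automorphisms

variable {m : ℕ} {EH EQ EF : Type*} [NormedAddCommGroup EH] [NormedSpace ℝ EH]
  [NormedAddCommGroup EQ] [NormedSpace ℝ EQ] [NormedAddCommGroup EF] [NormedSpace ℝ EF]
  {M : Type*} [TopologicalSpace M] [ChartedSpace (Eu m) M]
  {H : Type*} [TopologicalSpace H] [ChartedSpace EH H] [Group H]
  {Q : Type*} [TopologicalSpace Q] [ChartedSpace EQ Q]
  {F : Type*} [TopologicalSpace F] [ChartedSpace EF F]

/-- A principal automorphism `Φ` of `Q` over a diffeomorphism `φ` of `M`, possibly only defined over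
an open subset of `M`: `φ` is a diffeomorphism between open subsets `U`, `V` of `M`, and `Φ` is an
`H`-equivariant diffeomorphism `π⁻¹(U) → π⁻¹(V)` with `π ∘ Φ = φ ∘ π`. For `U = V = M` this is a
principal automorphism of `Q`. -/
structure LocalAutomorphism (B : PrincipalBundle m EH EQ M H Q) where
  base : PartialDiffeomorph 𝓘(ℝ, Eu m) 𝓘(ℝ, Eu m) M M ∞
  total : PartialDiffeomorph 𝓘(ℝ, EQ) 𝓘(ℝ, EQ) Q Q ∞
  source_eq : total.source = B.proj ⁻¹' base.source
  target_eq : total.target = B.proj ⁻¹' base.target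
  proj_apply : ∀ u ∈ total.source, B.proj (total u) = base (B.proj u)
  map_act : ∀ u ∈ total.source, ∀ a, total (B.act u a) = B.act (total u) a

namespace LocalAutomorphism

variable {B : PrincipalBundle m EH EQ M H Q} (A : LocalAutomorphism B) {x : M}

theorem symm_base (hx : x ∈ A.base.source) : A.base.symm (A.base x) = x := A.base.left_inv hx

theorem smooth_base (hx : x ∈ A.base.source) : SmoothNear 𝓘(ℝ, Eu m) 𝓘(ℝ, Eu m) A.base x :=
  smoothNear_of_contMDiffOn (A.base.open_source.mem_nhds hx) A.base.contMDiffOn_toFun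

theorem smooth_base_symm (hx : x ∈ A.base.source) :
    SmoothNear 𝓘(ℝ, Eu m) 𝓘(ℝ, Eu m) A.base.symm (A.base x) :=
  smoothNear_of_contMDiffOn (A.base.open_target.mem_nhds (A.base.map_source hx))
    A.base.contMDiffOn_invFun

theorem tendsto_base_symm (hx : x ∈ A.base.source) :
    Tendsto A.base.symm (𝓝 (A.base x)) (𝓝 x) := by
  have := (A.smooth_base_symm hx).contMDiffAt.continuousAt.tendsto
  rwa [A.symm_base hx] at this

theorem base_symm (hx : x ∈ A.base.source) :
    ∀ᶠ y in 𝓝 (A.base x), A.base.symm y ∈ A.base.source ∧ A.base (A.base.symm y) = y := by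
  filter_upwards [A.base.open_target.mem_nhds (A.base.map_source hx)] with y hy
  exact ⟨A.base.map_target hy, A.base.right_inv hy⟩

theorem mem_source (hx : x ∈ A.base.source) (w : FrameGerm B x) : w.σ x ∈ A.total.source := by
  rw [A.source_eq, mem_preimage, w.σ_section.self_of_nhds]
  exact hx

theorem smooth_total {u : Q} (hu : u ∈ A.total.source) :
    SmoothNear 𝓘(ℝ, EQ) 𝓘(ℝ, EQ) A.total u :=
  smoothNear_of_contMDiffOn (A.total.open_source.mem_nhds hu) A.total.contMDiffOn_toFun

/-- The prolongation `(ε, σ) ↦ (φ ∘ ε, Φ ∘ σ ∘ φ⁻¹)` on representatives. -/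
def mapGerm (hx : x ∈ A.base.source) (w : FrameGerm B x) : FrameGerm B (A.base x) where
  ε := A.base ∘ w.ε
  ε_zero := by simp [w.ε_zero]
  ε_diffeo := IsLocalDiffeomorphAt.comp (K := 𝓘(ℝ, Eu m)) (P := M) w.ε_diffeo
    (by rw [w.ε_zero]; exact ⟨A.base, hx, fun _ _ => rfl⟩)
  σ := A.total ∘ w.σ ∘ A.base.symm
  σ_smooth := SmoothNear.comp
    (by
      simp only [Function.comp_apply, A.symm_base hx]
      exact A.smooth_total (A.mem_source hx w))
    (SmoothNear.comp (by rw [A.symm_base hx]; exact w.σ_smooth) (A.smooth_base_symm hx))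
  σ_section := by
    filter_upwards [A.base_symm hx, (A.tendsto_base_symm hx).eventually w.σ_section] with y h1 h2
    simp only [Function.comp_apply]
    rw [A.proj_apply, h2, h1.2]
    rw [A.source_eq, mem_preimage, h2]
    exact h1.1

variable {r : GaugeOrder}

theorem mapGerm_rel (hx : x ∈ A.base.source) {w w' : FrameGerm B x}
    (h : (FrameGerm.setoid B r x).r w w') :
    (FrameGerm.setoid B r (A.base x)).r (A.mapGerm hx w) (A.mapGerm hx w') := by
  have sb := (A.smooth_base hx).contMDiffAt
  have ss := (A.smooth_base_symm hx).contMDiffAt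
  have st : ∀ w : FrameGerm B x, ContMDiffAt 𝓘(ℝ, EQ) 𝓘(ℝ, EQ) ∞ A.total (w.σ x) :=
    fun w => (A.smooth_total (A.mem_source hx w)).contMDiffAt
  have sσ : ∀ w : FrameGerm B x, ContMDiffAt 𝓘(ℝ, Eu m) 𝓘(ℝ, EQ) ∞ w.σ (A.base.symm (A.base x)) :=
    fun w => by rw [A.symm_base hx]; exact w.σ_smooth.contMDiffAt
  have st' : ∀ w : FrameGerm B x, ContMDiffAt 𝓘(ℝ, EQ) 𝓘(ℝ, EQ) ∞ A.total
      ((w.σ ∘ A.base.symm) (A.base x)) := fun w => by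
    simp only [Function.comp_apply, A.symm_base hx]; exact st w
  have j : JetEq 𝓘(ℝ, Eu m) 𝓘(ℝ, EQ) r.h (A.base x) (w.σ ∘ A.base.symm) (w'.σ ∘ A.base.symm) :=
    JetEq.comp (.refl _ _ _) (by rw [A.symm_base hx]; exact h.2) ss ss (sσ w) (sσ w')
  have k : JetEq 𝓘(ℝ, Eu m) 𝓘(ℝ, Eu m) r.k 0 (A.base ∘ w.ε) (A.base ∘ w'.ε) :=
    JetEq.comp (g := A.base) (g' := A.base) h.1 (.refl _ _ _) w.ε_diffeo.contMDiffAt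
      w'.ε_diffeo.contMDiffAt (by rw [w.ε_zero]; exact sb) (by rw [w.ε_zero]; exact sb)
  refine ⟨k, ?_⟩
  exact JetEq.comp (g := A.total) (g' := A.total) j (.refl _ _ _) ((sσ w).comp _ ss)
    ((sσ w').comp _ ss) (st' w) (st' w)

/-- The prolongation `W^{k,h} Φ : (j^k_0 ε, j^h_x σ) ↦ (j^k_0 (φ ∘ ε), j^h_{φ(x)} (Φ ∘ σ ∘ φ⁻¹))`. -/
def prolong (hx : x ∈ A.base.source) : WFiber B r x → WFiber B r (A.base x) :=
  Quotient.map (A.mapGerm hx) fun _ _ h => A.mapGerm_rel hx h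

theorem prolong_mk (hx : x ∈ A.base.source) (w : FrameGerm B x) :
    A.prolong hx (WFiber.mk r w) = WFiber.mk r (A.mapGerm hx w) := rfl

/-- `W^{k,h} Φ` commutes with the right action of `W^{k,h}_m H`. -/
theorem prolong_act (hx : x ∈ A.base.source) (w : WFiber B r x) (g : JetGroup m r EH H) :
    A.prolong hx (w.act g) = (A.prolong hx w).act g := by
  obtain ⟨w, rfl⟩ := w.exists_rep
  obtain ⟨g, rfl⟩ := g.exists_rep
  rw [WFiber.mk_act, prolong_mk, prolong_mk, WFiber.mk_act]
  refine WFiber.mk_eq (.of_eq rfl) ?_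
  have e : (w.act g).inv ∘ A.base.symm =ᶠ[𝓝 (A.base x)] ((A.mapGerm hx w).act g).inv := by
    refine FrameGerm.inv_unique _ ((w.act g).tendsto_inv.comp (A.tendsto_base_symm hx)) ?_
    filter_upwards [A.base_symm hx, (A.tendsto_base_symm hx).eventually (w.act g).inv_right]
      with y h1 h2
    show A.base ((w.act g).ε ((w.act g).inv (A.base.symm y))) = y
    rw [h2, h1.2]
  filter_upwards [e, (A.mapGerm hx w).act_σ g, A.base_symm hx,
    (A.tendsto_base_symm hx).eventually (w.act_σ g),
    (A.tendsto_base_symm hx).eventually w.σ_section] with y h1 h2 h3 h4 h5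
  rw [h2, ← h1]
  show A.total ((w.act g).σ (A.base.symm y)) = B.act (A.total (w.σ (A.base.symm y))) _
  rw [h4, A.map_act]
  · rfl
  · rw [A.source_eq, mem_preimage, h5]
    exact h3.1

variable [LieGroup 𝓘(ℝ, EH) ∞ H] {lam : JetAction m r EH H EF F}

/-- The map `[w, f]_λ ↦ [W^{k,h} Φ (w), f]_λ` on the fibres of `Q_λ`. -/
def mapFiber (hx : x ∈ A.base.source) : GaugeFiber B lam x → GaugeFiber B lam (A.base x) :=
  Quotient.map (fun p => (A.prolong hx p.1, p.2)) fun p q ⟨g, h1, h2⟩ =>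
    ⟨g, by simp only [h1, A.prolong_act], h2⟩

open Classical in
/-- The map `Φ_λ : Q_λ → Q_λ`, `[w, f]_λ ↦ [W^{k,h} Φ (w), f]_λ` induced by `Φ`; it is defined over
the domain `U` of `φ` (and extended by the identity outside). -/
def induced (A : LocalAutomorphism B) (q : GaugeNaturalBundle B lam) : GaugeNaturalBundle B lam :=
  if hx : q.proj ∈ A.base.source then ⟨A.base q.proj, A.mapFiber hx q.fibre⟩ else q

end LocalAutomorphism

end Automorphisms

/-! ### Flows -/

section Flow

variable {E : Type*} [NormedAddCommGroup E] [NormedSpace ℝ E]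
  {N : Type*} [TopologicalSpace N] [ChartedSpace E N]

/-- A smooth vector field. -/
def SmoothField [IsManifold 𝓘(ℝ, E) ∞ N] (X : ∀ x : N, TangentSpace 𝓘(ℝ, E) x) : Prop :=
  ContMDiff 𝓘(ℝ, E) 𝓘(ℝ, E).tangent ∞ (fun x => (⟨x, X x⟩ : TangentBundle 𝓘(ℝ, E) N))

/-- The domain of the maximal flow of `X`: the pairs `(t, x)` such that the integral curve of `X`
starting at `x` is defined up to time `t`. -/
def flowDomain (X : ∀ x : N, TangentSpace 𝓘(ℝ, E) x) : Set (ℝ × N) :=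
  {p | ∃ (γ : ℝ → N) (a b : ℝ), 0 ∈ Ioo a b ∧ p.1 ∈ Ioo a b ∧ γ 0 = p.2 ∧
    IsMIntegralCurveOn (I := 𝓘(ℝ, E)) γ X (Ioo a b)}

open Classical in
/-- The maximal flow `(t, x) ↦ φ_t(x)` of `X` (equal to `x` outside of the domain of the flow). -/
def flow (X : ∀ x : N, TangentSpace 𝓘(ℝ, E) x) (t : ℝ) (x : N) : N :=
  if h : (t, x) ∈ flowDomain X then h.choose t else x

end Flow

/-! ### Reductive `G`-structures and generalized Kosmann vector fields -/

section Reductive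

variable {m : ℕ} {EG EH EP EQ : Type*} [NormedAddCommGroup EG] [NormedSpace ℝ EG]
  [NormedAddCommGroup EH] [NormedSpace ℝ EH] [NormedAddCommGroup EP] [NormedSpace ℝ EP]
  [NormedAddCommGroup EQ] [NormedSpace ℝ EQ]
  {M : Type*} [TopologicalSpace M] [ChartedSpace (Eu m) M]
  {G : Type*} [TopologicalSpace G] [ChartedSpace EG G] [Group G]
  {H : Type*} [TopologicalSpace H] [ChartedSpace EH H] [Group H]
  {P : Type*} [TopologicalSpace P] [ChartedSpace EP P]
  {Q : Type*} [TopologicalSpace Q] [ChartedSpace EQ Q]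

namespace PrincipalBundle

variable (B : PrincipalBundle m EH EQ M H Q)

/-- The vector field `Ξ` on `Q` is `H`-invariant. -/
def InvariantField (Ξ : ∀ u : Q, TangentSpace 𝓘(ℝ, EQ) u) : Prop :=
  ∀ (a : H) (u : Q),
    mfderiv 𝓘(ℝ, EQ) 𝓘(ℝ, EQ) (fun v => B.act v a) u (Ξ u) = Ξ (B.act u a)

/-- The vector field `Ξ` on `Q` projects on the vector field `ξ` on `M`. -/
def ProjectsOn (Ξ : ∀ u : Q, TangentSpace 𝓘(ℝ, EQ) u)
    (ξ : ∀ x : M, TangentSpace 𝓘(ℝ, Eu m) x) : Prop :=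
  ∀ u : Q, mfderiv 𝓘(ℝ, EQ) 𝓘(ℝ, Eu m) B.proj u (Ξ u) = ξ (B.proj u)

/-- The fundamental vector at `u ∈ Q` of an element `v` of the Lie algebra of `H`, that is the
derivative at `e` of `a ↦ u · a` in the direction `v`. -/
def fundamental (u : Q) : GroupLieAlgebra 𝓘(ℝ, EH) H →L[ℝ] EQ :=
  mfderiv 𝓘(ℝ, EH) 𝓘(ℝ, EQ) (fun a => B.act u a) 1

end PrincipalBundle

/-- The adjoint representation `Ad_a`, the derivative at `e` of `b ↦ a b a⁻¹`. -/
def Ad (EH : Type*) [NormedAddCommGroup EH] [NormedSpace ℝ EH] {H : Type*} [TopologicalSpace H]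
    [ChartedSpace EH H] [Group H] (a : H) : EH →L[ℝ] EH :=
  mfderiv 𝓘(ℝ, EH) 𝓘(ℝ, EH) (fun b : H => a * b * a⁻¹) 1

/-- A reductive `G`-structure on the principal bundle `Q(M,H)`: a Lie subgroup `ι : G → H` (an
injective immersive homomorphism of Lie groups) with a direct sum decomposition `𝔥 = 𝔤 ⊕ 𝔪` for
which `𝔪` is `Ad_G`-invariant, and a principal subbundle `i : P → Q` over the identity of `M`, whose
structure group is `G`. -/
structure ReductiveStructure (BP : PrincipalBundle m EG EP M G P)
    (BQ : PrincipalBundle m EH EQ M H Q) where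
  hom : G →* H
  contMDiff_hom : ContMDiff 𝓘(ℝ, EG) 𝓘(ℝ, EH) ∞ hom
  hom_injective : Function.Injective hom
  mfderiv_hom_injective : Function.Injective (mfderiv 𝓘(ℝ, EG) 𝓘(ℝ, EH) hom 1)
  compl : Submodule ℝ EH
  isCompl : IsCompl
    (LinearMap.range (mfderiv 𝓘(ℝ, EG) 𝓘(ℝ, EH) hom 1 : EG →L[ℝ] EH).toLinearMap) compl
  Ad_mem : ∀ (a : G), ∀ v ∈ compl, Ad EH (hom a) v ∈ compl
  emb : P → Q
  contMDiff_emb : ContMDiff 𝓘(ℝ, EP) 𝓘(ℝ, EQ) ∞ emb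
  emb_act : ∀ u a, emb (BP.act u a) = BQ.act (emb u) (hom a)
  proj_emb : ∀ u, BQ.proj (emb u) = BP.proj u

namespace ReductiveStructure

variable {BP : PrincipalBundle m EG EP M G P} {BQ : PrincipalBundle m EH EQ M H Q}
  (R : ReductiveStructure BP BQ)

/-- The fibre at `u ∈ P` of the transverse bundle `𝓜(P) ≅ P × 𝔪`, the subspace of `T_u Q` consisting
of the fundamental vectors at `u` of the elements of `𝔪`. -/
def transverse (u : P) : Submodule ℝ EQ :=
  R.compl.map (BQ.fundamental (R.emb u)).toLinearMap

/-- `Ξ_K` is the generalized Kosmann vector field on `P` associated with `Ξ`: the component of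
`Ξ|_P` in `TP` for the decomposition `i_P^* TQ = TP ⊕ 𝓜(P)`. -/
def IsKosmannField (Ξ : ∀ u : Q, TangentSpace 𝓘(ℝ, EQ) u)
    (ΞK : ∀ u : P, TangentSpace 𝓘(ℝ, EP) u) : Prop :=
  ∀ u : P, Ξ (R.emb u) - mfderiv 𝓘(ℝ, EP) 𝓘(ℝ, EQ) R.emb u (ΞK u) ∈ R.transverse u

/-- The principal automorphism `Φ` of `Q` is the `H`-equivariant extension to `Q` of the time `t` map
of the flow of `Ξ_K`: it is defined over the set of the points of `M` at which the flow of `ξ` is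
defined up to time `t`, and `Φ(i(u)) = i((Φ_K)_t(u))` for `u ∈ P`. -/
def IsExtension [IsManifold 𝓘(ℝ, Eu m) ∞ M] [IsManifold 𝓘(ℝ, EP) ∞ P]
    (ΞK : ∀ u : P, TangentSpace 𝓘(ℝ, EP) u) (ξ : ∀ x : M, TangentSpace 𝓘(ℝ, Eu m) x) (t : ℝ)
    (Φ : LocalAutomorphism BQ) : Prop :=
  Φ.base.source = {x | (t, x) ∈ flowDomain ξ} ∧
    ∀ u : P, BP.proj u ∈ Φ.base.source → Φ.total (R.emb u) = R.emb (flow ΞK t u)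

end ReductiveStructure

end Reductive

/-! ### Induced one-parameter groups and Lie derivatives -/

section LieDerivative

variable {m : ℕ} {EH EQ EF : Type*} [NormedAddCommGroup EH] [NormedSpace ℝ EH]
  [NormedAddCommGroup EQ] [NormedSpace ℝ EQ] [NormedAddCommGroup EF] [NormedSpace ℝ EF]
  {M : Type*} [TopologicalSpace M] [ChartedSpace (Eu m) M] [IsManifold 𝓘(ℝ, Eu m) ∞ M]
  {H : Type*} [TopologicalSpace H] [ChartedSpace EH H] [Group H] [LieGroup 𝓘(ℝ, EH) ∞ H]
  {Q : Type*} [TopologicalSpace Q] [ChartedSpace EQ Q]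
  {F : Type*} [TopologicalSpace F] [ChartedSpace EF F] [IsManifold 𝓘(ℝ, EF) ∞ F]
  {B : PrincipalBundle m EH EQ M H Q} {r : GaugeOrder} {lam : JetAction m r EH H EF F}

variable (lam) in
/-- The generator `q ↦ d/dt (Φ_t)_λ(q) |_{t = 0}` of the family of maps of `Q_λ` induced by
automorphisms `Φ_t` of `Q`. -/
def generator (Φ : ℝ → LocalAutomorphism B) (q : GaugeNaturalBundle B lam) :
    TangentSpace 𝓘(ℝ, Eu m × EF) q :=
  mfderiv 𝓘(ℝ, ℝ) 𝓘(ℝ, Eu m × EF) (fun t => (Φ t).induced q) 0 (1 : ℝ)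

/-- The curve `t ↦ ((Φ_{-t})_λ ∘ σ ∘ φ_t)(x)`, where `φ` is the flow of `ξ`. -/
def lieCurve (Φ : ℝ → LocalAutomorphism B) (ξ : ∀ x : M, TangentSpace 𝓘(ℝ, Eu m) x)
    (σ : M → GaugeNaturalBundle B lam) (x : M) (t : ℝ) : GaugeNaturalBundle B lam :=
  (Φ (-t)).induced (σ (flow ξ t x))

/-- The generalized Lie derivative `d/dt ((Φ_{-t})_λ ∘ σ ∘ φ_t)(x) |_{t = 0}` of a section `σ` of
`Q_λ`. When `Φ_t` extends to `Q` the flow of the generalized Kosmann vector field of `Ξ`, this is the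
generalized `G`-reductive Lie derivative of `σ` with respect to `Ξ`. -/
def reductiveLieDerivative (Φ : ℝ → LocalAutomorphism B)
    (ξ : ∀ x : M, TangentSpace 𝓘(ℝ, Eu m) x) (σ : M → GaugeNaturalBundle B lam) (x : M) :
    TangentSpace 𝓘(ℝ, Eu m × EF) (σ x) :=
  mfderiv 𝓘(ℝ, ℝ) 𝓘(ℝ, Eu m × EF) (lieCurve Φ ξ σ x) 0 (1 : ℝ)

/-- The maps `(Φ_t)_λ` of `Q_λ` form a one-parameter group of automorphisms over the flow of `ξ`:
`(Φ_t)_λ` is defined on all the fibres of `Q_λ` over the domain of the time `t` map `φ_t`, it maps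
them to those over the image of `φ_t`, it depends smoothly on `t` and on the point,
`(Φ_0)_λ = id`, `(Φ_{t+s})_λ = (Φ_t)_λ ∘ (Φ_s)_λ` and `((Φ_t)_λ)⁻¹ = (Φ_{-t})_λ`. -/
structure IsOneParameterGroup (lam : JetAction m r EH H EF F) (Φ : ℝ → LocalAutomorphism B)
    (ξ : ∀ x : M, TangentSpace 𝓘(ℝ, Eu m) x) : Prop where
  isOpen_domain : IsOpen {p : ℝ × GaugeNaturalBundle B lam | (p.1, p.2.proj) ∈ flowDomain ξ}
  smooth : ContMDiffOn (𝓘(ℝ, ℝ).prod 𝓘(ℝ, Eu m × EF)) 𝓘(ℝ, Eu m × EF) ∞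
    (fun p : ℝ × GaugeNaturalBundle B lam => (Φ p.1).induced p.2)
    {p | (p.1, p.2.proj) ∈ flowDomain ξ}
  covers : ∀ t (q : GaugeNaturalBundle B lam), (t, q.proj) ∈ flowDomain ξ →
    ((Φ t).induced q).proj = flow ξ t q.proj
  zero : ∀ q : GaugeNaturalBundle B lam, (0, q.proj) ∈ flowDomain ξ ∧ (Φ 0).induced q = q
  add : ∀ s t (q : GaugeNaturalBundle B lam), (s, q.proj) ∈ flowDomain ξ →
    (t, ((Φ s).induced q).proj) ∈ flowDomain ξ →
    (t + s, q.proj) ∈ flowDomain ξ ∧ (Φ (t + s)).induced q = (Φ t).induced ((Φ s).induced q)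
  neg : ∀ t (q : GaugeNaturalBundle B lam), (t, q.proj) ∈ flowDomain ξ →
    (-t, ((Φ t).induced q).proj) ∈ flowDomain ξ ∧ (Φ (-t)).induced ((Φ t).induced q) = q

/-- The Lie derivative of `σ` with respect to `(Φ_t)` is well-defined on the open set `U`: for
`x ∈ U` the curve `t ↦ ((Φ_{-t})_λ ∘ σ ∘ φ_t)(x)` is smooth near `t = 0`, starts at `σ(x)` and stays
in the fibre of `Q_λ` over `x`, so that its derivative is a vertical vector at `σ(x)`; this vector is
`T_x σ(ξ(x)) - Ξ_λ(σ(x))`, where `Ξ_λ` is the generator of `(Φ_t)_λ`, and depends smoothly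
on `x`. -/
structure LieDerivativeWellDefined (Φ : ℝ → LocalAutomorphism B)
    (ξ : ∀ x : M, TangentSpace 𝓘(ℝ, Eu m) x) (U : Set M) (σ : M → GaugeNaturalBundle B lam) :
    Prop where
  curve_zero : ∀ x ∈ U, lieCurve Φ ξ σ x 0 = σ x
  curve_smooth : ∀ x ∈ U, SmoothNear 𝓘(ℝ, ℝ) 𝓘(ℝ, Eu m × EF) (lieCurve Φ ξ σ x) 0
  curve_proj : ∀ x ∈ U, ∀ᶠ t in 𝓝 0, (lieCurve Φ ξ σ x t).proj = x
  vertical : ∀ x ∈ U, mfderiv 𝓘(ℝ, Eu m × EF) 𝓘(ℝ, Eu m)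
    (fun q : GaugeNaturalBundle B lam => q.proj) (σ x) (reductiveLieDerivative Φ ξ σ x) = 0
  eq_sub : ∀ x ∈ U, reductiveLieDerivative Φ ξ σ x =
    mfderiv 𝓘(ℝ, Eu m) 𝓘(ℝ, Eu m × EF) σ x (ξ x) - generator lam Φ (σ x)
  smooth : ContMDiffOn 𝓘(ℝ, Eu m) 𝓘(ℝ, Eu m × EF).tangent ∞
    (fun x => (⟨σ x, reductiveLieDerivative Φ ξ σ x⟩ :
      TangentBundle 𝓘(ℝ, Eu m × EF) (GaugeNaturalBundle B lam))) U

end LieDerivative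

end

end GaugeNatural

/-! Existence and uniqueness of the Kosmann field are linear algebra in each tangent space. Vertical
vectors of a principal bundle are exactly the fundamental vectors, so the kernel of Tπ at `i(u)` is
a copy of 𝔥 = 𝔤 ⊕ 𝔪; the 𝔤-part is the vertical space of `P`, the 𝔪-part is the transverse space,
and `TP` already covers all of `TM`. Hence the tangent space of `Q` at `i(u)` is the direct sum of
that of `P` and the transverse space (`eq_zero_of_demb_mem`, `kosmann_formula`). The component in
`TP` is obtained as the derivative of an explicit map built from a local section and a map Λ from
`H` to `G` inducing a projection 𝔥 → 𝔤 along 𝔪, which gives smoothness (`smoothField_kosmann`).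
Ad-invariance of 𝔪 and uniqueness of the component give `G`-invariance; since transverse vectors are
vertical, the Kosmann field lies over ξ.

An invariant field lives exactly as long as its projection. Translations by the group carry integral
curves to integral curves, so all points over a small open set of the base share a common life time,
and the integral curve upstairs can be continued along the whole curve downstairs
(`IsInvariantLift.mem_flowDomain_iff`).

Every point of `Q` has the form `i(u) · a` with `u` in `P`. Therefore an equivariant extension of
the flow must send it to `i(flow(u)) · a`; this does not depend on the decomposition because the
flow commutes with `G`. Smoothness, the group law and uniqueness of the extension follow from this
formula (`extend_eq`, `extend_extend`, `IsExtension.total_eq`).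

The passage to a gauge-natural bundle is functorial in germs, so identities between automorphisms
near a fibre become identities between induced maps (`induced_comp`, `induced_id`). Relative to
frames given by charts of `M` and local sections of `Q`, an induced map is the action of a jet on
the coordinate in `F`; the jet has representatives depending smoothly on time and base point, and
smoothness of λ gives joint smoothness (`IsSmoothFamily.contMDiffAt_induced`). The Lie derivative is
then the two-variable chain rule for `(s, y) ↦ (Φ_s)_λ(y)` along the curve `t ↦ (-t, σ(φ_t(x)))`
(`der_lieCurve`).

All of this rests on the smoothness of maximal flows. Locally it is deduced from the inverse
function theorem in a Banach space of curves (`exists_smooth_localFlow_of_contDiff`), and it is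
propagated along orbits by connectedness (`SmoothField.flowSmoothAt`). -/

namespace GaugeNatural

noncomputable section

set_option linter.unusedSectionVars false

/-! ### Smooth dependence of solutions of ordinary differential equations on initial conditions -/

/-! ### Superposition operators on spaces of continuous functions. -/

section Nemytskii

universe u

variable {K : Type*} [TopologicalSpace K] [CompactSpace K]

/-- Pointwise application of a family of continuous linear maps, as a bilinear map. -/
def pointwiseApply (K : Type*) [TopologicalSpace K] [CompactSpace K] (E F : Type*)
    [NormedAddCommGroup E] [NormedSpace ℝ E] [NormedAddCommGroup F] [NormedSpace ℝ F] :
    C(K, E →L[ℝ] F) →L[ℝ] C(K, E) →L[ℝ] C(K, F) :=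
  LinearMap.mkContinuous₂
    (LinearMap.mk₂ ℝ
      (fun (A : C(K, E →L[ℝ] F)) (h : C(K, E)) =>
        (⟨fun s => A s (h s), A.continuous.clm_apply h.continuous⟩ : C(K, F)))
      (fun _ _ _ => by ext; simp) (fun _ _ _ => by ext; simp)
      (fun _ _ _ => by ext; simp) (fun _ _ _ => by ext; simp)) 1
    (fun A h => by
      rw [one_mul, ContinuousMap.norm_le _ (by positivity)]
      intro s
      exact (A s).le_of_opNorm_le_of_le (A.norm_coe_le_norm s) (h.norm_coe_le_norm s))

@[simp] theorem pointwiseApply_apply {E F : Type*}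
    [NormedAddCommGroup E] [NormedSpace ℝ E] [NormedAddCommGroup F] [NormedSpace ℝ F]
    (A : C(K, E →L[ℝ] F)) (h : C(K, E)) (s : K) : pointwiseApply K E F A h s = A s (h s) := rfl

/-- The superposition operator `γ ↦ f ∘ γ` is differentiable when `f` is of class `C¹`. -/
theorem hasFDerivAt_superposition {E F : Type*}
    [NormedAddCommGroup E] [NormedSpace ℝ E] [NormedAddCommGroup F] [NormedSpace ℝ F]
    {f : E → F} (hf : Differentiable ℝ f) (hf' : Continuous (fderiv ℝ f)) (γ : C(K, E)) :
    HasFDerivAt (fun γ : C(K, E) => (⟨f, hf.continuous⟩ : C(E, F)).comp γ)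
      (pointwiseApply K E F ((⟨fderiv ℝ f, hf'⟩ : C(E, E →L[ℝ] F)).comp γ)) γ := by
  rw [hasFDerivAt_iff_isLittleO_nhds_zero, Asymptotics.isLittleO_iff]
  intro c hc
  -- Continuity of γ ↦ f' ∘ γ in the sup norm yields one δ valid at all points of the compact space,
  -- with no local compactness of `E` needed.
  have hcont : Continuous fun γ : C(K, E) => (⟨fderiv ℝ f, hf'⟩ : C(E, E →L[ℝ] F)).comp γ :=
    ContinuousMap.continuous_postcomp _
  obtain ⟨δ, hδ, h⟩ := (Metric.continuousAt_iff (a := γ)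
    (f := fun γ : C(K, E) => (⟨fderiv ℝ f, hf'⟩ : C(E, E →L[ℝ] F)).comp γ)).1 hcont.continuousAt
    c hc
  filter_upwards [Metric.ball_mem_nhds (0 : C(K, E)) hδ] with k hk
  rw [mem_ball_zero_iff] at hk
  rw [ContinuousMap.norm_le _ (by positivity)]
  intro s
  have hb : ∀ x ∈ Metric.ball (γ s) δ, ‖fderiv ℝ f x - fderiv ℝ f (γ s)‖ ≤ c := by
    intro x hx
    rw [mem_ball_iff_norm] at hx
    -- The translate of γ by the constant `x - γ s` passes through `x` at `s`, so the sup-norm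
    -- estimate can be tested at the arbitrary point `x` of the ball.
    have h1 : dist (γ + ContinuousMap.const K (x - γ s)) γ < δ := by
      rw [dist_eq_norm, add_sub_cancel_left, ContinuousMap.norm_lt_iff _ hδ]
      exact fun _ => hx
    have h2 := (ContinuousMap.dist_lt_iff hc).1 (h h1) s
    rw [dist_eq_norm] at h2
    simpa using h2.le
  have hks : ‖k s‖ < δ := (k.norm_coe_le_norm s).trans_lt hk
  have := (convex_ball (γ s) δ).norm_image_sub_le_of_norm_fderiv_le' (f := f)
    (fun x _ => hf x) hb (Metric.mem_ball_self hδ) (y := γ s + k s)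
    (by simpa [mem_ball_iff_norm] using hks)
  rw [add_sub_cancel_left] at this
  simp only [ContinuousMap.coe_sub, ContinuousMap.coe_comp, Pi.sub_apply, Function.comp_apply,
    ContinuousMap.coe_mk, ContinuousMap.coe_add, Pi.add_apply, pointwiseApply_apply]
  exact this.trans (mul_le_mul_of_nonneg_left (k.norm_coe_le_norm s) hc.le)

/-- Induction on the order: the derivative at γ is pointwise application of f' ∘ γ, which is again a
superposition operator, now with values in `E →L[ℝ] F`. The target therefore has to vary inside the
induction, and it shares the universe of `E` so that spaces of linear maps remain admissible
targets. -/
theorem contDiff_superposition_nat {E : Type u} [NormedAddCommGroup E] [NormedSpace ℝ E] (n : ℕ) :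
    ∀ {F : Type u} [NormedAddCommGroup F] [NormedSpace ℝ F] {f : E → F} (hc : Continuous f),
      ContDiff ℝ n f → ContDiff ℝ n (fun γ : C(K, E) => (⟨f, hc⟩ : C(E, F)).comp γ) := by
  induction n with
  | zero =>
    intro F _ _ f hc _
    simp only [Nat.cast_zero]
    exact contDiff_zero.2 (ContinuousMap.continuous_postcomp _)
  | succ n ih =>
    intro F _ _ f hc hf
    push_cast at hf ⊢
    rw [contDiff_succ_iff_fderiv] at hf ⊢
    have hd := hasFDerivAt_superposition (K := K) hf.1 hf.2.2.continuous
    refine ⟨fun γ => (hd γ).differentiableAt, by simp, ?_⟩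
    have : fderiv ℝ (fun γ : C(K, E) => (⟨f, hc⟩ : C(E, F)).comp γ) =
        fun γ => pointwiseApply K E F
          ((⟨fderiv ℝ f, hf.2.2.continuous⟩ : C(E, E →L[ℝ] F)).comp γ) :=
      funext fun γ => (hd γ).fderiv
    rw [this]
    exact (pointwiseApply K E F).contDiff.comp (ih hf.2.2.continuous hf.2.2)

/-- The superposition operator `γ ↦ f ∘ γ` on continuous functions is smooth when `f` is smooth. -/
theorem contDiff_superposition {E F : Type u} [NormedAddCommGroup E] [NormedSpace ℝ E]
    [NormedAddCommGroup F] [NormedSpace ℝ F] {f : E → F} (hc : Continuous f)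
    (hf : ContDiff ℝ ∞ f) :
    ContDiff ℝ ∞ (fun γ : C(K, E) => (⟨f, hc⟩ : C(E, F)).comp γ) :=
  contDiff_infty.2 fun n => contDiff_superposition_nat n hc (contDiff_infty.1 hf n)

end Nemytskii

/-! ### Integration and reparametrization of curves on [-1, 1]. -/

section Volterra

variable {E : Type*} [NormedAddCommGroup E] [NormedSpace ℝ E]

/-- The interval `[-1, 1]`. -/
abbrev SymmInterval : Type := Icc (-1 : ℝ) 1

/-- The continuous extension to `ℝ` of a curve on `[-1, 1]`. -/
def extendCurve (γ : C(SymmInterval, E)) : ℝ → E := IccExtend (by norm_num : (-1 : ℝ) ≤ 1) γ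

theorem continuous_extendCurve (γ : C(SymmInterval, E)) : Continuous (extendCurve γ) :=
  γ.continuous.Icc_extend'

theorem extendCurve_of_mem (γ : C(SymmInterval, E)) {s : ℝ} (hs : s ∈ Icc (-1 : ℝ) 1) :
    extendCurve γ s = γ ⟨s, hs⟩ := IccExtend_of_mem _ _ hs

theorem extendCurve_coe (γ : C(SymmInterval, E)) (s : SymmInterval) :
    extendCurve γ s = γ s := IccExtend_val _ _ s

/-- The Volterra operator `γ ↦ (s ↦ ∫_0^s γ)`. -/
def volterra (E : Type*) [NormedAddCommGroup E] [NormedSpace ℝ E] :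
    C(SymmInterval, E) →L[ℝ] C(SymmInterval, E) :=
  LinearMap.mkContinuous
    { toFun := fun γ => ⟨fun s => ∫ τ in (0 : ℝ)..s, extendCurve γ τ,
        (intervalIntegral.continuous_primitive
          (fun a b => (continuous_extendCurve γ).intervalIntegrable a b) 0).comp
          continuous_subtype_val⟩
      map_add' := fun γ γ' => by
        ext s
        simp only [ContinuousMap.coe_mk, ContinuousMap.add_apply]
        rw [← intervalIntegral.integral_add ((continuous_extendCurve γ).intervalIntegrable _ _)
          ((continuous_extendCurve γ').intervalIntegrable _ _)]
        rfl
      map_smul' := fun c γ => by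
        ext s
        simp only [ContinuousMap.coe_mk, ContinuousMap.smul_apply, RingHom.id_apply]
        rw [← intervalIntegral.integral_smul]
        rfl } 1
    (fun γ => by
      rw [one_mul, ContinuousMap.norm_le _ (norm_nonneg _)]
      intro s
      have h : ∀ τ ∈ uIoc (0 : ℝ) s, ‖extendCurve γ τ‖ ≤ ‖γ‖ := fun τ _ => γ.norm_coe_le_norm _
      refine (intervalIntegral.norm_integral_le_of_norm_le_const h).trans ?_
      have : |(s : ℝ) - 0| ≤ 1 := by rw [sub_zero]; exact abs_le.2 s.2
      exact mul_le_of_le_one_right (norm_nonneg _) this)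

theorem volterra_apply (γ : C(SymmInterval, E)) (s : SymmInterval) :
    volterra E γ s = ∫ τ in (0 : ℝ)..s, extendCurve γ τ := rfl

/-- The reparametrization `γ ↦ γ(σ ·)` for `|σ| ≤ 1`. -/
def rescaleCurve (γ : C(SymmInterval, E)) (σ : SymmInterval) : C(SymmInterval, E) :=
  ⟨fun s => extendCurve γ (σ * s), (continuous_extendCurve γ).comp (by fun_prop)⟩

theorem SymmInterval.mul_mem (σ s : SymmInterval) : (σ * s : ℝ) ∈ Icc (-1 : ℝ) 1 := by
  have h1 := abs_le.2 σ.2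
  have h2 := abs_le.2 s.2
  rw [mem_Icc, ← abs_le, abs_mul]
  exact mul_le_one₀ h1 (abs_nonneg _) h2

/-- The rescaled curve only takes values of γ. The estimate keeps rescaled solutions inside the
neighbourhood where solutions of the integral equation are unique. -/
theorem rescaleCurve_sub_le (γ : C(SymmInterval, E)) (σ : SymmInterval) (x : E) :
    ‖rescaleCurve γ σ - ContinuousMap.const _ x‖ ≤ ‖γ - ContinuousMap.const _ x‖ := by
  rw [ContinuousMap.norm_le _ (norm_nonneg _)]
  intro s
  have := (γ - ContinuousMap.const _ x).norm_coe_le_norm ⟨_, SymmInterval.mul_mem σ s⟩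
  simpa [rescaleCurve, extendCurve_of_mem γ (SymmInterval.mul_mem σ s)] using this

theorem rescaleCurve_one (γ : C(SymmInterval, E)) (σ : SymmInterval) :
    rescaleCurve γ σ ⟨1, by norm_num⟩ = γ σ := by
  have : rescaleCurve γ σ ⟨1, by norm_num⟩ = extendCurve γ σ := by simp [rescaleCurve]
  rw [this, extendCurve_coe]

end Volterra

/-! ### Smooth local flows in a Banach space. -/

section LocalFlow

variable {E : Type*} [NormedAddCommGroup E] [NormedSpace ℝ E]

/-- The map `(t, x, γ) ↦ (t, x, γ - x - t ∫_0 f ∘ γ)`, whose local inverse solves the equation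
`γ' = t f(γ)`, `γ(0) = x`. -/
def odeMap {f : E → E} (hc : Continuous f) (p : ℝ × E × C(SymmInterval, E)) :
    ℝ × E × C(SymmInterval, E) :=
  (p.1, p.2.1, p.2.2 - ContinuousMap.const _ p.2.1 -
    p.1 • volterra E ((⟨f, hc⟩ : C(E, E)).comp p.2.2))

/-- The constant curves, as a continuous linear map. -/
def constCurve (E : Type*) [NormedAddCommGroup E] [NormedSpace ℝ E] :
    E →L[ℝ] C(SymmInterval, E) :=
  LinearMap.mkContinuous
    { toFun := fun x => ContinuousMap.const _ x
      map_add' := fun _ _ => rfl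
      map_smul' := fun _ _ => rfl } 1
    (fun x => by
      rw [one_mul, ContinuousMap.norm_le _ (norm_nonneg _)]
      exact fun _ => le_rfl)

theorem constCurve_apply (x : E) : constCurve E x = ContinuousMap.const _ x := rfl

theorem contDiff_odeMap {f : E → E} (hc : Continuous f) (hf : ContDiff ℝ ∞ f) :
    ContDiff ℝ ∞ (odeMap hc) := by
  have h1 : ContDiff ℝ ∞ fun p : ℝ × E × C(SymmInterval, E) =>
      (⟨f, hc⟩ : C(E, E)).comp p.2.2 :=
    (contDiff_superposition hc hf).comp (contDiff_snd.comp contDiff_snd)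
  have h2 : ContDiff ℝ ∞ fun p : ℝ × E × C(SymmInterval, E) => constCurve E p.2.1 :=
    (constCurve E).contDiff.comp (contDiff_fst.comp contDiff_snd)
  exact contDiff_fst.prodMk ((contDiff_fst.comp contDiff_snd).prodMk
    (((contDiff_snd.comp contDiff_snd).sub h2).sub
      (contDiff_fst.smul ((volterra E).contDiff.comp h1))))

/-- The linear isomorphism `(t, x, γ) ↦ (t, x, γ - x - t w)`. -/
def odeEquiv (w : C(SymmInterval, E)) :
    (ℝ × E × C(SymmInterval, E)) ≃L[ℝ] (ℝ × E × C(SymmInterval, E)) where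
  toFun p := (p.1, p.2.1, p.2.2 - constCurve E p.2.1 - p.1 • w)
  invFun p := (p.1, p.2.1, p.2.2 + constCurve E p.2.1 + p.1 • w)
  map_add' p q := by
    refine Prod.ext rfl (Prod.ext rfl ?_)
    simp only [Prod.fst_add, Prod.snd_add, map_add, add_smul]
    abel
  map_smul' c p := by
    refine Prod.ext rfl (Prod.ext rfl ?_)
    simp only [Prod.smul_fst, Prod.smul_snd, map_smul, smul_sub, smul_smul, RingHom.id_apply,
      smul_eq_mul]
  left_inv p := by
    refine Prod.ext rfl (Prod.ext rfl ?_)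
    simp only
    abel
  right_inv p := by
    refine Prod.ext rfl (Prod.ext rfl ?_)
    simp only
    abel
  continuous_toFun := by fun_prop
  continuous_invFun := by fun_prop

/-- The nonlinear term carries the factor `t`, so at `t = 0` it contributes only through the
variation of `t`. The derivative is thus triangular with identity diagonal, hence invertible without
any bound on `f`. -/
theorem hasFDerivAt_odeMap {f : E → E} (hc : Continuous f) (hf : ContDiff ℝ ∞ f) (x₀ : E) :
    HasFDerivAt (odeMap hc)
      (odeEquiv (volterra E ((⟨f, hc⟩ : C(E, E)).comp (constCurve E x₀))) :
        (ℝ × E × C(SymmInterval, E)) →L[ℝ] _) (0, x₀, constCurve E x₀) := by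
  set p₀ : ℝ × E × C(SymmInterval, E) := (0, x₀, constCurve E x₀)
  have h1 : DifferentiableAt ℝ (fun p : ℝ × E × C(SymmInterval, E) =>
      volterra E ((⟨f, hc⟩ : C(E, E)).comp p.2.2)) p₀ :=
    (((volterra E).contDiff.comp ((contDiff_superposition hc hf).comp
      (contDiff_snd.comp contDiff_snd))).differentiable (by simp)) p₀
  have a1 : HasFDerivAt (fun p : ℝ × E × C(SymmInterval, E) => p.1)
    (ContinuousLinearMap.fst ℝ ℝ (E × C(SymmInterval, E))) p₀ := hasFDerivAt_fst
  have a2 : HasFDerivAt (fun p : ℝ × E × C(SymmInterval, E) => p.2)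
    (ContinuousLinearMap.snd ℝ ℝ (E × C(SymmInterval, E))) p₀ := hasFDerivAt_snd
  have h2 := a1.smul h1.hasFDerivAt
  have h3 := ((a2.snd.sub ((constCurve E).hasFDerivAt.comp p₀ a2.fst)).sub h2)
  refine (a1.prodMk (a2.fst.prodMk h3)).congr_fderiv ?_
  ext p
  · rfl
  · rfl
  · simp [odeEquiv, p₀, constCurve_apply]
  all_goals simp [odeEquiv, p₀, constCurve_apply]

/-- A solution `γ` of `γ' = t f(γ)` rescaled by `σ` solves `γ' = t σ f(γ)`. -/
theorem odeMap_rescale {f : E → E} (hc : Continuous f) {t : ℝ} {x : E} {γ : C(SymmInterval, E)}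
    (h : odeMap hc (t, x, γ) = (t, x, 0)) (σ : SymmInterval) :
    odeMap hc (t * σ, x, rescaleCurve γ σ) = (t * σ, x, 0) := by
  have h' : γ - ContinuousMap.const _ x - t • volterra E ((⟨f, hc⟩ : C(E, E)).comp γ) = 0 :=
    congrArg (fun p => p.2.2) h
  refine Prod.ext rfl (Prod.ext rfl ?_)
  change rescaleCurve γ σ - ContinuousMap.const _ x -
    (t * σ) • volterra E ((⟨f, hc⟩ : C(E, E)).comp (rescaleCurve γ σ)) = 0
  ext s
  have h2 := DFunLike.congr_fun h' ⟨_, SymmInterval.mul_mem σ s⟩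
  simp only [ContinuousMap.coe_sub, ContinuousMap.coe_smul, Pi.sub_apply, Pi.smul_apply,
    volterra_apply, ContinuousMap.const_apply, ContinuousMap.zero_apply] at h2 ⊢
  rw [← h2]
  have e1 : rescaleCurve γ σ s = γ ⟨_, SymmInterval.mul_mem σ s⟩ :=
    extendCurve_of_mem γ (SymmInterval.mul_mem σ s)
  -- Substitution τ ↦ σ τ; with the factor σ kept outside the integral the identity also covers σ =
  -- 0.
  have e2 : (σ : ℝ) • ∫ τ in (0 : ℝ)..s,
      extendCurve ((⟨f, hc⟩ : C(E, E)).comp (rescaleCurve γ σ)) τ =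
      ∫ τ in (0 : ℝ)..(σ * s : ℝ), extendCurve ((⟨f, hc⟩ : C(E, E)).comp γ) τ := by
    have e3 : ∀ τ ∈ uIcc (0 : ℝ) s,
        extendCurve ((⟨f, hc⟩ : C(E, E)).comp (rescaleCurve γ σ)) τ =
          extendCurve ((⟨f, hc⟩ : C(E, E)).comp γ) (σ * τ) := by
      intro τ hτ
      have : τ ∈ Icc (-1 : ℝ) 1 :=
        (convex_Icc (-1 : ℝ) 1).ordConnected.uIcc_subset (by norm_num) s.2 hτ
      rw [extendCurve_of_mem _ this]
      rfl
    rw [intervalIntegral.integral_congr e3,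
      intervalIntegral.smul_integral_comp_mul_left (fun τ => extendCurve _ τ) (σ : ℝ), mul_zero]
  rw [e1, mul_smul, e2]

/-- The local flow of a smooth vector field depends smoothly on time and on the initial point. -/
theorem exists_smooth_localFlow_of_contDiff [CompleteSpace E] {f : E → E}
    (hf : ContDiff ℝ ∞ f) (x₀ : E) :
    ∃ ε > 0, ∃ φ : ℝ × E → E, ContDiffOn ℝ ∞ φ (Ioo (-ε) ε ×ˢ Metric.ball x₀ ε) ∧
      ∀ x ∈ Metric.ball x₀ ε, φ (0, x) = x ∧
        ∀ t ∈ Ioo (-ε) ε, HasDerivAt (fun t => φ (t, x)) (f (φ (t, x))) t := by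
  have hc := hf.continuous
  set Ψ := odeMap hc with hΨdef
  set c₀ : C(SymmInterval, E) := constCurve E x₀
  set p₀ : ℝ × E × C(SymmInterval, E) := (0, x₀, c₀)
  have hΨ : ContDiff ℝ ∞ Ψ := contDiff_odeMap hc hf
  have hd := hasFDerivAt_odeMap hc hf x₀
  have hn : (∞ : WithTop ℕ∞) ≠ 0 := by simp
  -- The inverse function theorem is applied at time 0 and the constant curve `x₀`, in the space of
  -- triples (time, initial point, curve).
  set L := hΨ.contDiffAt.toOpenPartialHomeomorph Ψ hd hn with hL
  have hLsrc : p₀ ∈ L.source := hΨ.contDiffAt.mem_toOpenPartialHomeomorph_source hd hn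
  have hLcoe : ∀ p, L p = Ψ p := fun _ => rfl
  have hp₀ : Ψ p₀ = (0, x₀, 0) := by
    refine Prod.ext rfl (Prod.ext rfl ?_)
    simp [Ψ, odeMap, p₀, c₀, constCurve_apply]
  have hLt : (0, x₀, 0) ∈ L.target := by
    have := L.map_source hLsrc
    rwa [hLcoe, hp₀] at this
  have hLs : L.symm (0, x₀, 0) = p₀ := by
    rw [← hp₀, ← hLcoe, L.left_inv hLsrc]
  -- the inverse is smooth near the base point
  have hinv : ∀ᶠ q in 𝓝 (0, x₀, 0), ContDiffAt ℝ ∞ L.symm q := by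
    have h1 : ∀ᶠ p in 𝓝 p₀, fderiv ℝ Ψ p ∈ range ((↑) :
        ((ℝ × E × C(SymmInterval, E)) ≃L[ℝ] (ℝ × E × C(SymmInterval, E))) → _) := by
      refine (hΨ.continuous_fderiv (by simp)).continuousAt.eventually ?_
      rw [hd.fderiv]
      exact ContinuousLinearEquiv.nhds _
    have h2 : Tendsto L.symm (𝓝 (0, x₀, 0)) (𝓝 p₀) := by
      have := (L.continuousAt_symm hLt).tendsto
      rwa [hLs] at this
    filter_upwards [h2.eventually h1, L.open_target.mem_nhds hLt] with q hq hq'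
    obtain ⟨e, he⟩ := hq
    refine L.contDiffAt_symm hq' (f₀' := e) ?_ hΨ.contDiffAt
    rw [he]
    exact (hΨ.differentiable hn _).hasFDerivAt
  -- `Γ (t, x)` solves γ' = t f(γ), γ(0) = x on [-1, 1] for `(t, x)` near `(0, x₀)`, so its value at
  -- 1 will be the flow at time `t`.
  set Γ : ℝ × E → C(SymmInterval, E) := fun p => (L.symm (p.1, p.2, 0)).2.2 with hΓdef
  have hincl : ContDiff ℝ ∞ fun p : ℝ × E => (p.1, p.2, (0 : C(SymmInterval, E))) := by fun_prop
  have hΓ : ∀ᶠ p in 𝓝 ((0 : ℝ), x₀), ContDiffAt ℝ ∞ Γ p := by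
    filter_upwards [hincl.continuous.continuousAt.eventually hinv] with p hp
    exact contDiffAt_snd.comp p (contDiffAt_snd.comp p (hp.comp p hincl.contDiffAt))
  have hΓ0 : Γ (0, x₀) = c₀ := by simp only [Γ, hLs, p₀]
  have hΓeq : ∀ᶠ p in 𝓝 ((0 : ℝ), x₀), Ψ (p.1, p.2, Γ p) = (p.1, p.2, 0) := by
    have := (hincl.continuous.continuousAt (x := ((0 : ℝ), x₀))).eventually
      (L.open_target.mem_nhds hLt)
    filter_upwards [this] with p hp
    have h1 : Ψ (L.symm (p.1, p.2, 0)) = (p.1, p.2, 0) := L.right_inv hp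
    have h2 : L.symm (p.1, p.2, 0) = (p.1, p.2, Γ p) := by
      refine Prod.ext ?_ (Prod.ext ?_ rfl)
      · exact (congrArg Prod.fst h1 : _)
      · exact (congrArg (fun p => p.2.1) h1 : _)
    rw [h2] at h1
    exact h1
  -- uniqueness of solutions near the constant curve
  obtain ⟨δ, hδ, hball⟩ := Metric.mem_nhds_iff.1 (L.open_source.mem_nhds hLsrc)
  have huniq : ∀ t x γ, |t| < δ → ‖x - x₀‖ < δ → ‖γ - c₀‖ < δ → Ψ (t, x, γ) = (t, x, 0) →
      γ = Γ (t, x) := by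
    intro t x γ ht hx hγ h
    have hm : (t, x, γ) ∈ L.source := by
      apply hball
      rw [mem_ball_iff_norm]
      simp only [p₀, Prod.mk_sub_mk, sub_zero, Prod.norm_def, Real.norm_eq_abs]
      exact max_lt ht (max_lt hx hγ)
    have := L.left_inv hm
    rw [hLcoe, h] at this
    simp only [Γ, this]
  have hnear : ∀ᶠ p in 𝓝 ((0 : ℝ), x₀), ‖Γ p - c₀‖ < δ := by
    have : Tendsto Γ (𝓝 (0, x₀)) (𝓝 c₀) := by
      have := hΓ.self_of_nhds.continuousAt.tendsto
      rwa [hΓ0] at this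
    filter_upwards [this (Metric.ball_mem_nhds c₀ hδ)] with p hp
    exact mem_ball_iff_norm.1 hp
  obtain ⟨η, hη, hall⟩ := Metric.eventually_nhds_iff.1 (hΓ.and (hΓeq.and hnear))
  -- Halving leaves room for the closed condition |t| ≤ ε: the curve at the end time `t = ε` itself
  -- is needed below.
  set ε := min η δ / 2 with hεdef
  have hε : 0 < ε := by positivity
  have hεη : ε < η := by
    have := min_le_left η δ
    rw [hεdef]; linarith
  have hεδ : ε < δ := by
    have := min_le_right η δ
    rw [hεdef]; linarith
  have hgood : ∀ t x, |t| ≤ ε → x ∈ Metric.ball x₀ ε → ContDiffAt ℝ ∞ Γ (t, x) ∧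
      Ψ (t, x, Γ (t, x)) = (t, x, 0) ∧ ‖Γ (t, x) - c₀‖ < δ := by
    intro t x ht hx
    refine hall ?_
    rw [Prod.dist_eq, Real.dist_eq, sub_zero]
    exact max_lt (ht.trans_lt hεη) ((Metric.mem_ball.1 hx).trans hεη)
  let one : SymmInterval := ⟨1, by norm_num⟩
  -- By scaling, `Γ (ε, x)` run at speed σ solves the equation with parameter εσ and stays close to
  -- the constant curve; local uniqueness identifies it with `Γ (ε * σ, x)`.
  have hresc : ∀ x ∈ Metric.ball x₀ ε, ∀ σ : SymmInterval, Γ (ε, x) σ = Γ (ε * σ, x) one := by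
    intro x hx σ
    obtain ⟨-, h2, h3⟩ := hgood ε x (abs_of_pos hε).le hx
    have hσ : |ε * (σ : ℝ)| < δ := by
      rw [abs_mul, abs_of_pos hε]
      exact (mul_le_of_le_one_right hε.le (abs_le.2 σ.2)).trans_lt hεδ
    have := huniq (ε * σ) x (rescaleCurve (Γ (ε, x)) σ) hσ
      ((mem_ball_iff_norm.1 hx).trans hεδ)
      ((rescaleCurve_sub_le _ _ _).trans_lt h3) (odeMap_rescale hc h2 σ)
    rw [← this, rescaleCurve_one]
  have hint : ∀ x ∈ Metric.ball x₀ ε, ∀ σ : SymmInterval, Γ (ε, x) σ =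
      x + ε • ∫ τ in (0 : ℝ)..σ, f (extendCurve (Γ (ε, x)) τ) := by
    intro x hx σ
    obtain ⟨-, h2, -⟩ := hgood ε x (abs_of_pos hε).le hx
    have h3 : Γ (ε, x) - ContinuousMap.const _ x -
      ε • volterra E ((⟨f, hc⟩ : C(E, E)).comp (Γ (ε, x))) = 0 := congrArg (fun p => p.2.2) h2
    have h4 := DFunLike.congr_fun h3 σ
    have h5 : Γ (ε, x) σ - x - ε • ∫ τ in (0 : ℝ)..σ, f (extendCurve (Γ (ε, x)) τ) = 0 := h4
    rw [← sub_eq_zero, ← h5]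
    abel
  refine ⟨ε, hε, fun p => Γ p one, ?_, ?_⟩
  · rintro ⟨t, x⟩ ⟨ht, hx⟩
    apply ContDiffAt.contDiffWithinAt
    have h1 := (hgood t x (abs_lt.2 ht).le hx).1
    exact (ContinuousMap.evalCLM ℝ one).contDiff.contDiffAt.comp _ h1
  · intro x hx
    -- All times are read off the single curve `Γ (ε, x)`, so the differential equation in `t`
    -- reduces to the fundamental theorem of calculus.
    have key : ∀ t ∈ Ioo (-ε) ε, Γ (t, x) one =
        x + ε • ∫ τ in (0 : ℝ)..(t / ε), f (extendCurve (Γ (ε, x)) τ) := by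
      intro t ht
      have hm : t / ε ∈ Icc (-1 : ℝ) 1 := by
        rw [mem_Icc, ← abs_le, abs_div, abs_of_pos hε, div_le_one hε]
        exact (abs_lt.2 ht).le
      have h1 := hresc x hx ⟨t / ε, hm⟩
      rw [hint x hx] at h1
      rw [h1, mul_div_cancel₀ _ hε.ne']
    refine ⟨?_, ?_⟩
    · refine (key 0 (by simp [hε])).trans ?_
      simp
    · intro t ht
      have hm : t / ε ∈ Icc (-1 : ℝ) 1 := by
        rw [mem_Icc, ← abs_le, abs_div, abs_of_pos hε, div_le_one hε]
        exact (abs_lt.2 ht).le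
      have hfc : Continuous fun τ => f (extendCurve (Γ (ε, x)) τ) :=
        hc.comp (continuous_extendCurve _)
      have h1 : HasDerivAt (fun u => ∫ τ in (0 : ℝ)..u, f (extendCurve (Γ (ε, x)) τ))
          (f (extendCurve (Γ (ε, x)) (t / ε))) (t / ε) :=
        intervalIntegral.integral_hasDerivAt_right (hfc.intervalIntegrable _ _)
          (hfc.stronglyMeasurableAtFilter _ _) hfc.continuousAt
      have h2 := ((h1.scomp t ((hasDerivAt_id t).div_const ε)).const_smul ε).const_add x
      have h3 : ε • (1 / ε) • f (extendCurve (Γ (ε, x)) (t / ε)) = f (Γ (t, x) one) := by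
        rw [smul_smul, mul_one_div_cancel hε.ne', one_smul, extendCurve_of_mem _ hm,
          hresc x hx ⟨t / ε, hm⟩, mul_div_cancel₀ _ hε.ne']
      rw [← h3]
      refine h2.congr_of_eventuallyEq ?_
      filter_upwards [isOpen_Ioo.mem_nhds ht] with s hs
      rw [key s hs]
      rfl

/-- The local flow of a vector field which is smooth near a point depends smoothly on time and on
the initial point. -/
theorem exists_smooth_localFlow [FiniteDimensional ℝ E] {f : E → E} {s : Set E}
    (hf : ContDiffOn ℝ ∞ f s) {x₀ : E} (hs : s ∈ 𝓝 x₀) :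
    ∃ ε > 0, ∃ φ : ℝ × E → E, ContDiffOn ℝ ∞ φ (Ioo (-ε) ε ×ˢ Metric.ball x₀ ε) ∧
      ∀ x ∈ Metric.ball x₀ ε, φ (0, x) = x ∧
        ∀ t ∈ Ioo (-ε) ε, φ (t, x) ∈ s ∧ HasDerivAt (fun t => φ (t, x)) (f (φ (t, x))) t := by
  have : CompleteSpace E := FiniteDimensional.complete ℝ E
  obtain ⟨ρ, hρ, hρs⟩ := Metric.mem_nhds_iff.1 hs
  -- The cut-off is 1 on the ball of radius ρ/3 and vanishes beyond ρ/2, so that `b • f` is smooth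
  -- on all of `E`; its integral curves are those of `f` while they stay in the smaller ball.
  let b : ContDiffBump x₀ := ⟨ρ / 3, ρ / 2, by positivity, by linarith⟩
  have hg : ContDiff ℝ ∞ fun x => b x • f x := by
    rw [contDiff_iff_contDiffAt]
    intro x
    by_cases hx : x ∈ Metric.ball x₀ ρ
    · have : ContDiffAt ℝ ∞ f x :=
        (hf.mono hρs).contDiffAt (Metric.isOpen_ball.mem_nhds hx)
      exact b.contDiff.contDiffAt.smul this
    · have hx' : x ∈ (Metric.closedBall x₀ (ρ / 2))ᶜ := by
        simp only [Metric.mem_ball, not_lt] at hx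
        simp only [mem_compl_iff, Metric.mem_closedBall, not_le]
        linarith
      refine (contDiffAt_const (c := (0 : E))).congr_of_eventuallyEq ?_
      filter_upwards [Metric.isClosed_closedBall.isOpen_compl.mem_nhds hx'] with y hy
      have : b y = 0 := b.zero_of_le_dist (by
        simp only [mem_compl_iff, Metric.mem_closedBall, not_le] at hy
        exact hy.le)
      rw [this, zero_smul]
  obtain ⟨ε, hε, φ, hφ, h⟩ := exists_smooth_localFlow_of_contDiff hg x₀
  have hU : IsOpen (Ioo (-ε) ε ×ˢ Metric.ball x₀ ε) := isOpen_Ioo.prod Metric.isOpen_ball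
  have h0 : ((0 : ℝ), x₀) ∈ Ioo (-ε) ε ×ˢ Metric.ball x₀ ε := by simp [hε]
  have hcont : Tendsto φ (𝓝 (0, x₀)) (𝓝 x₀) := by
    have := (hφ.contDiffAt (hU.mem_nhds h0)).continuousAt.tendsto
    rwa [(h x₀ (Metric.mem_ball_self hε)).1] at this
  obtain ⟨η, hη, hη'⟩ := Metric.eventually_nhds_iff.1
    (hcont.eventually (Metric.ball_mem_nhds x₀ (show 0 < ρ / 3 by positivity)))
  refine ⟨min ε η, lt_min hε hη, φ, hφ.mono (prod_mono
    (Ioo_subset_Ioo (neg_le_neg (min_le_left _ _)) (min_le_left _ _))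
    (Metric.ball_subset_ball (min_le_left _ _))), fun x hx => ⟨(h x
      (Metric.ball_subset_ball (min_le_left _ _) hx)).1, fun t ht => ?_⟩⟩
  have hm : φ (t, x) ∈ Metric.ball x₀ (ρ / 3) := by
    apply hη'
    rw [Prod.dist_eq, Real.dist_eq, sub_zero]
    exact max_lt ((abs_lt.2 ht).trans_le (min_le_right _ _))
      ((Metric.mem_ball.1 hx).trans_le (min_le_right _ _))
  refine ⟨hρs (Metric.ball_subset_ball (by linarith) hm), ?_⟩
  have := (h x (Metric.ball_subset_ball (min_le_left _ _) hx)).2 t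
    (Ioo_subset_Ioo (neg_le_neg (min_le_left _ _)) (min_le_left _ _) ht)
  rwa [b.one_of_mem_closedBall (Metric.ball_subset_closedBall hm), one_smul] at this

end LocalFlow

/-! ### Tangent maps of smooth maps -/

section TangentTools

variable {E₁ E₂ E₃ : Type*} [NormedAddCommGroup E₁] [NormedSpace ℝ E₁]
  [NormedAddCommGroup E₂] [NormedSpace ℝ E₂] [NormedAddCommGroup E₃] [NormedSpace ℝ E₃]
  {H₁ H₂ H₃ : Type*} [TopologicalSpace H₁] [TopologicalSpace H₂] [TopologicalSpace H₃]
  {I : ModelWithCorners ℝ E₁ H₁} {J : ModelWithCorners ℝ E₂ H₂} {K : ModelWithCorners ℝ E₃ H₃}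
  {N₁ N₂ N₃ : Type*} [TopologicalSpace N₁] [ChartedSpace H₁ N₁]
  [TopologicalSpace N₂] [ChartedSpace H₂ N₂] [TopologicalSpace N₃] [ChartedSpace H₃ N₃]

theorem SmoothNear.exists_isOpen {f : N₁ → N₂} {x : N₁} (hf : SmoothNear I J f x) :
    ∃ s, IsOpen s ∧ x ∈ s ∧ ContMDiffOn I J ∞ f s := by
  obtain ⟨s, hs, ho, hx⟩ := eventually_nhds_iff.1 hf
  exact ⟨s, ho, hx, fun y hy => (hs y hy).contMDiffWithinAt⟩

theorem SmoothNear.mdifferentiableAt {f : N₁ → N₂} {x : N₁} (hf : SmoothNear I J f x) :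
    MDifferentiableAt I J f x := hf.contMDiffAt.mdifferentiableAt (by simp)

variable [IsManifold I ∞ N₁] [IsManifold J ∞ N₂]

/-- The tangent map of a smooth map, applied to a smooth family of tangent vectors. -/
theorem SmoothNear.contMDiffAt_mfderiv_apply {f : N₁ → N₂} {g : N₃ → N₁}
    {V : ∀ y, TangentSpace I (g y)} {y₀ : N₃} (hf : SmoothNear I J f (g y₀))
    (hV : ContMDiffAt K I.tangent ∞ (fun y => (⟨g y, V y⟩ : TangentBundle I N₁)) y₀) :
    ContMDiffAt K J.tangent ∞
      (fun y => (⟨f (g y), mfderiv I J f (g y) (V y)⟩ : TangentBundle J N₂)) y₀ := by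
  obtain ⟨s, hs, hx, hfs⟩ := hf.exists_isOpen
  have h1 := hfs.contMDiffOn_tangentMapWithin (m := ∞) (by simp) hs.uniqueMDiffOn
  have hopen : IsOpen ((Bundle.TotalSpace.proj : TangentBundle I N₁ → N₁) ⁻¹' s) :=
    hs.preimage (FiberBundle.continuous_proj E₁ (TangentSpace I : N₁ → Type _))
  have h2 := h1.contMDiffAt (x := (⟨g y₀, V y₀⟩ : TangentBundle I N₁)) (hopen.mem_nhds hx)
  refine (ContMDiffAt.comp y₀ h2 hV).congr_of_eventuallyEq ?_
  have h3 : ∀ᶠ y in 𝓝 y₀, g y ∈ s := hV.continuousAt.eventually (hopen.mem_nhds hx)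
  filter_upwards [h3] with y hy
  simp only [Function.comp_apply, tangentMapWithin]
  rw [mfderivWithin_of_isOpen hs hy]

/-- A pair of smooth families of tangent vectors is a smooth family of tangent vectors of the
product. -/
theorem contMDiffAt_vector_prodMk {g : N₃ → N₁} {k : N₃ → N₂}
    {V : ∀ y, TangentSpace I (g y)} {W : ∀ y, TangentSpace J (k y)} {y₀ : N₃}
    (hV : ContMDiffAt K I.tangent ∞ (fun y => (⟨g y, V y⟩ : TangentBundle I N₁)) y₀)
    (hW : ContMDiffAt K J.tangent ∞ (fun y => (⟨k y, W y⟩ : TangentBundle J N₂)) y₀) :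
    ContMDiffAt K (I.prod J).tangent ∞
      (fun y => (⟨(g y, k y), (V y, W y)⟩ : TangentBundle (I.prod J) (N₁ × N₂))) y₀ :=
  (contMDiff_equivTangentBundleProd_symm (I := I) (I' := J) (M := N₁) (M' := N₂)).contMDiffAt.comp
    y₀ (hV.prodMk hW)

/-- The zero vectors along a smooth map. -/
theorem contMDiffAt_vector_zero {g : N₃ → N₁} {y₀ : N₃} (hg : ContMDiffAt K I ∞ g y₀) :
    ContMDiffAt K I.tangent ∞ (fun y => (⟨g y, 0⟩ : TangentBundle I N₁)) y₀ :=
  (Bundle.contMDiff_zeroSection ℝ (TangentSpace I : N₁ → Type _)).contMDiffAt.comp y₀ hg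

end TangentTools

/-! ### Smoothness of maximal flows -/

section Flows

variable {E : Type*} [NormedAddCommGroup E] [NormedSpace ℝ E]
  {N : Type*} [TopologicalSpace N] [ChartedSpace E N]

theorem comp_smulRight_one {E' : Type*} [NormedAddCommGroup E'] [NormedSpace ℝ E']
    (L : E →L[ℝ] E') (v : E) :
    L.comp (ContinuousLinearMap.smulRight (1 : ℝ →L[ℝ] ℝ) v) =
      ContinuousLinearMap.smulRight (1 : ℝ →L[ℝ] ℝ) (L v) := by
  ext; simp

/-- Bridges the form of the derivative of a curve in a normed space and the form used for integral
curves on a manifold. -/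
theorem comp_toSpanSingleton {E' : Type*} [NormedAddCommGroup E'] [NormedSpace ℝ E']
    (L : E →L[ℝ] E') (v : E) :
    L.comp (ContinuousLinearMap.toSpanSingleton ℝ v) =
      ContinuousLinearMap.smulRight (1 : ℝ →L[ℝ] ℝ) (L v) := by
  ext; simp

theorem IsMIntegralCurveOn.map {E' N' : Type*} [NormedAddCommGroup E'] [NormedSpace ℝ E']
    [TopologicalSpace N'] [ChartedSpace E' N'] {X : ∀ x : N, TangentSpace 𝓘(ℝ, E) x}
    {Y : ∀ x : N', TangentSpace 𝓘(ℝ, E') x} {γ : ℝ → N} {s : Set ℝ}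
    (h : IsMIntegralCurveOn (I := 𝓘(ℝ, E)) γ X s) {f : N → N'}
    (hf : ∀ t ∈ s, MDifferentiableAt 𝓘(ℝ, E) 𝓘(ℝ, E') f (γ t))
    (hXY : ∀ t ∈ s, mfderiv 𝓘(ℝ, E) 𝓘(ℝ, E') f (γ t) (X (γ t)) = Y (f (γ t))) :
    IsMIntegralCurveOn (I := 𝓘(ℝ, E')) (f ∘ γ) Y s := by
  intro t ht
  have := (hf t ht).hasMFDerivAt.comp_hasMFDerivWithinAt t (h t ht)
  rw [Function.comp_apply, ← hXY t ht]
  refine this.congr_mfderiv ?_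
  exact comp_smulRight_one (E := E) (E' := E') _ _

variable [IsManifold 𝓘(ℝ, E) ∞ N] [FiniteDimensional ℝ E] {X : ∀ x : N, TangentSpace 𝓘(ℝ, E) x}

/-- Smooth local flows exist. -/
theorem SmoothField.exists_localFlow (hX : SmoothField X) (x₀ : N) :
    ∃ ε > 0, ∃ U, IsOpen U ∧ x₀ ∈ U ∧ ∃ φ : ℝ × N → N,
      ContMDiffOn (𝓘(ℝ, ℝ).prod 𝓘(ℝ, E)) 𝓘(ℝ, E) ∞ φ (Ioo (-ε) ε ×ˢ U) ∧
      ∀ x ∈ U, φ (0, x) = x ∧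
        IsMIntegralCurveOn (I := 𝓘(ℝ, E)) (fun t => φ (t, x)) X (Ioo (-ε) ε) := by
  set e := extChartAt 𝓘(ℝ, E) x₀ with he
  have heo : IsOpen e.target := isOpen_extChartAt_target x₀
  -- The representative of `X` in the chart; the local flow is constructed for it and transported
  -- back by the inverse chart.
  let f : E → E := fun y => mfderiv 𝓘(ℝ, E) 𝓘(ℝ, E) e (e.symm y) (X (e.symm y))
  have hf : ContDiffOn ℝ ∞ f e.target := by
    rw [← contMDiffOn_iff_contDiffOn]
    intro y hy
    apply ContMDiffAt.contMDiffWithinAt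
    have hy' : e.symm y ∈ (chartAt E x₀).source := by
      rw [← extChartAt_source 𝓘(ℝ, E)]; exact e.map_target hy
    have h1 : SmoothNear 𝓘(ℝ, E) 𝓘(ℝ, E) e (e.symm y) :=
      smoothNear_of_contMDiffOn ((chartAt E x₀).open_source.mem_nhds hy') contMDiffOn_extChartAt
    have h2 : ContMDiffAt 𝓘(ℝ, E) 𝓘(ℝ, E) ∞ e.symm y :=
      (contMDiffOn_extChartAt_symm x₀).contMDiffAt (heo.mem_nhds hy)
    have h3 := h1.contMDiffAt_mfderiv_apply (g := e.symm) (V := fun y => X (e.symm y))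
      (ContMDiffAt.comp y hX.contMDiffAt h2)
    exact (contMDiff_snd_tangentBundle_modelSpace E 𝓘(ℝ, E)).contMDiffAt.comp y h3
  obtain ⟨ε, hε, ψ, hψ, h⟩ := exists_smooth_localFlow hf (extChartAt_target_mem_nhds x₀)
  set U := (chartAt E x₀).source ∩ e ⁻¹' Metric.ball (e x₀) ε with hU
  have hUo : IsOpen U := by
    have := isOpen_extChartAt_preimage' (I := 𝓘(ℝ, E)) x₀ (Metric.isOpen_ball (x := e x₀) (ε := ε))
    rwa [extChartAt_source] at this
  refine ⟨ε, hε, U, hUo, ⟨mem_chart_source _ _, Metric.mem_ball_self hε⟩,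
    fun p => e.symm (ψ (p.1, e p.2)), ?_, ?_⟩
  · rintro ⟨t, x⟩ ⟨ht, hx⟩
    apply ContMDiffAt.contMDiffWithinAt
    have h1 : ContMDiffAt 𝓘(ℝ, E) 𝓘(ℝ, E) ∞ e x :=
      contMDiffOn_extChartAt.contMDiffAt ((chartAt E x₀).open_source.mem_nhds hx.1)
    have h2 : ContMDiffAt (𝓘(ℝ, ℝ).prod 𝓘(ℝ, E)) 𝓘(ℝ, ℝ × E) ∞
        (fun p : ℝ × N => (p.1, e p.2)) (t, x) :=
      contMDiffAt_fst.prodMk_space (h1.comp (t, x) contMDiffAt_snd)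
    have h3 : ContMDiffAt 𝓘(ℝ, ℝ × E) 𝓘(ℝ, E) ∞ ψ (t, e x) :=
      (hψ.contDiffAt ((isOpen_Ioo.prod Metric.isOpen_ball).mem_nhds
        (show (t, e x) ∈ _ from ⟨ht, hx.2⟩))).contMDiffAt
    have h4 : ContMDiffAt 𝓘(ℝ, E) 𝓘(ℝ, E) ∞ e.symm (ψ (t, e x)) :=
      (contMDiffOn_extChartAt_symm x₀).contMDiffAt (heo.mem_nhds ((h _ hx.2).2 t ht).1)
    exact ContMDiffAt.comp (t, x) h4 (ContMDiffAt.comp (t, x) h3 h2)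
  · intro x hx
    have hx' : x ∈ e.source := by rw [he, extChartAt_source]; exact hx.1
    refine ⟨by simp only [(h _ hx.2).1, e.left_inv hx'], fun t ht => ?_⟩
    obtain ⟨h1, h2⟩ := (h _ hx.2).2 t ht
    have h3 : MDifferentiableAt 𝓘(ℝ, E) 𝓘(ℝ, E) e.symm (ψ (t, e x)) :=
      ((contMDiffOn_extChartAt_symm (n := ∞) x₀).contMDiffAt (heo.mem_nhds h1)).mdifferentiableAt
        (by simp)
    have h4 := h3.hasMFDerivAt.comp t h2.hasFDerivAt.hasMFDerivAt
    -- The derivative of the inverse chart cancels the derivative of the chart in the definition of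
    -- `f`, so the transported curve has velocity `X`.
    have h5 := mfderivWithin_extChartAt_symm_comp_mfderiv_extChartAt (I := 𝓘(ℝ, E)) h1
    simp only [modelWithCornersSelf_coe, range_id, mfderivWithin_univ] at h5
    apply HasMFDerivAt.hasMFDerivWithinAt
    refine HasMFDerivAt.congr_mfderiv h4 ?_
    have h6 : mfderiv 𝓘(ℝ, E) 𝓘(ℝ, E) e.symm (ψ (t, e x)) (f (ψ (t, e x))) =
        X (e.symm (ψ (t, e x))) := DFunLike.congr_fun h5 (X (e.symm (ψ (t, e x))))
    exact (comp_toSpanSingleton (E := E) (E' := E) _ _).trans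
      (congrArg (fun v : E => ContinuousLinearMap.smulRight (1 : ℝ →L[ℝ] ℝ) v) h6)

end Flows

/-! ### The maximal flow: group law and joint smoothness. -/

section MaximalFlow

variable {E : Type*} [NormedAddCommGroup E] [NormedSpace ℝ E]
  {N : Type*} [TopologicalSpace N] [ChartedSpace E N]
  [IsManifold 𝓘(ℝ, E) ∞ N] [FiniteDimensional ℝ E] {X : ∀ x : N, TangentSpace 𝓘(ℝ, E) x}

theorem zero_mem_flowDomain (hX : SmoothField X) (x : N) : ((0 : ℝ), x) ∈ flowDomain X := by
  obtain ⟨ε, hε, U, -, hx, φ, -, h⟩ := hX.exists_localFlow x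
  exact ⟨fun t => φ (t, x), -ε, ε, ⟨by linarith, hε⟩, ⟨by linarith, hε⟩, (h x hx).1, (h x hx).2⟩

variable [T2Space N]

/-- Integral curves with the same initial point agree on the intersection of their domains. -/
theorem SmoothField.integralCurve_unique (hX : SmoothField X) {γ γ' : ℝ → N} {a b a' b' s t : ℝ}
    (hγ : IsMIntegralCurveOn (I := 𝓘(ℝ, E)) γ X (Ioo a b))
    (hγ' : IsMIntegralCurveOn (I := 𝓘(ℝ, E)) γ' X (Ioo a' b'))
    (hs : s ∈ Ioo a b) (hs' : s ∈ Ioo a' b') (h : γ s = γ' s)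
    (ht : t ∈ Ioo a b) (ht' : t ∈ Ioo a' b') : γ t = γ' t := by
  have : FiniteDimensional ℝ E := inferInstance
  have : CompleteSpace E := FiniteDimensional.complete ℝ E
  have hX1 : ContMDiff 𝓘(ℝ, E) 𝓘(ℝ, E).tangent 1
      (fun x => (⟨x, X x⟩ : TangentBundle 𝓘(ℝ, E) N)) :=
    ContMDiff.of_le hX (by exact_mod_cast le_top)
  refine isMIntegralCurveOn_Ioo_eqOn_of_contMDiff_boundaryless (t₀ := s) (a := max a a')
    (b := min b b') ⟨max_lt hs.1 hs'.1, lt_min hs.2 hs'.2⟩ hX1 (hγ.mono ?_) (hγ'.mono ?_) h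
    ⟨max_lt ht.1 ht'.1, lt_min ht.2 ht'.2⟩
  · exact Ioo_subset_Ioo (le_max_left _ _) (min_le_left _ _)
  · exact Ioo_subset_Ioo (le_max_right _ _) (min_le_right _ _)

/-- The maximal flow is given by any integral curve. -/
theorem SmoothField.flow_eq (hX : SmoothField X) {γ : ℝ → N} {a b t : ℝ} {x : N}
    (hγ : IsMIntegralCurveOn (I := 𝓘(ℝ, E)) γ X (Ioo a b)) (h0 : 0 ∈ Ioo a b) (ht : t ∈ Ioo a b)
    (hx : γ 0 = x) : (t, x) ∈ flowDomain X ∧ flow X t x = γ t := by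
  have hm : (t, x) ∈ flowDomain X := ⟨γ, a, b, h0, ht, hx, hγ⟩
  refine ⟨hm, ?_⟩
  rw [flow, dif_pos hm]
  obtain ⟨a', b', h0', ht', hx', hc⟩ := hm.choose_spec
  exact hX.integralCurve_unique hc hγ h0' h0 (hx'.trans hx.symm) ht' ht

/-- The orbits of the maximal flow are integral curves. -/
theorem SmoothField.exists_Ioo (hX : SmoothField X) {t : ℝ} {x : N}
    (h : (t, x) ∈ flowDomain X) : ∃ a b : ℝ, 0 ∈ Ioo a b ∧ t ∈ Ioo a b ∧
      (∀ s ∈ Ioo a b, (s, x) ∈ flowDomain X) ∧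
      IsMIntegralCurveOn (I := 𝓘(ℝ, E)) (fun s => flow X s x) X (Ioo a b) := by
  obtain ⟨γ, a, b, h0, ht, hx, hγ⟩ := h
  refine ⟨a, b, h0, ht, fun s hs => (hX.flow_eq hγ h0 hs hx).1, fun s hs => ?_⟩
  have h1 : ∀ s ∈ Ioo a b, flow X s x = γ s := fun s hs => (hX.flow_eq hγ h0 hs hx).2
  have := (hγ s hs).congr_of_eventuallyEq (f₁ := fun s => flow X s x)
    (eventually_nhdsWithin_of_forall h1) (h1 s hs)
  exact this.congr_mfderiv
    (congrArg (fun y : N => ContinuousLinearMap.smulRight (1 : ℝ →L[ℝ] ℝ) (X y : E)) (h1 s hs).symm)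

theorem SmoothField.flow_zero (hX : SmoothField X) (x : N) : flow X 0 x = x := by
  obtain ⟨γ, a, b, h0, ht, hx, hγ⟩ := zero_mem_flowDomain hX x
  rw [(hX.flow_eq hγ h0 h0 hx).2, hx]

/-- The group law of the maximal flow. -/
theorem SmoothField.flow_add (hX : SmoothField X) {s t : ℝ} {x : N}
    (hs : (s, x) ∈ flowDomain X) (ht : (t, flow X s x) ∈ flowDomain X) :
    (t + s, x) ∈ flowDomain X ∧ flow X (t + s) x = flow X t (flow X s x) := by
  classical
  have : CompleteSpace E := FiniteDimensional.complete ℝ E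
  obtain ⟨γ, a, b, h0, h1, hx, hγ⟩ := hs
  have hs' := (hX.flow_eq hγ h0 h1 hx).2
  rw [hs'] at ht ⊢
  obtain ⟨γ', a', b', h0', h1', hx', hγ'⟩ := ht
  have ht' := (hX.flow_eq hγ' h0' h1' hx').2
  rw [ht']
  have hX1 : ContMDiff 𝓘(ℝ, E) 𝓘(ℝ, E).tangent 1
      (fun x => (⟨x, X x⟩ : TangentBundle 𝓘(ℝ, E) N)) :=
    ContMDiff.of_le hX (by exact_mod_cast le_top)
  have hset : {τ : ℝ | τ + -s ∈ Ioo a' b'} = Ioo (a' + s) (b' + s) := by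
    ext τ
    simp only [Set.mem_ofPred_eq, mem_Ioo]
    constructor <;> rintro ⟨h, h'⟩ <;> constructor <;> linarith
  -- The second orbit, delayed by `s`, meets the first one at time `s`; gluing them gives an
  -- integral curve through `x` reaching time `t + s`.
  have hγ'' : IsMIntegralCurveOn (I := 𝓘(ℝ, E)) (γ' ∘ (· + -s)) X (Ioo (a' + s) (b' + s)) := by
    have := hγ'.comp_add (-s)
    rwa [hset] at this
  have hsm : s ∈ Ioo (a' + s) (b' + s) := ⟨by linarith [h0'.1], by linarith [h0'.2]⟩
  have htm : t + s ∈ Ioo (a' + s) (b' + s) := ⟨by linarith [h1'.1], by linarith [h1'.2]⟩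
  have heq : γ s = (γ' ∘ (· + -s)) s := by simp [hx']
  have hp := isMIntegralCurveOn_piecewise hX1 hγ hγ'' ⟨h1, hsm⟩ heq
  rw [Ioo_union_Ioo' (hsm.1.trans h1.2) (h1.1.trans hsm.2)] at hp
  obtain ⟨r1, r2⟩ := hX.flow_eq (t := t + s) (x := x) hp
    ⟨(min_le_left _ _).trans_lt h0.1, h0.2.trans_le (le_max_left _ _)⟩
    ⟨(min_le_right _ _).trans_lt htm.1, htm.2.trans_le (le_max_right _ _)⟩
    (by rw [piecewise, if_pos h0, hx])
  refine ⟨r1, r2.trans ?_⟩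
  -- The glued curve follows γ wherever γ is defined, so uniqueness is needed when `t + s` lies in
  -- the overlap.
  by_cases hm : t + s ∈ Ioo a b
  · rw [piecewise, if_pos hm, hX.integralCurve_unique hγ hγ'' h1 hsm heq hm htm]
    simp
  · rw [piecewise, if_neg hm]
    simp

/-- The shifted curve τ ↦ γ(τ + t) is an integral curve which starts at γ(t) and is back at `x` at
time `-t`. -/
theorem SmoothField.flow_neg (hX : SmoothField X) {t : ℝ} {x : N}
    (h : (t, x) ∈ flowDomain X) :
    (-t, flow X t x) ∈ flowDomain X ∧ flow X (-t) (flow X t x) = x := by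
  obtain ⟨γ, a, b, h0, h1, hx, hγ⟩ := h
  rw [(hX.flow_eq hγ h0 h1 hx).2]
  have hset : {τ : ℝ | τ + t ∈ Ioo a b} = Ioo (a - t) (b - t) := by
    ext τ
    simp only [Set.mem_ofPred_eq, mem_Ioo]
    constructor <;> rintro ⟨h, h'⟩ <;> constructor <;> linarith
  have hγ' := hγ.comp_add t
  rw [hset] at hγ'
  obtain ⟨r1, r2⟩ := hX.flow_eq (t := -t) (x := γ t) hγ' ⟨by linarith [h1.1], by linarith [h1.2]⟩
    ⟨by linarith [h0.1], by linarith [h0.2]⟩ (by simp)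
  exact ⟨r1, r2.trans (by simpa using hx)⟩

/-- `flow X` is smooth near `p`, and defined near `p`. -/
def FlowSmoothAt (X : ∀ x : N, TangentSpace 𝓘(ℝ, E) x) (p : ℝ × N) : Prop :=
  flowDomain X ∈ 𝓝 p ∧ ContMDiffAt (𝓘(ℝ, ℝ).prod 𝓘(ℝ, E)) 𝓘(ℝ, E) ∞
    (fun p : ℝ × N => flow X p.1 p.2) p

/-- Near a point with smooth flow at time `t₁`, the flow at a nearby time is the flow up to `t₁`
followed by a smooth local flow. Smoothness thus spreads in steps whose size depends only on the
point of the orbit that is passed, and connectedness of the time interval carries it from 0 to `t`.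
-/
theorem SmoothField.flowSmoothAt (hX : SmoothField X) {t : ℝ} {x : N}
    (h : (t, x) ∈ flowDomain X) : FlowSmoothAt X (t, x) := by
  -- around each point there is a time by which smoothness can be propagated
  have step : ∀ y : N, ∃ ε > 0, ∃ U, IsOpen U ∧ y ∈ U ∧ ∀ (t₁ t₂ : ℝ) (x : N),
      (t₁, x) ∈ flowDomain X → flow X t₁ x ∈ U → |t₂ - t₁| < ε →
      FlowSmoothAt X (t₁, x) → FlowSmoothAt X (t₂, x) := by
    intro y
    obtain ⟨ε, hε, U, hU, hy, φ, hφ, hc⟩ := hX.exists_localFlow y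
    refine ⟨ε, hε, U, hU, hy, fun t₁ t₂ x hm hxU ht hs => ?_⟩
    have hh : ContMDiffAt (𝓘(ℝ, ℝ).prod 𝓘(ℝ, E)) 𝓘(ℝ, E) ∞
        (fun p : ℝ × N => flow X t₁ p.2) (t₂, x) :=
      hs.2.comp (t₂, x) (f := fun p : ℝ × N => (t₁, p.2)) (contMDiffAt_const.prodMk contMDiffAt_snd)
    have hτ : ContMDiffAt (𝓘(ℝ, ℝ).prod 𝓘(ℝ, E)) 𝓘(ℝ, ℝ) ∞
        (fun p : ℝ × N => p.1 - t₁) (t₂, x) := by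
      have : ContMDiffAt 𝓘(ℝ, ℝ) 𝓘(ℝ, ℝ) ∞ (fun s : ℝ => s - t₁) t₂ :=
        (contDiff_id.sub contDiff_const).contMDiff.contMDiffAt
      exact ContMDiffAt.comp (t₂, x) (f := fun p : ℝ × N => p.1) this contMDiffAt_fst
    have hφ' : ContMDiffAt (𝓘(ℝ, ℝ).prod 𝓘(ℝ, E)) 𝓘(ℝ, E) ∞ φ (t₂ - t₁, flow X t₁ x) :=
      hφ.contMDiffAt ((isOpen_Ioo.prod hU).mem_nhds ⟨abs_lt.1 ht, hxU⟩)
    have hcomp := hφ'.comp (t₂, x) (f := fun p : ℝ × N => (p.1 - t₁, flow X t₁ p.2))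
      (hτ.prodMk hh)
    have e1 : ∀ᶠ p : ℝ × N in 𝓝 (t₂, x), (t₁, p.2) ∈ flowDomain X := by
      have : ContinuousAt (fun p : ℝ × N => (t₁, p.2)) (t₂, x) := by fun_prop
      exact this.eventually hs.1
    have e2 : ∀ᶠ p : ℝ × N in 𝓝 (t₂, x), flow X t₁ p.2 ∈ U :=
      hh.continuousAt.eventually (hU.mem_nhds hxU)
    have e3 : ∀ᶠ p : ℝ × N in 𝓝 (t₂, x), p.1 - t₁ ∈ Ioo (-ε) ε :=
      hτ.continuousAt.eventually (isOpen_Ioo.mem_nhds (abs_lt.1 ht))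
    have e4 : ∀ᶠ p : ℝ × N in 𝓝 (t₂, x), (p.1, p.2) ∈ flowDomain X ∧
        flow X p.1 p.2 = φ (p.1 - t₁, flow X t₁ p.2) := by
      filter_upwards [e1, e2, e3] with p h1 h2 h3
      obtain ⟨q1, q2⟩ := hX.flow_eq (hc _ h2).2 ⟨by linarith, hε⟩ h3 (hc _ h2).1
      have := hX.flow_add h1 q1
      rw [sub_add_cancel, q2] at this
      exact this
    exact ⟨e4.mono fun p hp => hp.1, hcomp.congr_of_eventuallyEq (e4.mono fun p hp => hp.2)⟩
  obtain ⟨a, b, h0, ht, hdom, hγ⟩ := hX.exists_Ioo h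
  have hbase : FlowSmoothAt X (0, x) := by
    obtain ⟨ε, hε, U, hU, hx, φ, hφ, hc⟩ := hX.exists_localFlow x
    have hO : Ioo (-ε) ε ×ˢ U ∈ 𝓝 ((0 : ℝ), x) :=
      (isOpen_Ioo.prod hU).mem_nhds ⟨⟨by linarith, hε⟩, hx⟩
    have e : ∀ p ∈ Ioo (-ε) ε ×ˢ U, p ∈ flowDomain X ∧ flow X p.1 p.2 = φ p := fun p hp =>
      hX.flow_eq (hc _ hp.2).2 ⟨by linarith, hε⟩ hp.1 (hc _ hp.2).1
    exact ⟨mem_of_superset hO fun p hp => (e p hp).1,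
      (hφ.contMDiffAt hO).congr_of_eventuallyEq (mem_of_superset hO fun p hp => (e p hp).2)⟩
  -- The relation "smoothness at t₁ implies smoothness at t₂" is transitive; around each `s` it must
  -- hold in both directions, and both use the local flow at the orbit point of time `s`.
  refine isPreconnected_Ioo.induction₂'
    (fun t₁ t₂ => FlowSmoothAt X (t₁, x) → FlowSmoothAt X (t₂, x)) ?_ ?_ h0 ht hbase
  · intro s hs
    obtain ⟨ε, hε, U, hU, hy, hstep⟩ := step (flow X s x)
    have hcont : ContinuousAt (fun s => flow X s x) s :=
      ((hγ s hs).continuousWithinAt).continuousAt (isOpen_Ioo.mem_nhds hs)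
    have hb : ∀ᶠ r in 𝓝 s, |r - s| < ε := by
      filter_upwards [Metric.ball_mem_nhds s hε] with r hr
      rwa [Metric.mem_ball, Real.dist_eq] at hr
    filter_upwards [self_mem_nhdsWithin,
      mem_nhdsWithin_of_mem_nhds (hcont.eventually (hU.mem_nhds hy)),
      mem_nhdsWithin_of_mem_nhds hb] with r hr hrU hrs
    exact ⟨hstep s r x (hdom s hs) hy hrs, hstep r s x (hdom r hr) hrU (by rwa [abs_sub_comm])⟩
  · intro r s t _ _ _ h1 h2 h3
    exact h2 (h1 h3)

theorem SmoothField.isOpen_flowDomain (hX : SmoothField X) : IsOpen (flowDomain X) :=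
  isOpen_iff_mem_nhds.2 fun _ hp => (hX.flowSmoothAt hp).1

theorem SmoothField.contMDiffAt_flow (hX : SmoothField X) {p : ℝ × N} (h : p ∈ flowDomain X) :
    ContMDiffAt (𝓘(ℝ, ℝ).prod 𝓘(ℝ, E)) 𝓘(ℝ, E) ∞ (fun p : ℝ × N => flow X p.1 p.2) p :=
  (hX.flowSmoothAt h).2

/-- Related vector fields have related flows. -/
theorem SmoothField.flow_map {E' N' : Type*} [NormedAddCommGroup E'] [NormedSpace ℝ E']
    [FiniteDimensional ℝ E'] [TopologicalSpace N'] [ChartedSpace E' N']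
    [IsManifold 𝓘(ℝ, E') ∞ N'] [T2Space N'] {Y : ∀ x : N', TangentSpace 𝓘(ℝ, E') x}
    (hX : SmoothField X) (hY : SmoothField Y) {f : N → N'}
    (hf : ContMDiff 𝓘(ℝ, E) 𝓘(ℝ, E') ∞ f)
    (hXY : ∀ x, mfderiv 𝓘(ℝ, E) 𝓘(ℝ, E') f x (X x) = Y (f x)) {t : ℝ} {x : N}
    (h : (t, x) ∈ flowDomain X) : (t, f x) ∈ flowDomain Y ∧ f (flow X t x) = flow Y t (f x) := by
  obtain ⟨a, b, h0, ht, -, hγ⟩ := hX.exists_Ioo h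
  have := IsMIntegralCurveOn.map hγ (Y := Y) (f := f) (fun t _ => (hf _).mdifferentiableAt (by simp))
    (fun t _ => hXY _)
  have := hY.flow_eq (x := f x) this h0 ht (by simp [hX.flow_zero])
  exact ⟨this.1, this.2.symm⟩

theorem SmoothField.deriv_flow (hX : SmoothField X) (x : N) :
    HasMFDerivAt 𝓘(ℝ, ℝ) 𝓘(ℝ, E) (fun t => flow X t x) 0
      (ContinuousLinearMap.smulRight (1 : ℝ →L[ℝ] ℝ) (X x)) := by
  obtain ⟨a, b, h0, -, -, hγ⟩ := hX.exists_Ioo (zero_mem_flowDomain hX x)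
  have := (hγ 0 h0).hasMFDerivAt (isOpen_Ioo.mem_nhds h0)
  exact this.congr_mfderiv
    (congrArg (fun y : N => ContinuousLinearMap.smulRight (1 : ℝ →L[ℝ] ℝ) (X y : E))
      (hX.flow_zero x))

end MaximalFlow

/-! ### Derivatives as maps between the model spaces -/

section Der

variable {E₁ E₂ E₃ E₄ : Type*} [NormedAddCommGroup E₁] [NormedSpace ℝ E₁]
  [NormedAddCommGroup E₂] [NormedSpace ℝ E₂] [NormedAddCommGroup E₃] [NormedSpace ℝ E₃]
  [NormedAddCommGroup E₄] [NormedSpace ℝ E₄]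
  {H₁ H₂ H₃ H₄ : Type*} [TopologicalSpace H₁] [TopologicalSpace H₂] [TopologicalSpace H₃]
  [TopologicalSpace H₄]
  (I : ModelWithCorners ℝ E₁ H₁) (J : ModelWithCorners ℝ E₂ H₂) (K : ModelWithCorners ℝ E₃ H₃)
  (L : ModelWithCorners ℝ E₄ H₄)
  {N₁ N₂ N₃ N₄ : Type*} [TopologicalSpace N₁] [ChartedSpace H₁ N₁]
  [TopologicalSpace N₂] [ChartedSpace H₂ N₂] [TopologicalSpace N₃] [ChartedSpace H₃ N₃]
  [TopologicalSpace N₄] [ChartedSpace H₄ N₄]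

/-- The derivative of a map between manifolds, as a linear map between the model spaces. -/
def der (f : N₁ → N₂) (x : N₁) : E₁ →L[ℝ] E₂ := mfderiv I J f x

variable {I J K L}

theorem der_comp {f : N₁ → N₂} {g : N₂ → N₃} {x : N₁} (hg : MDifferentiableAt J K g (f x))
    (hf : MDifferentiableAt I J f x) (v : E₁) :
    der I K (fun y => g (f y)) x v = der J K g (f x) (der I J f x v) :=
  mfderiv_comp_apply x hg hf v

theorem der_congr {f g : N₁ → N₂} {x : N₁} (h : f =ᶠ[𝓝 x] g) : der I J f x = der I J g x :=
  h.mfderiv_eq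

theorem der_id (x : N₁) (v : E₁) : der I I (fun y : N₁ => y) x v = v :=
  DFunLike.congr_fun (mfderiv_id (I := I) (x := x)) v

theorem der_const (c : N₂) (x : N₁) (v : E₁) : der I J (fun _ : N₁ => c) x v = 0 :=
  DFunLike.congr_fun (mfderiv_const (I := I) (I' := J) (x := x) (c := c)) v

theorem der_prodMk {f : N₁ → N₂} {g : N₁ → N₃} {x : N₁} (hf : MDifferentiableAt I J f x)
    (hg : MDifferentiableAt I K g x) (v : E₁) :
    der I (J.prod K) (fun y => (f y, g y)) x v = (der I J f x v, der I K g x v) :=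
  DFunLike.congr_fun (mfderiv_prodMk hf hg) v

theorem der_prod {f : N₁ × N₂ → N₃} {x : N₁} {y : N₂}
    (hf : MDifferentiableAt (I.prod J) K f (x, y)) (v : E₁) (w : E₂) :
    der (I.prod J) K f (x, y) (v, w) =
      der I K (fun z => f (z, y)) x v + der J K (fun z => f (x, z)) y w :=
  DFunLike.congr_fun (mfderiv_prod_eq_add_comp hf) (v, w)

/-- The chain rule with the total derivative split into partial ones. It serves both for the action
map of a principal bundle and for the two-variable map behind the Lie derivative. -/
theorem der_comp₂ {F : N₂ × N₃ → N₄} {f : N₁ → N₂} {g : N₁ → N₃} {x : N₁}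
    (hF : MDifferentiableAt (J.prod K) L F (f x, g x)) (hf : MDifferentiableAt I J f x)
    (hg : MDifferentiableAt I K g x) (v : E₁) :
    der I L (fun y => F (f y, g y)) x v =
      der J L (fun z => F (z, g x)) (f x) (der I J f x v) +
        der K L (fun z => F (f x, z)) (g x) (der I K g x v) := by
  rw [der_comp (J := J.prod K) (f := fun y => (f y, g y)) hF (hf.prodMk hg), der_prodMk hf hg,
    der_prod hF]

end Der

/-- A linear map between the tangent spaces at two points is the derivative of a map. -/
theorem exists_smoothNear_der_eq {E₁ E₂ : Type*} [NormedAddCommGroup E₁] [NormedSpace ℝ E₁]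
    [NormedAddCommGroup E₂] [NormedSpace ℝ E₂] {N₁ N₂ : Type*} [TopologicalSpace N₁]
    [ChartedSpace E₁ N₁] [TopologicalSpace N₂] [ChartedSpace E₂ N₂] [IsManifold 𝓘(ℝ, E₁) ∞ N₁]
    [IsManifold 𝓘(ℝ, E₂) ∞ N₂] (x : N₁) (y : N₂) (A : E₁ →L[ℝ] E₂) :
    ∃ f : N₁ → N₂, SmoothNear 𝓘(ℝ, E₁) 𝓘(ℝ, E₂) f x ∧ f x = y ∧
      der 𝓘(ℝ, E₁) 𝓘(ℝ, E₂) f x = A := by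
  set e := extChartAt 𝓘(ℝ, E₁) x
  set e' := extChartAt 𝓘(ℝ, E₂) y
  -- An affine map in the preferred charts at `x` and `y`; these charts have the identity as
  -- derivative at their base points, so the derivative of the composite is `A` itself.
  let a : E₁ → E₂ := fun z => e' y + A (z - e x)
  have ha : ContDiff ℝ ∞ a := contDiff_const.add (A.contDiff.comp (contDiff_id.sub contDiff_const))
  have hax : a (e x) = e' y := by simp [a]
  have s1 : SmoothNear 𝓘(ℝ, E₁) 𝓘(ℝ, E₁) e x :=
    smoothNear_of_contMDiffOn (chart_source_mem_nhds _ _) contMDiffOn_extChartAt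
  have s2 : SmoothNear 𝓘(ℝ, E₁) 𝓘(ℝ, E₂) a (e x) := ha.contMDiff.smoothNear _
  have s3 : SmoothNear 𝓘(ℝ, E₂) 𝓘(ℝ, E₂) e'.symm (a (e x)) := by
    rw [hax]
    exact smoothNear_of_contMDiffOn (extChartAt_target_mem_nhds y) (contMDiffOn_extChartAt_symm y)
  have s12 : SmoothNear 𝓘(ℝ, E₁) 𝓘(ℝ, E₂) (fun z => a (e z)) x := s2.comp s1
  refine ⟨fun z => e'.symm (a (e z)),
    SmoothNear.comp (g := e'.symm) (f := fun z => a (e z)) s3 s12, ?_, ?_⟩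
  · simp only [hax]
    exact extChartAt_to_inv y
  · ext v
    rw [der_comp (g := e'.symm) (f := fun z => a (e z)) s3.mdifferentiableAt s12.mdifferentiableAt,
      der_comp (g := a) (f := e) s2.mdifferentiableAt s1.mdifferentiableAt]
    have d1 : der 𝓘(ℝ, E₁) 𝓘(ℝ, E₁) e x v = v :=
      DFunLike.congr_fun (mfderiv_extChartAt_self (I := 𝓘(ℝ, E₁)) (x := x)) v
    have d2 : ∀ w, der 𝓘(ℝ, E₁) 𝓘(ℝ, E₂) a (e x) w = A w := by
      intro w
      have h1 : HasFDerivAt a A (e x) := by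
        have := (A.hasFDerivAt.comp (e x) ((hasFDerivAt_id (e x)).sub_const (e x))).const_add (e' y)
        exact this
      exact DFunLike.congr_fun h1.hasMFDerivAt.mfderiv w
    have d3 : ∀ w, der 𝓘(ℝ, E₂) 𝓘(ℝ, E₂) e'.symm (e' y) w = w := by
      intro w
      have h1 := mfderivWithin_range_extChartAt_symm (I := 𝓘(ℝ, E₂)) (x := y)
      simp only [modelWithCornersSelf_coe, range_id, mfderivWithin_univ] at h1
      exact DFunLike.congr_fun h1 w
    rw [d1, d2, hax, d3]

/-! ### Tangent vectors of principal bundles -/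

section PrincipalTangent

variable {m : ℕ} {EH EQ : Type*} [NormedAddCommGroup EH] [NormedSpace ℝ EH]
  [NormedAddCommGroup EQ] [NormedSpace ℝ EQ]
  {M : Type*} [TopologicalSpace M] [ChartedSpace (Eu m) M]
  {H : Type*} [TopologicalSpace H] [ChartedSpace EH H] [Group H] [LieGroup 𝓘(ℝ, EH) ∞ H]
  {Q : Type*} [TopologicalSpace Q] [ChartedSpace EQ Q]

namespace PrincipalBundle

variable (B : PrincipalBundle m EH EQ M H Q)

/-- There is a local section through each point. -/
theorem exists_section (u : Q) : ∃ s : M → Q, SmoothNear 𝓘(ℝ, Eu m) 𝓘(ℝ, EQ) s (B.proj u) ∧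
    s (B.proj u) = u ∧ ∀ᶠ y in 𝓝 (B.proj u), B.proj (s y) = y := by
  have hx := B.mem_dom (B.proj u)
  refine ⟨fun y => B.act (B.sectionAt (B.proj u) y)
    (B.div (B.sectionAt (B.proj u) (B.proj u)) u), ?_, ?_, ?_⟩
  · exact B.smoothNear_act (B.sectionAt_smooth hx) (contMDiff_const.smoothNear _)
  · exact B.act_div (B.sectionAt_proj hx)
  · filter_upwards [(B.isOpen_dom (B.proj u)).mem_nhds hx] with y hy
    rw [B.proj_act, B.sectionAt_proj hy]

/-- The coordinate of `q` in the fibre, with respect to a local section `s`. -/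
def vert (s : M → Q) (q : Q) : H := B.div (s (B.proj q)) q

variable {B} {s : M → Q} {u : Q}

theorem smooth_sectionProj (hs : SmoothNear 𝓘(ℝ, Eu m) 𝓘(ℝ, EQ) s (B.proj u)) :
    SmoothNear 𝓘(ℝ, EQ) 𝓘(ℝ, EQ) (fun q => s (B.proj q)) u :=
  SmoothNear.comp (f := B.proj) hs (B.contMDiff_proj.smoothNear u)

theorem eventually_section (hp : ∀ᶠ y in 𝓝 (B.proj u), B.proj (s y) = y) :
    ∀ᶠ q in 𝓝 u, B.proj (s (B.proj q)) = B.proj q :=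
  B.contMDiff_proj.continuous.continuousAt.eventually hp

theorem smooth_vert (hs : SmoothNear 𝓘(ℝ, Eu m) 𝓘(ℝ, EQ) s (B.proj u))
    (hp : ∀ᶠ y in 𝓝 (B.proj u), B.proj (s y) = y) :
    SmoothNear 𝓘(ℝ, EQ) 𝓘(ℝ, EH) (B.vert s) u :=
  B.smoothNear_div (smooth_sectionProj hs) (contMDiff_id.smoothNear u) (eventually_section hp)

theorem act_vert {q : Q} (h : B.proj (s (B.proj q)) = B.proj q) :
    B.act (s (B.proj q)) (B.vert s q) = q := B.act_div h

theorem vert_act {q : Q} (h : B.proj (s (B.proj q)) = B.proj q) (a : H) :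
    B.vert s (B.act q a) = B.vert s q * a := by
  have h' : B.proj (s (B.proj (B.act q a))) = B.proj (B.act q a) := by rwa [B.proj_act]
  refine B.act_injective (s (B.proj q)) ?_
  have := act_vert h'
  rw [B.proj_act] at this
  rw [this, B.act_mul, act_vert h]

theorem vert_self (hsu : s (B.proj u) = u) : B.vert s u = 1 := by
  rw [vert, hsu]
  have := B.div_act u 1
  rwa [B.act_one] at this

variable (B)

theorem mdifferentiableAt_act (p : Q × H) :
    MDifferentiableAt (𝓘(ℝ, EQ).prod 𝓘(ℝ, EH)) 𝓘(ℝ, EQ) (fun p : Q × H => B.act p.1 p.2) p :=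
  (B.contMDiff_act p).mdifferentiableAt (by simp)

theorem contMDiff_act_right (a : H) : ContMDiff 𝓘(ℝ, EQ) 𝓘(ℝ, EQ) ∞ (fun u => B.act u a) :=
  B.contMDiff_act.comp (contMDiff_id.prodMk contMDiff_const)

theorem contMDiff_act_left (u : Q) : ContMDiff 𝓘(ℝ, EH) 𝓘(ℝ, EQ) ∞ (fun a => B.act u a) :=
  B.contMDiff_act.comp (contMDiff_const.prodMk contMDiff_id)

theorem mdiff_act_right (a : H) (u : Q) :
    MDifferentiableAt 𝓘(ℝ, EQ) 𝓘(ℝ, EQ) (fun u => B.act u a) u :=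
  (B.contMDiff_act_right a u).mdifferentiableAt (by simp)

theorem mdiff_act_left (u : Q) (a : H) :
    MDifferentiableAt 𝓘(ℝ, EH) 𝓘(ℝ, EQ) (fun a => B.act u a) a :=
  (B.contMDiff_act_left u a).mdifferentiableAt (by simp)

theorem mdiff_proj (u : Q) : MDifferentiableAt 𝓘(ℝ, EQ) 𝓘(ℝ, Eu m) B.proj u :=
  (B.contMDiff_proj u).mdifferentiableAt (by simp)

/-- The fundamental vector, with values in the model space. -/
def fund (u : Q) : EH →L[ℝ] EQ := der 𝓘(ℝ, EH) 𝓘(ℝ, EQ) (fun a => B.act u a) 1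

theorem der_act_right_one (u : Q) (v : EQ) :
    der 𝓘(ℝ, EQ) 𝓘(ℝ, EQ) (fun u => B.act u 1) u v = v := by
  have : (fun u => B.act u 1) = fun u => u := funext B.act_one
  rw [this, der_id]

/-- The derivative of `f(y) · a(y)` at a point where `a = 1`. -/
theorem der_act {E₁ N₁ H₁ : Type*} [NormedAddCommGroup E₁] [NormedSpace ℝ E₁]
    [TopologicalSpace H₁] {I : ModelWithCorners ℝ E₁ H₁} [TopologicalSpace N₁] [ChartedSpace H₁ N₁]
    {f : N₁ → Q} {a : N₁ → H} {y : N₁} (hf : MDifferentiableAt I 𝓘(ℝ, EQ) f y)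
    (ha : MDifferentiableAt I 𝓘(ℝ, EH) a y) (h1 : a y = 1) (v : E₁) :
    der I 𝓘(ℝ, EQ) (fun y => B.act (f y) (a y)) y v =
      der I 𝓘(ℝ, EQ) f y v + B.fund (f y) (der I 𝓘(ℝ, EH) a y v) := by
  rw [der_comp₂ (J := 𝓘(ℝ, EQ)) (K := 𝓘(ℝ, EH)) (F := fun p : Q × H => B.act p.1 p.2)
    (B.mdifferentiableAt_act _) hf ha, h1, B.der_act_right_one]
  rfl

/-- The map a ↦ π(u · a) is constant. -/
theorem der_proj_fund (u : Q) (v : EH) : der 𝓘(ℝ, EQ) 𝓘(ℝ, Eu m) B.proj u (B.fund u v) = 0 := by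
  have h := der_comp (I := 𝓘(ℝ, EH)) (g := B.proj) (f := fun a => B.act u a) (x := 1)
    (B.mdiff_proj _) (B.mdiff_act_left u 1) v
  simp only [B.proj_act, B.act_one, der_const] at h
  exact h.symm

theorem der_proj_act_right (u : Q) (a : H) (v : EQ) :
    der 𝓘(ℝ, EQ) 𝓘(ℝ, Eu m) B.proj (B.act u a)
      (der 𝓘(ℝ, EQ) 𝓘(ℝ, EQ) (fun u => B.act u a) u v) =
      der 𝓘(ℝ, EQ) 𝓘(ℝ, Eu m) B.proj u v := by
  rw [← der_comp (g := B.proj) (f := fun u => B.act u a) (B.mdiff_proj _) (B.mdiff_act_right a u)]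
  simp only [B.proj_act]

/-- Along the fibre through `u = s(π(u))` the fibre coordinate of `u · a` is `a`. Its derivative is
thus a left inverse of the fundamental map, which gives injectivity of the latter. -/
theorem der_vert_fund (hs : SmoothNear 𝓘(ℝ, Eu m) 𝓘(ℝ, EQ) s (B.proj u))
    (hsu : s (B.proj u) = u) (hp : ∀ᶠ y in 𝓝 (B.proj u), B.proj (s y) = y) (v : EH) :
    der 𝓘(ℝ, EQ) 𝓘(ℝ, EH) (B.vert s) u (B.fund u v) = v := by
  have h := der_comp (I := 𝓘(ℝ, EH)) (K := 𝓘(ℝ, EH)) (g := B.vert s)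
    (f := fun a => B.act u a) (x := 1)
    (by rw [B.act_one]; exact (smooth_vert hs hp).mdifferentiableAt) (B.mdiff_act_left u 1) v
  have e : (fun a => B.vert s (B.act u a)) = fun a => a := by
    funext a
    rw [vert_act (by rw [hsu]), vert_self hsu, one_mul]
  rw [e, der_id, B.act_one] at h
  exact h.symm

theorem fund_injective (u : Q) : Function.Injective (B.fund u) := by
  obtain ⟨s, hs, hsu, hp⟩ := B.exists_section u
  exact Function.LeftInverse.injective (g := der 𝓘(ℝ, EQ) 𝓘(ℝ, EH) (B.vert s) u)
    (B.der_vert_fund hs hsu hp)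

/-- The decomposition of tangent vectors given by a local section. -/
theorem der_section_add (hs : SmoothNear 𝓘(ℝ, Eu m) 𝓘(ℝ, EQ) s (B.proj u))
    (hsu : s (B.proj u) = u) (hp : ∀ᶠ y in 𝓝 (B.proj u), B.proj (s y) = y) (v : EQ) :
    der 𝓘(ℝ, Eu m) 𝓘(ℝ, EQ) s (B.proj u) (der 𝓘(ℝ, EQ) 𝓘(ℝ, Eu m) B.proj u v) +
      B.fund u (der 𝓘(ℝ, EQ) 𝓘(ℝ, EH) (B.vert s) u v) = v := by
  -- Near `u` each point is `s(π(q))` acted on by its fibre coordinate; differentiating this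
  -- identity at `u`, where the coordinate is 1, splits the tangent vector.
  have h := B.der_act (f := fun q => s (B.proj q)) (smooth_sectionProj hs).mdifferentiableAt
    (smooth_vert hs hp).mdifferentiableAt (vert_self hsu) v
  rw [der_comp (g := s) hs.mdifferentiableAt (B.mdiff_proj u), hsu] at h
  rw [← h, der_congr (g := fun q => q), der_id]
  filter_upwards [eventually_section hp] with q hq using act_vert hq

/-- Vertical vectors are fundamental vectors. -/
theorem exists_fund_eq (u : Q) {v : EQ} (h : der 𝓘(ℝ, EQ) 𝓘(ℝ, Eu m) B.proj u v = 0) :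
    ∃ w, B.fund u w = v := by
  obtain ⟨s, hs, hsu, hp⟩ := B.exists_section u
  have := B.der_section_add hs hsu hp v
  rw [h, map_zero, zero_add] at this
  exact ⟨_, this⟩

/-- Fundamental vectors are equivariant. -/
theorem der_act_fund (u : Q) (a : H) (v : EH) :
    der 𝓘(ℝ, EQ) 𝓘(ℝ, EQ) (fun u => B.act u a) u (B.fund u v) =
      B.fund (B.act u a) (Ad EH a⁻¹ v) := by
  have c : ContMDiff 𝓘(ℝ, EH) 𝓘(ℝ, EH) ∞ (fun b : H => a⁻¹ * b * a⁻¹⁻¹) :=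
    (contMDiff_const.mul contMDiff_id).mul contMDiff_const
  have h1 := der_comp (I := 𝓘(ℝ, EH)) (g := fun b => B.act (B.act u a) b)
    (f := fun b : H => a⁻¹ * b * a⁻¹⁻¹) (x := 1) (B.mdiff_act_left _ _)
    ((c 1).mdifferentiableAt (by simp)) v
  have h2 := der_comp (I := 𝓘(ℝ, EH)) (g := fun u => B.act u a)
    (f := fun b => B.act u b) (x := 1) (B.mdiff_act_right _ _) (B.mdiff_act_left u 1) v
  -- Both sides are `u · (b a)`; the double inverse matches the definition of `Ad` at `a⁻¹`.
  have e : (fun b : H => B.act (B.act u a) (a⁻¹ * b * a⁻¹⁻¹)) = fun b => B.act (B.act u b) a := by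
    funext b
    rw [← B.act_mul, ← B.act_mul]
    congr 1
    group
  have e1 : a⁻¹ * 1 * a⁻¹⁻¹ = 1 := by group
  rw [e, e1] at h1
  rw [B.act_one] at h2
  exact h2.symm.trans h1

section Fields

variable [IsManifold 𝓘(ℝ, Eu m) ∞ M] [IsManifold 𝓘(ℝ, EQ) ∞ Q]

/-- An invariant vector field projects onto a unique vector field on the base. -/
theorem existsUnique_projectsOn {Ξ : ∀ u : Q, TangentSpace 𝓘(ℝ, EQ) u}
    (hinv : B.InvariantField Ξ) :
    ∃! ξ : ∀ x : M, TangentSpace 𝓘(ℝ, Eu m) x, B.ProjectsOn Ξ ξ := by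
  let c : M → Q := fun x => (B.proj_surjective x).choose
  have hc : ∀ x, B.proj (c x) = x := fun x => (B.proj_surjective x).choose_spec
  refine ⟨fun x => der 𝓘(ℝ, EQ) 𝓘(ℝ, Eu m) B.proj (c x) (Ξ (c x)), fun u => ?_, fun ξ hξ => ?_⟩
  · obtain ⟨a, ha⟩ := (B.proj_eq_iff (c (B.proj u)) u).1 (hc _)
    have h1 : der 𝓘(ℝ, EQ) 𝓘(ℝ, EQ) (fun v => B.act v a) (c (B.proj u)) (Ξ (c (B.proj u))) =
      Ξ (B.act (c (B.proj u)) a) := hinv a _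
    have h2 := B.der_proj_act_right (c (B.proj u)) a (Ξ (c (B.proj u)))
    rw [h1] at h2
    -- Tangent spaces depend on the point, so an equality of points is generalized and eliminated
    -- instead of being rewritten; this device recurs below.
    have : ∀ w, w = u → (der 𝓘(ℝ, EQ) 𝓘(ℝ, Eu m) B.proj u (Ξ u) : Eu m) =
        der 𝓘(ℝ, EQ) 𝓘(ℝ, Eu m) B.proj w (Ξ w) := by rintro _ rfl; rfl
    exact (this _ ha).trans h2
  · funext x
    have h1 : (der 𝓘(ℝ, EQ) 𝓘(ℝ, Eu m) B.proj (c x) (Ξ (c x)) : Eu m) = ξ (B.proj (c x)) := hξ (c x)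
    have : ∀ y, y = x → (ξ y : Eu m) = ξ x := by rintro _ rfl; rfl
    exact (h1.trans (this _ (hc x))).symm

/-- Near each base point, ξ is the image under Tπ of the field restricted to a smooth local section.
-/
theorem smoothField_of_projectsOn {Ξ : ∀ u : Q, TangentSpace 𝓘(ℝ, EQ) u} (hΞ : SmoothField Ξ)
    {ξ : ∀ x : M, TangentSpace 𝓘(ℝ, Eu m) x} (h : B.ProjectsOn Ξ ξ) : SmoothField ξ := by
  intro x
  obtain ⟨u, rfl⟩ := B.proj_surjective x
  obtain ⟨s, hs, hsu, hp⟩ := B.exists_section u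
  have h1 := (B.contMDiff_proj.smoothNear (s (B.proj u))).contMDiffAt_mfderiv_apply
    (V := fun y => Ξ (s y)) (ContMDiffAt.comp (B.proj u) hΞ.contMDiffAt hs.contMDiffAt)
  refine h1.congr_of_eventuallyEq ?_
  filter_upwards [hp] with y hy
  have h2 := h (s y)
  have : ∀ z, z = y → (⟨y, ξ y⟩ : TangentBundle 𝓘(ℝ, Eu m) M) = ⟨z, ξ z⟩ := by rintro _ rfl; rfl
  rw [this _ hy]
  exact congrArg (Bundle.TotalSpace.mk (B.proj (s y))) h2.symm

end Fields

end PrincipalBundle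

end PrincipalTangent

/-! ### Generalized Kosmann vector fields -/

section Kosmann

variable {m : ℕ} {EG EH EP EQ : Type*} [NormedAddCommGroup EG] [NormedSpace ℝ EG]
  [NormedAddCommGroup EH] [NormedSpace ℝ EH] [NormedAddCommGroup EP] [NormedSpace ℝ EP]
  [NormedAddCommGroup EQ] [NormedSpace ℝ EQ]
  {M : Type*} [TopologicalSpace M] [ChartedSpace (Eu m) M]
  {G : Type*} [TopologicalSpace G] [ChartedSpace EG G] [Group G] [LieGroup 𝓘(ℝ, EG) ∞ G]
  {H : Type*} [TopologicalSpace H] [ChartedSpace EH H] [Group H] [LieGroup 𝓘(ℝ, EH) ∞ H]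
  {P : Type*} [TopologicalSpace P] [ChartedSpace EP P]
  {Q : Type*} [TopologicalSpace Q] [ChartedSpace EQ Q]

namespace ReductiveStructure

variable {BP : PrincipalBundle m EG EP M G P} {BQ : PrincipalBundle m EH EQ M H Q}
  (R : ReductiveStructure BP BQ)

/-- The inclusion of Lie algebras. -/
def dhom : EG →L[ℝ] EH := der 𝓘(ℝ, EG) 𝓘(ℝ, EH) R.hom 1

/-- The derivative of the embedding of the subbundle. -/
def demb (u : P) : EP →L[ℝ] EQ := der 𝓘(ℝ, EP) 𝓘(ℝ, EQ) R.emb u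

theorem dhom_injective : Function.Injective R.dhom := R.mfderiv_hom_injective

theorem isCompl_range : IsCompl (LinearMap.range R.dhom.toLinearMap) R.compl := R.isCompl

/-- The projection along 𝔪, followed by the inverse of the injection of 𝔤 onto its image in 𝔥.
Finite dimension of 𝔥 makes it continuous. -/
theorem exists_projection [FiniteDimensional ℝ EH] :
    ∃ pr : EH →L[ℝ] EG, ∀ v, v - R.dhom (pr v) ∈ R.compl := by
  let e := LinearEquiv.ofInjective R.dhom.toLinearMap R.dhom_injective
  let p := (LinearMap.range R.dhom.toLinearMap).projectionOnto R.compl R.isCompl_range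
  refine ⟨LinearMap.toContinuousLinearMap (e.symm.toLinearMap ∘ₗ p), fun v => ?_⟩
  have h1 : R.dhom (e.symm (p v)) = (p v : EH) := by
    have := LinearEquiv.apply_symm_apply e (p v)
    exact congrArg Subtype.val this
  show v - R.dhom (e.symm (p v)) ∈ R.compl
  rw [h1]
  have h2 : p (v - (p v : EH)) = 0 := by
    rw [map_sub, Submodule.projectionOnto_apply_left, sub_self]
  exact (Submodule.projectionOnto_apply_eq_zero_iff R.isCompl_range).1 h2

theorem mdiff_emb (u : P) : MDifferentiableAt 𝓘(ℝ, EP) 𝓘(ℝ, EQ) R.emb u :=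
  (R.contMDiff_emb u).mdifferentiableAt (by simp)

/-- Differentiate `i(u · a) = i(u) · hom(a)` at the unit. -/
theorem demb_fund (u : P) (v : EG) : R.demb u (BP.fund u v) = BQ.fund (R.emb u) (R.dhom v) := by
  have h1 := der_comp (I := 𝓘(ℝ, EG)) (g := R.emb) (f := fun a => BP.act u a) (x := 1)
    (R.mdiff_emb _) (BP.mdiff_act_left u 1) v
  have h2 := der_comp (I := 𝓘(ℝ, EG)) (g := fun a => BQ.act (R.emb u) a) (f := R.hom) (x := 1)
    (BQ.mdiff_act_left _ _) ((R.contMDiff_hom 1).mdifferentiableAt (by simp)) v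
  simp only [R.emb_act, BP.act_one, map_one] at h1 h2
  exact h1.symm.trans h2

theorem der_proj_demb (u : P) (v : EP) :
    der 𝓘(ℝ, EQ) 𝓘(ℝ, Eu m) BQ.proj (R.emb u) (R.demb u v) =
      der 𝓘(ℝ, EP) 𝓘(ℝ, Eu m) BP.proj u v := by
  have h := der_comp (g := BQ.proj) (f := R.emb) (BQ.mdiff_proj _) (R.mdiff_emb u) v
  simp only [R.proj_emb] at h
  exact h.symm

theorem mem_transverse {u : P} {v : EQ} :
    v ∈ R.transverse u ↔ ∃ w ∈ R.compl, BQ.fund (R.emb u) w = v := Iff.rfl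

theorem der_proj_transverse {u : P} {v : EQ} (h : v ∈ R.transverse u) :
    der 𝓘(ℝ, EQ) 𝓘(ℝ, Eu m) BQ.proj (R.emb u) v = 0 := by
  obtain ⟨w, -, rfl⟩ := R.mem_transverse.1 h
  exact BQ.der_proj_fund _ _

/-- The tangent space of the subbundle meets the transverse space trivially. -/
theorem eq_zero_of_demb_mem {u : P} {v : EP} (h : R.demb u v ∈ R.transverse u) : v = 0 := by
  have h0 := R.der_proj_transverse h
  rw [R.der_proj_demb] at h0
  -- Transverse vectors are vertical, so the vector on `P` is vertical and comes from some `z` in 𝔤.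
  -- By injectivity of the fundamental map of `Q`, the image of `z` lies in 𝔤 ∩ 𝔪 = 0.
  obtain ⟨z, rfl⟩ := BP.exists_fund_eq u h0
  obtain ⟨w, hw, e⟩ := R.mem_transverse.1 h
  rw [R.demb_fund] at e
  have e := BQ.fund_injective _ e
  have h1 : R.dhom z ∈ (LinearMap.range R.dhom.toLinearMap) ⊓ R.compl := ⟨⟨z, rfl⟩, e ▸ hw⟩
  rw [R.isCompl_range.inf_eq_bot, Submodule.mem_bot] at h1
  have : z = 0 := R.dhom_injective (by rw [h1, map_zero])
  rw [this, map_zero]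

/-- The vector `Y` at `u ∈ P` is the component tangent to `P` of the vector `X` at `i(u)`. -/
def IsKosmannAt (u : P) (X : EQ) (Y : EP) : Prop := X - R.demb u Y ∈ R.transverse u

theorem IsKosmannAt.unique {R : ReductiveStructure BP BQ} {u : P} {X : EQ} {Y Y' : EP}
    (h : R.IsKosmannAt u X Y) (h' : R.IsKosmannAt u X Y') : Y = Y' := by
  rw [← sub_eq_zero]
  apply R.eq_zero_of_demb_mem (u := u)
  have : X - R.demb u Y' - (X - R.demb u Y) ∈ R.transverse u := (R.transverse u).sub_mem h' h
  rw [map_sub]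
  convert this using 1
  abel

/-- Translation by `a` carries the fundamental vector of `w` to that of Ad(a⁻¹)w, and 𝔪 is stable
under this; the tangential part follows equivariance of the embedding. This is where reductivity
beyond the direct sum is used. -/
theorem isKosmannAt_act (a : G) {u : P} {X : EQ} {Y : EP} (h : R.IsKosmannAt u X Y) :
    R.IsKosmannAt (BP.act u a)
      (der 𝓘(ℝ, EQ) 𝓘(ℝ, EQ) (fun q => BQ.act q (R.hom a)) (R.emb u) X)
      (der 𝓘(ℝ, EP) 𝓘(ℝ, EP) (fun v => BP.act v a) u Y) := by
  have h1 := der_comp (g := R.emb) (f := fun v => BP.act v a) (R.mdiff_emb _)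
    (BP.mdiff_act_right a u) Y
  have h2 := der_comp (g := fun q => BQ.act q (R.hom a)) (f := R.emb)
    (BQ.mdiff_act_right (R.hom a) (R.emb u)) (R.mdiff_emb u) Y
  simp only [R.emb_act] at h1
  have h5 : R.demb (BP.act u a) (der 𝓘(ℝ, EP) 𝓘(ℝ, EP) (fun v => BP.act v a) u Y) =
    der 𝓘(ℝ, EQ) 𝓘(ℝ, EQ) (fun q => BQ.act q (R.hom a)) (R.emb u) (R.demb u Y) := h1.symm.trans h2
  obtain ⟨w, hw, e⟩ := R.mem_transverse.1 h
  rw [IsKosmannAt, h5, ← map_sub, ← e, BQ.der_act_fund, ← map_inv]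
  exact R.mem_transverse.2 ⟨_, R.Ad_mem a⁻¹ w hw, by rw [R.emb_act]⟩

/-- The local formula for Kosmann vectors: with the help of a local section `s` of the subbundle, the
vector `X` is mapped by the derivative of `q ↦ s(π(q)) · Λ(a)`, where `q = i(s(π(q))) · a` and `Λ` is
a map between the groups which induces a projection along `𝔪` between their Lie algebras. -/
theorem kosmann_formula {pr : EH →L[ℝ] EG} (hpr : ∀ v, v - R.dhom (pr v) ∈ R.compl) {Λ : H → G}
    (sΛ : SmoothNear 𝓘(ℝ, EH) 𝓘(ℝ, EG) Λ 1) (Λ_one : Λ 1 = 1)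
    (dΛ : der 𝓘(ℝ, EH) 𝓘(ℝ, EG) Λ 1 = pr) {s : M → P} {u : P}
    (hs : SmoothNear 𝓘(ℝ, Eu m) 𝓘(ℝ, EP) s (BP.proj u)) (hsu : s (BP.proj u) = u)
    (hp : ∀ᶠ y in 𝓝 (BP.proj u), BP.proj (s y) = y) (X : EQ) :
    R.IsKosmannAt u X (der 𝓘(ℝ, EQ) 𝓘(ℝ, EP)
      (fun q => BP.act (s (BQ.proj q)) (Λ (BQ.vert (fun y => R.emb (s y)) q))) (R.emb u) X) := by
  set S : M → Q := fun y => R.emb (s y) with hS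
  have eu : BQ.proj (R.emb u) = BP.proj u := R.proj_emb u
  have hSs : SmoothNear 𝓘(ℝ, Eu m) 𝓘(ℝ, EQ) S (BQ.proj (R.emb u)) := by
    rw [eu]
    exact SmoothNear.comp (f := s) (R.contMDiff_emb.smoothNear _) hs
  have hSu : S (BQ.proj (R.emb u)) = R.emb u := by simp only [hS, eu, hsu]
  have hSp : ∀ᶠ y in 𝓝 (BQ.proj (R.emb u)), BQ.proj (S y) = y := by
    rw [eu]
    filter_upwards [hp] with y hy
    rw [hS, R.proj_emb, hy]
  have hs' : SmoothNear 𝓘(ℝ, Eu m) 𝓘(ℝ, EP) s (BQ.proj (R.emb u)) := by rwa [eu]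
  have sv := PrincipalBundle.smooth_vert hSs hSp
  have v1 : BQ.vert S (R.emb u) = 1 := PrincipalBundle.vert_self hSu
  have sΛ' : SmoothNear 𝓘(ℝ, EH) 𝓘(ℝ, EG) Λ (BQ.vert S (R.emb u)) := by rwa [v1]
  have sp : SmoothNear 𝓘(ℝ, EQ) 𝓘(ℝ, EP) (fun q => s (BQ.proj q)) (R.emb u) :=
    SmoothNear.comp (f := BQ.proj) hs' (BQ.contMDiff_proj.smoothNear _)
  have d := BP.der_act (f := fun q => s (BQ.proj q)) (a := fun q => Λ (BQ.vert S q))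
    sp.mdifferentiableAt (SmoothNear.comp (f := BQ.vert S) sΛ' sv).mdifferentiableAt
    (by rw [v1, Λ_one]) X
  have d1 := der_comp (g := Λ) (f := BQ.vert S) sΛ'.mdifferentiableAt sv.mdifferentiableAt X
  have d2 := der_comp (g := s) (f := BQ.proj) hs'.mdifferentiableAt (BQ.mdiff_proj (R.emb u)) X
  have d3 := der_comp (g := R.emb) (f := s) (x := BQ.proj (R.emb u)) (R.mdiff_emb _)
    hs'.mdifferentiableAt (der 𝓘(ℝ, EQ) 𝓘(ℝ, Eu m) BQ.proj (R.emb u) X)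
  have d4 := BQ.der_section_add hSs hSu hSp X
  rw [IsKosmannAt, d, d1, d2, v1, dΛ, map_add]
  simp only [eu, hsu] at d3 d4 ⊢
  have d3' : R.demb u (der 𝓘(ℝ, Eu m) 𝓘(ℝ, EP) s (BP.proj u)
      (der 𝓘(ℝ, EQ) 𝓘(ℝ, Eu m) BQ.proj (R.emb u) X)) = _ := d3.symm
  rw [d3', R.demb_fund]
  set V := der 𝓘(ℝ, EQ) 𝓘(ℝ, EH) (BQ.vert S) (R.emb u) X
  -- `V` is the vertical coordinate of `X`. The horizontal parts of `X` and of the Kosmann vector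
  -- both come from the section and cancel, leaving the fundamental vector of the 𝔪-part of `V`.
  refine R.mem_transverse.2 ⟨V - R.dhom (pr V), hpr V, ?_⟩
  rw [map_sub]
  rw [eq_sub_iff_add_eq]
  conv_rhs => rw [← d4]
  simp only [hS]
  abel

section Fields

variable [IsManifold 𝓘(ℝ, EP) ∞ P] [IsManifold 𝓘(ℝ, EQ) ∞ Q] [FiniteDimensional ℝ EH]

/-- Λ need not be a homomorphism: only its value and derivative at the unit matter. Having it as a
map, and not just the linear projection, allows Kosmann vectors to be written as derivatives of
maps. -/
theorem exists_lift :
    ∃ (pr : EH →L[ℝ] EG) (Λ : H → G), (∀ v, v - R.dhom (pr v) ∈ R.compl) ∧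
      SmoothNear 𝓘(ℝ, EH) 𝓘(ℝ, EG) Λ 1 ∧ Λ 1 = 1 ∧ der 𝓘(ℝ, EH) 𝓘(ℝ, EG) Λ 1 = pr := by
  obtain ⟨pr, hpr⟩ := R.exists_projection
  obtain ⟨Λ, h1, h2, h3⟩ := exists_smoothNear_der_eq (1 : H) (1 : G) pr
  exact ⟨pr, Λ, hpr, h1, h2, h3⟩

/-- Every vector field has a unique generalized Kosmann vector field. -/
theorem existsUnique_isKosmannField (Ξ : ∀ u : Q, TangentSpace 𝓘(ℝ, EQ) u) :
    ∃! ΞK : ∀ u : P, TangentSpace 𝓘(ℝ, EP) u, R.IsKosmannField Ξ ΞK := by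
  obtain ⟨pr, Λ, hpr, sΛ, Λ_one, dΛ⟩ := R.exists_lift
  have h : ∀ u, ∃ Y : EP, R.IsKosmannAt u (Ξ (R.emb u)) Y := fun u => by
    obtain ⟨s, hs, hsu, hp⟩ := BP.exists_section u
    exact ⟨_, R.kosmann_formula hpr sΛ Λ_one dΛ hs hsu hp _⟩
  choose Y hY using h
  exact ⟨Y, hY, fun Y' hY' => funext fun u => IsKosmannAt.unique (R := R) (hY' u) (hY u)⟩

/-- `kosmann_formula` needs a section through the point considered. As `u` varies, a fixed section
`s` is translated by the fibre coordinate `g u`, so that it passes through `u`. The resulting map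
`K` is jointly smooth on `P × Q`, and the Kosmann vector at `u` is its derivative at `(u, i(u))` in
the direction (0, Ξ), a smooth family of tangent vectors. -/
theorem smoothField_kosmann {Ξ : ∀ u : Q, TangentSpace 𝓘(ℝ, EQ) u} (hΞ : SmoothField Ξ)
    {ΞK : ∀ u : P, TangentSpace 𝓘(ℝ, EP) u} (hK : R.IsKosmannField Ξ ΞK) : SmoothField ΞK := by
  intro u₀
  obtain ⟨pr, Λ, hpr, sΛ, Λ_one, dΛ⟩ := R.exists_lift
  obtain ⟨s, hs, hsu, hp⟩ := BP.exists_section u₀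
  let g : P → G := BP.vert s
  have g1 : g u₀ = 1 := PrincipalBundle.vert_self hsu
  let σ : P × Q → P := fun p => BP.act (s (BQ.proj p.2)) (g p.1)
  let K : P × Q → P := fun p => BP.act (σ p) (Λ (BQ.div (R.emb (σ p)) p.2))
  have eu : ∀ u, BQ.proj (R.emb u) = BP.proj u := R.proj_emb
  have sg : SmoothNear 𝓘(ℝ, EP) 𝓘(ℝ, EG) g u₀ := PrincipalBundle.smooth_vert hs hp
  have sσ : SmoothNear (𝓘(ℝ, EP).prod 𝓘(ℝ, EQ)) 𝓘(ℝ, EP) σ (u₀, R.emb u₀) := by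
    refine BP.smoothNear_act ?_ ?_
    · exact SmoothNear.comp (g := s) (f := fun p : P × Q => BQ.proj p.2) (by simpa only [eu] using hs)
        ((BQ.contMDiff_proj.comp contMDiff_snd).smoothNear _)
    · exact SmoothNear.comp (g := g) (f := fun p : P × Q => p.1) sg (contMDiff_fst.smoothNear _)
  have σ0 : σ (u₀, R.emb u₀) = u₀ := by simp only [σ, eu, hsu, g1, BP.act_one]
  have hproj : ∀ᶠ p in 𝓝 (u₀, R.emb u₀), BQ.proj (R.emb (σ p)) = BQ.proj p.2 := by
    have h1 : Tendsto (fun p : P × Q => BQ.proj p.2) (𝓝 (u₀, R.emb u₀)) (𝓝 (BP.proj u₀)) := by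
      rw [← eu]
      exact (BQ.contMDiff_proj.continuous.comp continuous_snd).continuousAt
    filter_upwards [h1.eventually hp] with p hp
    rw [eu, BP.proj_act, hp]
  have sdiv : SmoothNear (𝓘(ℝ, EP).prod 𝓘(ℝ, EQ)) 𝓘(ℝ, EH)
      (fun p : P × Q => BQ.div (R.emb (σ p)) p.2) (u₀, R.emb u₀) :=
    BQ.smoothNear_div (SmoothNear.comp (g := R.emb) (f := σ) (R.contMDiff_emb.smoothNear _) sσ)
      (contMDiff_snd.smoothNear _) hproj
  have sK : SmoothNear (𝓘(ℝ, EP).prod 𝓘(ℝ, EQ)) 𝓘(ℝ, EP) K (u₀, R.emb u₀) := by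
    refine BP.smoothNear_act sσ (SmoothNear.comp (g := Λ)
      (f := fun p : P × Q => BQ.div (R.emb (σ p)) p.2) ?_ sdiv)
    have : BQ.div (R.emb u₀) (R.emb u₀) = 1 := by
      have := BQ.div_act (R.emb u₀) 1
      rwa [BQ.act_one] at this
    simp only [σ0, this]
    exact sΛ
  have sΞ : ContMDiffAt 𝓘(ℝ, EP) 𝓘(ℝ, EQ).tangent ∞
      (fun u => (⟨R.emb u, Ξ (R.emb u)⟩ : TangentBundle 𝓘(ℝ, EQ) Q)) u₀ :=
    ContMDiffAt.comp (g := fun q => (⟨q, Ξ q⟩ : TangentBundle 𝓘(ℝ, EQ) Q)) u₀ (hΞ _)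
      (R.contMDiff_emb u₀)
  have sV := contMDiffAt_vector_prodMk (contMDiffAt_vector_zero (contMDiffAt_id (x := u₀)
    (I := 𝓘(ℝ, EP)) (n := ∞))) sΞ
  have main := SmoothNear.contMDiffAt_mfderiv_apply (g := fun u => (u, R.emb u)) sK sV
  refine main.congr_of_eventuallyEq ?_
  have hsm : ∀ᶠ u in 𝓝 u₀, (SmoothNear 𝓘(ℝ, Eu m) 𝓘(ℝ, EP) s (BP.proj u) ∧
      ∀ᶠ y in 𝓝 (BP.proj u), BP.proj (s y) = y) ∧
      SmoothNear (𝓘(ℝ, EP).prod 𝓘(ℝ, EQ)) 𝓘(ℝ, EP) K (u, R.emb u) := by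
    refine (BP.contMDiff_proj.continuous.continuousAt.eventually
      ((eventually_eventually_nhds.2 hs).and (eventually_eventually_nhds.2 hp))).and ?_
    exact (continuous_id.prodMk R.contMDiff_emb.continuous).continuousAt.eventually
      (eventually_eventually_nhds.2 sK)
  filter_upwards [hsm] with u hu
  obtain ⟨⟨hs', hp'⟩, hK'⟩ := hu
  have hpu : BP.proj (s (BP.proj u)) = BP.proj u := hp'.self_of_nhds
  have hσu : BP.act (s (BP.proj u)) (g u) = u := PrincipalBundle.act_vert hpu
  -- With `u` frozen, the partial map `K (u, ·)` is exactly the map of `kosmann_formula` for the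
  -- translated section.
  have e1 := R.kosmann_formula hpr sΛ Λ_one dΛ (s := fun y => BP.act (s y) (g u)) (u := u)
    (BP.smoothNear_act hs' (contMDiff_const.smoothNear _)) hσu
    (by filter_upwards [hp'] with y hy; rw [BP.proj_act, hy]) (Ξ (R.emb u))
  have e2 : (ΞK u : EP) = der 𝓘(ℝ, EQ) 𝓘(ℝ, EP) (fun q => K (u, q)) (R.emb u) (Ξ (R.emb u)) :=
    IsKosmannAt.unique (R := R) (hK u) e1
  have e3 := der_prod (I := 𝓘(ℝ, EP)) (J := 𝓘(ℝ, EQ)) hK'.mdifferentiableAt 0 (Ξ (R.emb u))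
  rw [map_zero, zero_add, ← e2] at e3
  have e4 : K (u, R.emb u) = u := by
    have h1 : σ (u, R.emb u) = u := by simp only [σ, eu, hσu]
    have : BQ.div (R.emb u) (R.emb u) = 1 := by
      have := BQ.div_act (R.emb u) 1
      rwa [BQ.act_one] at this
    simp only [K, h1, this, Λ_one, BP.act_one]
  have : ∀ (z : P) (v w : EP), z = u → v = w →
      (⟨u, w⟩ : TangentBundle 𝓘(ℝ, EP) P) = ⟨z, v⟩ := by
    rintro _ _ _ rfl rfl; rfl
  exact this _ _ _ e4 e3

/-- By uniqueness: the translate of the Kosmann vector at `u` and the Kosmann vector at `u · a` are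
both tangential components of the same vector of Ξ. -/
theorem invariantField_kosmann {Ξ : ∀ u : Q, TangentSpace 𝓘(ℝ, EQ) u} (hinv : BQ.InvariantField Ξ)
    {ΞK : ∀ u : P, TangentSpace 𝓘(ℝ, EP) u} (hK : R.IsKosmannField Ξ ΞK) :
    BP.InvariantField ΞK := by
  intro a u
  have h3 : der 𝓘(ℝ, EQ) 𝓘(ℝ, EQ) (fun q => BQ.act q (R.hom a)) (R.emb u) (Ξ (R.emb u)) =
    (Ξ (BQ.act (R.emb u) (R.hom a)) : EQ) := hinv (R.hom a) (R.emb u)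
  have h4 : (Ξ (BQ.act (R.emb u) (R.hom a)) : EQ) = Ξ (R.emb (BP.act u a)) := by
    have : ∀ z, z = BQ.act (R.emb u) (R.hom a) →
      (Ξ (BQ.act (R.emb u) (R.hom a)) : EQ) = Ξ z := by rintro _ rfl; rfl
    exact this _ (R.emb_act u a)
  have key := R.isKosmannAt_act a (hK u)
  have key' : ∀ X : EQ, der 𝓘(ℝ, EQ) 𝓘(ℝ, EQ) (fun q => BQ.act q (R.hom a)) (R.emb u)
      (Ξ (R.emb u)) = X → R.IsKosmannAt (BP.act u a) X
      (der 𝓘(ℝ, EP) 𝓘(ℝ, EP) (fun v => BP.act v a) u (ΞK u)) := by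
    rintro _ rfl
    exact key
  exact IsKosmannAt.unique (R := R) (key' _ (h3.trans h4)) (hK _)

/-- The two fields differ by transverse vectors, which are vertical. -/
theorem projectsOn_kosmann {Ξ : ∀ u : Q, TangentSpace 𝓘(ℝ, EQ) u}
    {ξ : ∀ x : M, TangentSpace 𝓘(ℝ, Eu m) x} (hξ : BQ.ProjectsOn Ξ ξ)
    {ΞK : ∀ u : P, TangentSpace 𝓘(ℝ, EP) u} (hK : R.IsKosmannField Ξ ΞK) :
    BP.ProjectsOn ΞK ξ := by
  intro u
  have h0 : ∀ (X : EQ) (Y : EP), R.IsKosmannAt u X Y →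
      der 𝓘(ℝ, EQ) 𝓘(ℝ, Eu m) BQ.proj (R.emb u) X = der 𝓘(ℝ, EP) 𝓘(ℝ, Eu m) BP.proj u Y := by
    intro X Y h
    have h1 := R.der_proj_transverse h
    rwa [map_sub, R.der_proj_demb, sub_eq_zero] at h1
  have h2 := h0 _ _ (hK u)
  have h3 : der 𝓘(ℝ, EQ) 𝓘(ℝ, Eu m) BQ.proj (R.emb u) (Ξ (R.emb u)) = (ξ (BQ.proj (R.emb u)) : Eu m) :=
    hξ _
  have : ∀ z, z = BP.proj u → (ξ z : Eu m) = ξ (BP.proj u) := by rintro _ rfl; rfl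
  exact h2.symm.trans (h3.trans (this _ (R.proj_emb u)))

end Fields

end ReductiveStructure

end Kosmann

/-! ### Division in the fibres of a principal bundle. -/

section Division

variable {m : ℕ} {EH EQ : Type*} [NormedAddCommGroup EH] [NormedSpace ℝ EH]
  [NormedAddCommGroup EQ] [NormedSpace ℝ EQ]
  {M : Type*} [TopologicalSpace M] [ChartedSpace (Eu m) M]
  {H : Type*} [TopologicalSpace H] [ChartedSpace EH H] [Group H]
  {Q : Type*} [TopologicalSpace Q] [ChartedSpace EQ Q]

namespace PrincipalBundle

variable {B : PrincipalBundle m EH EQ M H Q}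

theorem div_act_left {u q : Q} (h : B.proj u = B.proj q) (a : H) :
    B.div (B.act u a) q = a⁻¹ * B.div u q := by
  refine B.act_injective (B.act u a) ?_
  rw [B.act_div (by rwa [B.proj_act]), ← B.act_mul, mul_inv_cancel_left, B.act_div h]

theorem div_act_right {u q : Q} (h : B.proj u = B.proj q) (a : H) :
    B.div u (B.act q a) = B.div u q * a := by
  refine B.act_injective u ?_
  rw [B.act_div (by rwa [B.proj_act]), B.act_mul, B.act_div h]

end PrincipalBundle

end Division

/-! ### Flows of invariant vector fields -/

theorem SmoothField.isOpen_time {E N : Type*} [NormedAddCommGroup E] [NormedSpace ℝ E]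
    [TopologicalSpace N] [ChartedSpace E N] [IsManifold 𝓘(ℝ, E) ∞ N] [FiniteDimensional ℝ E]
    [T2Space N] {X : ∀ x : N, TangentSpace 𝓘(ℝ, E) x} (hX : SmoothField X) (t : ℝ) :
    IsOpen {x | (t, x) ∈ flowDomain X} :=
  hX.isOpen_flowDomain.preimage (by fun_prop : Continuous fun x : N => (t, x))

theorem SmoothField.contMDiffAt_flow_time {E N : Type*} [NormedAddCommGroup E] [NormedSpace ℝ E]
    [TopologicalSpace N] [ChartedSpace E N] [IsManifold 𝓘(ℝ, E) ∞ N] [FiniteDimensional ℝ E]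
    [T2Space N] {X : ∀ x : N, TangentSpace 𝓘(ℝ, E) x} (hX : SmoothField X) {t : ℝ} {x : N}
    (h : (t, x) ∈ flowDomain X) : ContMDiffAt 𝓘(ℝ, E) 𝓘(ℝ, E) ∞ (flow X t) x :=
  ContMDiffAt.comp (g := fun p : ℝ × N => flow X p.1 p.2) (f := fun x => (t, x)) x
    (hX.contMDiffAt_flow h) (contMDiffAt_const.prodMk contMDiffAt_id)

theorem SmoothField.flow_mem_neg {E N : Type*} [NormedAddCommGroup E] [NormedSpace ℝ E]
    [TopologicalSpace N] [ChartedSpace E N] [IsManifold 𝓘(ℝ, E) ∞ N] [FiniteDimensional ℝ E]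
    [T2Space N] {X : ∀ x : N, TangentSpace 𝓘(ℝ, E) x} (hX : SmoothField X) {t : ℝ} {x : N}
    (h : (-t, x) ∈ flowDomain X) :
    (t, flow X (-t) x) ∈ flowDomain X ∧ flow X t (flow X (-t) x) = x := by
  have := hX.flow_neg h
  rwa [neg_neg] at this

/-- The time `t` map of the flow, as a diffeomorphism between open subsets. -/
def SmoothField.flowDiffeo {E N : Type*} [NormedAddCommGroup E] [NormedSpace ℝ E]
    [TopologicalSpace N] [ChartedSpace E N] [IsManifold 𝓘(ℝ, E) ∞ N] [FiniteDimensional ℝ E]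
    [T2Space N] {X : ∀ x : N, TangentSpace 𝓘(ℝ, E) x} (hX : SmoothField X) (t : ℝ) :
    PartialDiffeomorph 𝓘(ℝ, E) 𝓘(ℝ, E) N N ∞ where
  toFun := flow X t
  invFun := flow X (-t)
  source := {x | (t, x) ∈ flowDomain X}
  target := {x | (-t, x) ∈ flowDomain X}
  map_source' _ hx := (hX.flow_neg hx).1
  map_target' _ hx := (hX.flow_mem_neg hx).1
  left_inv' _ hx := (hX.flow_neg hx).2
  right_inv' _ hx := (hX.flow_mem_neg hx).2
  open_source := hX.isOpen_time t
  open_target := hX.isOpen_time (-t)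
  contMDiffOn_toFun _ hx := (hX.contMDiffAt_flow_time hx).contMDiffWithinAt
  contMDiffOn_invFun _ hx := (hX.contMDiffAt_flow_time hx).contMDiffWithinAt

section InvariantFlow

variable {m : ℕ} {EH EQ : Type*} [NormedAddCommGroup EH] [NormedSpace ℝ EH]
  [NormedAddCommGroup EQ] [NormedSpace ℝ EQ]
  {M : Type*} [TopologicalSpace M] [ChartedSpace (Eu m) M]
  {H : Type*} [TopologicalSpace H] [ChartedSpace EH H] [Group H] [LieGroup 𝓘(ℝ, EH) ∞ H]
  {Q : Type*} [TopologicalSpace Q] [ChartedSpace EQ Q]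
  [IsManifold 𝓘(ℝ, Eu m) ∞ M] [IsManifold 𝓘(ℝ, EQ) ∞ Q]

namespace PrincipalBundle

/-- `X` is a smooth invariant vector field on `Q` over the smooth vector field `ξ` on `M`. -/
structure IsInvariantLift (B : PrincipalBundle m EH EQ M H Q)
    (X : ∀ u : Q, TangentSpace 𝓘(ℝ, EQ) u) (ξ : ∀ x : M, TangentSpace 𝓘(ℝ, Eu m) x) : Prop where
  smooth : SmoothField X
  smooth_base : SmoothField ξ
  invariant : B.InvariantField X
  projects : B.ProjectsOn X ξ

variable {B : PrincipalBundle m EH EQ M H Q} {X : ∀ u : Q, TangentSpace 𝓘(ℝ, EQ) u}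
  {ξ : ∀ x : M, TangentSpace 𝓘(ℝ, Eu m) x}
  [T2Space M] [T2Space Q] [FiniteDimensional ℝ EQ]

namespace IsInvariantLift

variable (h : B.IsInvariantLift X ξ)
include h

theorem flow_proj {t : ℝ} {u : Q} (hu : (t, u) ∈ flowDomain X) :
    (t, B.proj u) ∈ flowDomain ξ ∧ B.proj (flow X t u) = flow ξ t (B.proj u) :=
  h.smooth.flow_map h.smooth_base B.contMDiff_proj h.projects hu

theorem flow_act (a : H) {t : ℝ} {u : Q} (hu : (t, u) ∈ flowDomain X) :
    (t, B.act u a) ∈ flowDomain X ∧ B.act (flow X t u) a = flow X t (B.act u a) :=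
  h.smooth.flow_map h.smooth (B.contMDiff_act_right a) (h.invariant a) hu

/-- There is a common life time for the integral curves through the points over a neighbourhood of
a point of the base. -/
theorem exists_time (x₀ : M) : ∃ ε > 0, ∀ᶠ x in 𝓝 x₀, ∀ t : ℝ, |t| < ε → ∀ u, B.proj u = x →
    (t, u) ∈ flowDomain X := by
  obtain ⟨u₀, rfl⟩ := B.proj_surjective x₀
  obtain ⟨s, hs, hsu, hp⟩ := B.exists_section u₀
  have h0 : flowDomain X ∈ 𝓝 ((0 : ℝ), s (B.proj u₀)) :=
    h.smooth.isOpen_flowDomain.mem_nhds (zero_mem_flowDomain h.smooth _)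
  rw [nhds_prod_eq] at h0
  obtain ⟨T, hT, W, hW, hTW⟩ := mem_prod_iff.1 h0
  obtain ⟨ε, hε, hεT⟩ := Metric.mem_nhds_iff.1 hT
  refine ⟨ε, hε, ?_⟩
  filter_upwards [hs.contMDiffAt.continuousAt.eventually hW, hp] with x hx hpx t ht u hu
  -- A life time valid along a local section is valid on whole fibres, because every point over `x`
  -- is a translate of `s x`.
  obtain ⟨a, rfl⟩ := (B.proj_eq_iff (s x) u).1 (hpx.trans hu.symm)
  refine (h.flow_act a (hTW ⟨hεT ?_, hx⟩)).1
  rwa [Metric.mem_ball, Real.dist_eq, sub_zero]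

/-- Integral curves of `X` are defined as long as their projections. -/
theorem mem_flowDomain_iff {t : ℝ} {u : Q} :
    (t, u) ∈ flowDomain X ↔ (t, B.proj u) ∈ flowDomain ξ := by
  refine ⟨fun hu => (h.flow_proj hu).1, fun hx => ?_⟩
  obtain ⟨a, b, h0, ht, -, hγ⟩ := h.smooth_base.exists_Ioo hx
  -- Continuation along the base orbit: around each of its points `exists_time` gives a life time
  -- common to all fibres nearby, so the curve upstairs can be extended across that point in both
  -- directions of time.
  refine isPreconnected_Ioo.induction₂'
    (fun t₁ t₂ => (t₁, u) ∈ flowDomain X → (t₂, u) ∈ flowDomain X) ?_ ?_ h0 ht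
    (zero_mem_flowDomain h.smooth u)
  · intro s hs
    obtain ⟨ε, hε, hU⟩ := h.exists_time (flow ξ s (B.proj u))
    have hcont : ContinuousAt (fun s => flow ξ s (B.proj u)) s :=
      ((hγ s hs).continuousWithinAt).continuousAt (isOpen_Ioo.mem_nhds hs)
    have hb : ∀ᶠ r in 𝓝 s, |r - s| < ε := by
      filter_upwards [Metric.ball_mem_nhds s hε] with r hr
      rwa [Metric.mem_ball, Real.dist_eq] at hr
    have key : ∀ r r', (∀ t : ℝ, |t| < ε → ∀ v, B.proj v = flow ξ r (B.proj u) →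
        (t, v) ∈ flowDomain X) → |r' - r| < ε → (r, u) ∈ flowDomain X →
        (r', u) ∈ flowDomain X := by
      intro r r' h1 h2 h3
      have := (h.smooth.flow_add h3 (h1 (r' - r) h2 _ (h.flow_proj h3).2)).1
      rwa [sub_add_cancel] at this
    filter_upwards [mem_nhdsWithin_of_mem_nhds (hcont.eventually hU),
      mem_nhdsWithin_of_mem_nhds hb] with r hrU hrs
    exact ⟨key s r hU.self_of_nhds hrs, key r s hrU (by rwa [abs_sub_comm])⟩
  · intro r s t _ _ _ h1 h2 h3
    exact h2 (h1 h3)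

end IsInvariantLift

end PrincipalBundle

end InvariantFlow

/-! ### Extension of the flow to `Q` -/

section Extension

variable {m : ℕ} {EG EH EP EQ : Type*} [NormedAddCommGroup EG] [NormedSpace ℝ EG]
  [NormedAddCommGroup EH] [NormedSpace ℝ EH] [NormedAddCommGroup EP] [NormedSpace ℝ EP]
  [NormedAddCommGroup EQ] [NormedSpace ℝ EQ]
  {M : Type*} [TopologicalSpace M] [ChartedSpace (Eu m) M]
  {G : Type*} [TopologicalSpace G] [ChartedSpace EG G] [Group G] [LieGroup 𝓘(ℝ, EG) ∞ G]
  {H : Type*} [TopologicalSpace H] [ChartedSpace EH H] [Group H] [LieGroup 𝓘(ℝ, EH) ∞ H]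
  {P : Type*} [TopologicalSpace P] [ChartedSpace EP P]
  {Q : Type*} [TopologicalSpace Q] [ChartedSpace EQ Q]
  [IsManifold 𝓘(ℝ, Eu m) ∞ M] [IsManifold 𝓘(ℝ, EP) ∞ P]
  [T2Space M] [T2Space P] [FiniteDimensional ℝ EP]

namespace ReductiveStructure

variable {BP : PrincipalBundle m EG EP M G P} {BQ : PrincipalBundle m EH EQ M H Q}
  (R : ReductiveStructure BP BQ) (X : ∀ u : P, TangentSpace 𝓘(ℝ, EP) u)
  {ξ : ∀ x : M, TangentSpace 𝓘(ℝ, Eu m) x}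

/-- The equivariant extension to `Q` of the time `t` map of the flow of `X`. -/
def extend (t : ℝ) (q : Q) : Q :=
  BQ.act (R.emb (flow X t (BP.proj_surjective (BQ.proj q)).choose))
    (BQ.div (R.emb (BP.proj_surjective (BQ.proj q)).choose) q)

variable {X} (h : BP.IsInvariantLift X ξ)
include h

/-- Independence of the point chosen over `π(q)`: another choice is `c · a` with `a` in `G`, the
flow commutes with `a`, and the factors `hom a` and `(hom a)⁻¹` cancel. -/
theorem extend_eq {t : ℝ} {q : Q} (ht : (t, BQ.proj q) ∈ flowDomain ξ) {u : P}
    (hu : BP.proj u = BQ.proj q) :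
    R.extend X t q = BQ.act (R.emb (flow X t u)) (BQ.div (R.emb u) q) := by
  have hc := (BP.proj_surjective (BQ.proj q)).choose_spec
  set c := (BP.proj_surjective (BQ.proj q)).choose with hc'
  obtain ⟨a, rfl⟩ := (BP.proj_eq_iff c u).1 (hc.trans hu.symm)
  have hm : (t, c) ∈ flowDomain X := h.mem_flowDomain_iff.2 (by rwa [hc])
  rw [extend, ← hc', ← (h.flow_act a hm).2, R.emb_act, R.emb_act,
    PrincipalBundle.div_act_left (by rw [R.proj_emb, hc]), ← BQ.act_mul, mul_inv_cancel_left]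

theorem exists_lift_mem {t : ℝ} {q : Q} (ht : (t, BQ.proj q) ∈ flowDomain ξ) :
    ∃ u : P, BP.proj u = BQ.proj q ∧ (t, u) ∈ flowDomain X := by
  obtain ⟨u, hu⟩ := BP.proj_surjective (BQ.proj q)
  exact ⟨u, hu, h.mem_flowDomain_iff.2 (by rwa [hu])⟩

theorem proj_extend {t : ℝ} {q : Q} (ht : (t, BQ.proj q) ∈ flowDomain ξ) :
    BQ.proj (R.extend X t q) = flow ξ t (BQ.proj q) := by
  obtain ⟨u, hu, hm⟩ := exists_lift_mem h ht
  rw [R.extend_eq h ht hu, BQ.proj_act, R.proj_emb, (h.flow_proj hm).2, hu]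

theorem extend_act {t : ℝ} {q : Q} (ht : (t, BQ.proj q) ∈ flowDomain ξ) (a : H) :
    R.extend X t (BQ.act q a) = BQ.act (R.extend X t q) a := by
  obtain ⟨u, hu, hm⟩ := exists_lift_mem h ht
  rw [R.extend_eq h ht hu, R.extend_eq h (u := u) (by rwa [BQ.proj_act]) (by rwa [BQ.proj_act]),
    PrincipalBundle.div_act_right (by rw [R.proj_emb, hu]), BQ.act_mul]

theorem extend_emb {t : ℝ} {u : P} (ht : (t, BP.proj u) ∈ flowDomain ξ) :
    R.extend X t (R.emb u) = R.emb (flow X t u) := by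
  rw [R.extend_eq h (u := u) (by rwa [R.proj_emb]) (by rw [R.proj_emb])]
  have := BQ.div_act (R.emb u) 1
  rw [BQ.act_one] at this
  rw [this, BQ.act_one]

/-- Writing `q = i(u) · b`, each extension moves only `u` and leaves `b` unchanged, so the group law
is that of the flow on `P`. -/
theorem extend_extend {s t : ℝ} {q : Q} (hs : (s, BQ.proj q) ∈ flowDomain ξ)
    (ht : (t, flow ξ s (BQ.proj q)) ∈ flowDomain ξ) :
    R.extend X t (R.extend X s q) = R.extend X (t + s) q := by
  obtain ⟨u, hu, hm⟩ := exists_lift_mem h hs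
  have hp := R.proj_extend h hs
  have hpu : BP.proj (flow X s u) = flow ξ s (BQ.proj q) := by rw [(h.flow_proj hm).2, hu]
  have hts := h.smooth_base.flow_add hs ht
  have hm' : (t, flow X s u) ∈ flowDomain X := h.mem_flowDomain_iff.2 (by rwa [hpu])
  rw [R.extend_eq h (u := flow X s u) (by rwa [hp]) (by rw [hpu, hp]), R.extend_eq h hs hu,
    BQ.div_act, R.extend_eq h hts.1 hu, (h.smooth.flow_add hm hm').2]

theorem extend_zero (q : Q) : R.extend X 0 q = q := by
  have ht := zero_mem_flowDomain h.smooth_base (BQ.proj q)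
  obtain ⟨u, hu, -⟩ := exists_lift_mem h ht
  rw [R.extend_eq h ht hu, h.smooth.flow_zero, BQ.act_div (by rw [R.proj_emb, hu])]

theorem extend_neg {t : ℝ} {q : Q} (ht : (t, BQ.proj q) ∈ flowDomain ξ) :
    R.extend X (-t) (R.extend X t q) = q := by
  rw [R.extend_extend h ht (h.smooth_base.flow_neg ht).1, neg_add_cancel, R.extend_zero h]

/-- The extension of the flow is smooth in time and space. -/
theorem smoothNear_extend {t : ℝ} {q : Q} (ht : (t, BQ.proj q) ∈ flowDomain ξ) :
    SmoothNear (𝓘(ℝ, ℝ).prod 𝓘(ℝ, EQ)) 𝓘(ℝ, EQ) (fun p : ℝ × Q => R.extend X p.1 p.2) (t, q) := by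
  obtain ⟨u, hu, hm⟩ := exists_lift_mem h ht
  obtain ⟨s, hs, hsu, hp⟩ := BP.exists_section u
  rw [hu] at hs hsu hp
  have c1 : Tendsto (fun p : ℝ × Q => BQ.proj p.2) (𝓝 (t, q)) (𝓝 (BQ.proj q)) :=
    (BQ.contMDiff_proj.continuous.comp continuous_snd).continuousAt
  have c2 : Tendsto (fun p : ℝ × Q => (p.1, BQ.proj p.2)) (𝓝 (t, q)) (𝓝 (t, BQ.proj q)) :=
    (continuous_fst.prodMk (BQ.contMDiff_proj.continuous.comp continuous_snd)).continuousAt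
  have s1 : SmoothNear (𝓘(ℝ, ℝ).prod 𝓘(ℝ, EQ)) 𝓘(ℝ, EP) (fun p : ℝ × Q => s (BQ.proj p.2)) (t, q) :=
    SmoothNear.comp (g := s) (f := fun p : ℝ × Q => BQ.proj p.2) hs
      ((BQ.contMDiff_proj.comp contMDiff_snd).smoothNear _)
  have s2 : SmoothNear (𝓘(ℝ, ℝ).prod 𝓘(ℝ, EP)) 𝓘(ℝ, EP) (fun p : ℝ × P => flow X p.1 p.2) (t, u) := by
    filter_upwards [h.smooth.isOpen_flowDomain.mem_nhds hm] with p hp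
    exact h.smooth.contMDiffAt_flow hp
  have s3 : SmoothNear (𝓘(ℝ, ℝ).prod 𝓘(ℝ, EQ)) 𝓘(ℝ, EP)
      (fun p : ℝ × Q => flow X p.1 (s (BQ.proj p.2))) (t, q) :=
    SmoothNear.comp (g := fun p : ℝ × P => flow X p.1 p.2)
      (f := fun p : ℝ × Q => (p.1, s (BQ.proj p.2))) (by simpa only [hsu] using s2)
      (SmoothNear.prodMk (contMDiff_fst.smoothNear _) s1)
  have s4 := BQ.smoothNear_act
    (SmoothNear.comp (g := R.emb) (R.contMDiff_emb.smoothNear _) s3)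
    (BQ.smoothNear_div (g := fun p : ℝ × Q => p.2)
      (SmoothNear.comp (g := R.emb) (R.contMDiff_emb.smoothNear _) s1) (contMDiff_snd.smoothNear _)
      (by
        filter_upwards [c1.eventually hp] with p hp
        simp only [Function.comp_apply, R.proj_emb, hp]))
  -- By `extend_eq` the arbitrary choice of points of `P` may be replaced near `(t, q)` by a smooth
  -- local section.
  refine s4.congr ?_
  filter_upwards [c1.eventually hp, c2.eventually (h.smooth_base.isOpen_flowDomain.mem_nhds ht)]
    with p h1 h2
  exact R.extend_eq h h2 h1

theorem contMDiffAt_extend {t : ℝ} {q : Q} (ht : (t, BQ.proj q) ∈ flowDomain ξ) :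
    ContMDiffAt 𝓘(ℝ, EQ) 𝓘(ℝ, EQ) ∞ (R.extend X t) q :=
  ContMDiffAt.comp (g := fun p : ℝ × Q => R.extend X p.1 p.2) (f := fun q => (t, q)) q
    (R.smoothNear_extend h ht).contMDiffAt (contMDiffAt_const.prodMk contMDiffAt_id)

/-- The extension of the flow, as a local automorphism of `Q`. -/
def extension (t : ℝ) : LocalAutomorphism BQ where
  base := h.smooth_base.flowDiffeo t
  total :=
    { toFun := R.extend X t
      invFun := R.extend X (-t)
      source := BQ.proj ⁻¹' {x | (t, x) ∈ flowDomain ξ}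
      target := BQ.proj ⁻¹' {x | (-t, x) ∈ flowDomain ξ}
      map_source' := fun q hq => by
        rw [mem_preimage, R.proj_extend h hq]
        exact (h.smooth_base.flow_neg hq).1
      map_target' := fun q hq => by
        rw [mem_preimage, R.proj_extend h hq]
        exact (h.smooth_base.flow_mem_neg hq).1
      left_inv' := fun q hq => R.extend_neg h hq
      right_inv' := fun q hq => by
        have := R.extend_neg h hq
        rwa [neg_neg] at this
      open_source := (h.smooth_base.isOpen_time t).preimage BQ.contMDiff_proj.continuous
      open_target := (h.smooth_base.isOpen_time (-t)).preimage BQ.contMDiff_proj.continuous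
      contMDiffOn_toFun := fun q hq => (R.contMDiffAt_extend h hq).contMDiffWithinAt
      contMDiffOn_invFun := fun q hq => (R.contMDiffAt_extend h hq).contMDiffWithinAt }
  source_eq := rfl
  target_eq := rfl
  proj_apply _ hu := R.proj_extend h hu
  map_act _ hu a := R.extend_act h hu a

theorem isExtension_extension (t : ℝ) : R.IsExtension X ξ t (R.extension h t) :=
  ⟨rfl, fun _ hu => R.extend_emb h hu⟩

omit h in
theorem IsExtension.mem_source {R : ReductiveStructure BP BQ} {t : ℝ} {Φ : LocalAutomorphism BQ}
    (hΦ : R.IsExtension X ξ t Φ) {q : Q} :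
    q ∈ Φ.total.source ↔ (t, BQ.proj q) ∈ flowDomain ξ := by
  rw [Φ.source_eq, hΦ.1]
  rfl

/-- Since `q = i(u) · b`, equivariance and the values on `P` leave no freedom. -/
theorem IsExtension.total_eq {R : ReductiveStructure BP BQ} {t : ℝ} {Φ : LocalAutomorphism BQ}
    (hΦ : R.IsExtension X ξ t Φ) {q : Q} (hq : (t, BQ.proj q) ∈ flowDomain ξ) :
    Φ.total q = R.extend X t q := by
  obtain ⟨u, hu, hm⟩ := exists_lift_mem h hq
  have hpu : (t, BP.proj u) ∈ flowDomain ξ := by rwa [hu]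
  have h1 : BQ.act (R.emb u) (BQ.div (R.emb u) q) = q := BQ.act_div (by rw [R.proj_emb, hu])
  have h2 : R.emb u ∈ Φ.total.source := hΦ.mem_source.2 (by rwa [R.proj_emb])
  rw [R.extend_eq h hq hu, ← hΦ.2 u (by rw [hΦ.1]; exact hpu), ← Φ.map_act _ h2, h1]

/-- The base map is determined by the total map, because the latter covers it and π is onto. -/
theorem IsExtension.base_eq {R : ReductiveStructure BP BQ} {t : ℝ} {Φ : LocalAutomorphism BQ}
    (hΦ : R.IsExtension X ξ t Φ) {x : M} (hx : (t, x) ∈ flowDomain ξ) : Φ.base x = flow ξ t x := by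
  obtain ⟨q, rfl⟩ := BQ.proj_surjective x
  rw [← Φ.proj_apply q (hΦ.mem_source.2 hx), hΦ.total_eq h hx, R.proj_extend h hx]

end ReductiveStructure

end Extension

/-! ### Charts of gauge-natural bundles -/

section GaugeCharts

variable {m : ℕ} {EH EQ EF : Type*} [NormedAddCommGroup EH] [NormedSpace ℝ EH]
  [NormedAddCommGroup EQ] [NormedSpace ℝ EQ] [NormedAddCommGroup EF] [NormedSpace ℝ EF]
  {M : Type*} [TopologicalSpace M] [ChartedSpace (Eu m) M] [IsManifold 𝓘(ℝ, Eu m) ∞ M]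
  {H : Type*} [TopologicalSpace H] [ChartedSpace EH H] [Group H] [LieGroup 𝓘(ℝ, EH) ∞ H]
  {Q : Type*} [TopologicalSpace Q] [ChartedSpace EQ Q]
  {F : Type*} [TopologicalSpace F] [ChartedSpace EF F] [IsManifold 𝓘(ℝ, EF) ∞ F]
  {B : PrincipalBundle m EH EQ M H Q} {r : GaugeOrder} {lam : JetAction m r EH H EF F}

namespace GaugeNaturalBundle

/-- The chart `gaugeChart` as a homeomorphism between open subsets. -/
def chart (B : PrincipalBundle m EH EQ M H Q) (lam : JetAction m r EH H EF F) (x₀ : M) (f₀ : F) :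
    OpenPartialHomeomorph (GaugeNaturalBundle B lam) (Eu m × EF) :=
  (gaugeCore B lam).openPartialHomeomorph (gaugeChart B lam x₀ f₀) ⟨x₀, f₀, rfl⟩

theorem chart_mem_atlas (x₀ : M) (f₀ : F) :
    chart B lam x₀ f₀ ∈ atlas (Eu m × EF) (GaugeNaturalBundle B lam) := by
  have : ∃ c, ∃ hc : c ∈ (gaugeCore B lam).atlas,
      chart B lam x₀ f₀ = (gaugeCore B lam).openPartialHomeomorph c hc := ⟨_, ⟨x₀, f₀, rfl⟩, rfl⟩
  simpa [atlas, ChartedSpace.atlas, ChartedSpaceCore.toChartedSpace] using this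

theorem contMDiffOn_gaugeChart (x₀ : M) (f₀ : F) :
    ContMDiffOn 𝓘(ℝ, Eu m × EF) 𝓘(ℝ, Eu m × EF) ∞ (gaugeChart B lam x₀ f₀)
      (gaugeChart B lam x₀ f₀).source :=
  contMDiffOn_of_mem_maximalAtlas
    (IsManifold.subset_maximalAtlas (chart_mem_atlas (B := B) (lam := lam) x₀ f₀))

theorem contMDiffOn_gaugeChart_symm (x₀ : M) (f₀ : F) :
    ContMDiffOn 𝓘(ℝ, Eu m × EF) 𝓘(ℝ, Eu m × EF) ∞ (gaugeChart B lam x₀ f₀).symm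
      (gaugeChart B lam x₀ f₀).target :=
  contMDiffOn_symm_of_mem_maximalAtlas
    (IsManifold.subset_maximalAtlas (chart_mem_atlas (B := B) (lam := lam) x₀ f₀))

theorem isOpen_gaugeChart_source (x₀ : M) (f₀ : F) : IsOpen (gaugeChart B lam x₀ f₀).source :=
  (chart B lam x₀ f₀).open_source

theorem isOpen_gaugeChart_target (x₀ : M) (f₀ : F) : IsOpen (gaugeChart B lam x₀ f₀).target :=
  (chart B lam x₀ f₀).open_target

/-- The argument `f₀` is only a default value outside `dom x₀`. It can therefore be exchanged for
the coordinate of the point itself, around which the chart of `F` is then taken. -/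
theorem coordAt_congr {x₀ : M} (f₀ f₁ : F) {q : GaugeNaturalBundle B lam} (h : q.proj ∈ B.dom x₀) :
    coordAt x₀ f₀ q = coordAt x₀ f₁ q := by
  rw [coordAt, dif_pos h, coordAt, dif_pos h]

theorem ofCoord_congr {x₀ x : M} (f₀ f₁ f : F) (h : x ∈ B.dom x₀) :
    ofCoord B lam x₀ f₀ x f = ofCoord B lam x₀ f₁ x f := by
  rw [ofCoord, dif_pos h, ofCoord, dif_pos h]

theorem mem_source_gaugeChart {x₀ : M} (f₀ : F) {q : GaugeNaturalBundle B lam}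
    (h : q.proj ∈ B.dom x₀) : q ∈ (gaugeChart B lam x₀ (coordAt x₀ f₀ q)).source := by
  refine ⟨h, ?_⟩
  rw [coordAt_congr (coordAt x₀ f₀ q) f₀ h]
  exact mem_chart_source _ _

/-- The projection of a gauge-natural bundle is smooth. -/
theorem contMDiff_proj : ContMDiff 𝓘(ℝ, Eu m × EF) 𝓘(ℝ, Eu m) ∞
    (fun q : GaugeNaturalBundle B lam => q.proj) := by
  intro q
  let f₀ : F := q.2.coord (B.mem_dom q.proj)
  have hq := mem_source_gaugeChart f₀ (B.mem_dom q.proj)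
  set e := gaugeChart B lam q.proj (coordAt q.proj f₀ q)
  have hO := (isOpen_gaugeChart_source (B := B) (lam := lam) _ _).mem_nhds hq
  have h1 := (contMDiffOn_gaugeChart _ _).contMDiffAt hO
  have h2 : ContMDiffAt 𝓘(ℝ, Eu m × EF) 𝓘(ℝ, Eu m) ∞ (fun q => (e q).1) q :=
    ContMDiffAt.comp (g := (Prod.fst : Eu m × EF → Eu m)) (I' := 𝓘(ℝ, Eu m × EF)) q contDiff_fst.contMDiff.contMDiffAt h1
  have h3 : ContMDiffAt 𝓘(ℝ, Eu m) 𝓘(ℝ, Eu m) ∞ (chartAt (Eu m) q.proj).symm (e q).1 :=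
    contMDiffOn_chart_symm.contMDiffAt
      ((chartAt (Eu m) q.proj).open_target.mem_nhds ((chartAt (Eu m) q.proj).map_source hq.1.1))
  refine (ContMDiffAt.comp q h3 h2).congr_of_eventuallyEq ?_
  filter_upwards [hO] with p hp using ((chartAt (Eu m) q.proj).left_inv hp.1.1).symm

theorem contMDiffAt_coordAt {x₀ : M} (f₀ : F) {q : GaugeNaturalBundle B lam}
    (h : q.proj ∈ B.dom x₀) :
    ContMDiffAt 𝓘(ℝ, Eu m × EF) 𝓘(ℝ, EF) ∞ (coordAt x₀ f₀ : GaugeNaturalBundle B lam → F) q := by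
  have hq := mem_source_gaugeChart f₀ h
  set f₁ := coordAt x₀ f₀ q
  set e := gaugeChart B lam x₀ f₁
  have hO := (isOpen_gaugeChart_source (B := B) (lam := lam) _ _).mem_nhds hq
  have h1 := (contMDiffOn_gaugeChart _ _).contMDiffAt hO
  have h2 : ContMDiffAt 𝓘(ℝ, Eu m × EF) 𝓘(ℝ, EF) ∞ (fun q => (e q).2) q :=
    ContMDiffAt.comp (g := (Prod.snd : Eu m × EF → EF)) (I' := 𝓘(ℝ, Eu m × EF)) q contDiff_snd.contMDiff.contMDiffAt h1
  have h3 : ContMDiffAt 𝓘(ℝ, EF) 𝓘(ℝ, EF) ∞ (chartAt EF f₁).symm (e q).2 :=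
    contMDiffOn_chart_symm.contMDiffAt
      ((chartAt EF f₁).open_target.mem_nhds ((chartAt EF f₁).map_source hq.2))
  refine (ContMDiffAt.comp q h3 h2).congr_of_eventuallyEq ?_
  filter_upwards [hO] with p hp
  rw [coordAt_congr f₀ f₁ hp.1]
  exact ((chartAt EF f₁).left_inv hp.2).symm

theorem contMDiffAt_ofCoord {x₀ x : M} (f₀ f : F) (h : x ∈ B.dom x₀) :
    ContMDiffAt (𝓘(ℝ, Eu m).prod 𝓘(ℝ, EF)) 𝓘(ℝ, Eu m × EF) ∞
      (fun p : M × F => ofCoord B lam x₀ f₀ p.1 p.2) (x, f) := by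
  have h1 : ContMDiffAt (𝓘(ℝ, Eu m).prod 𝓘(ℝ, EF)) 𝓘(ℝ, Eu m) ∞
      (fun p : M × F => chartAt (Eu m) x₀ p.1) (x, f) :=
    ContMDiffAt.comp (x, f) (g := chartAt (Eu m) x₀)
      (contMDiffOn_chart.contMDiffAt ((chartAt (Eu m) x₀).open_source.mem_nhds h.1)) contMDiffAt_fst
  have h2 : ContMDiffAt (𝓘(ℝ, Eu m).prod 𝓘(ℝ, EF)) 𝓘(ℝ, EF) ∞
      (fun p : M × F => chartAt EF f p.2) (x, f) :=
    ContMDiffAt.comp (x, f) (g := chartAt EF f)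
      (contMDiffOn_chart.contMDiffAt (chart_source_mem_nhds _ _)) contMDiffAt_snd
  have ht : (chartAt (Eu m) x₀ x, chartAt EF f f) ∈ (gaugeChart B lam x₀ f).target := by
    refine ⟨⟨(chartAt (Eu m) x₀).map_source h.1, ?_⟩, mem_chart_target _ _⟩
    rw [(chartAt (Eu m) x₀).left_inv h.1]
    exact h
  have h3 := (contMDiffOn_gaugeChart_symm (B := B) (lam := lam) x₀ f).contMDiffAt
    ((isOpen_gaugeChart_target _ _).mem_nhds ht)
  refine (ContMDiffAt.comp (x, f) (f := fun p : M × F => (chartAt (Eu m) x₀ p.1, chartAt EF f p.2))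
    h3 (h1.prodMk_space h2)).congr_of_eventuallyEq ?_
  have hO : B.dom x₀ ×ˢ (chartAt EF f).source ∈ 𝓝 (x, f) :=
    ((B.isOpen_dom x₀).prod (chartAt EF f).open_source).mem_nhds ⟨h, mem_chart_source _ _⟩
  filter_upwards [hO] with p hp
  show _ = ofCoord B lam x₀ f ((chartAt (Eu m) x₀).symm (chartAt (Eu m) x₀ p.1))
    ((chartAt EF f).symm (chartAt EF f p.2))
  rw [(chartAt (Eu m) x₀).left_inv hp.1.1, (chartAt EF f).left_inv hp.2, ofCoord_congr _ f _ hp.1]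

/-! ### Points given by germs of frames -/

/-- The point `[(j^k_0 ε, j^h_x σ), f]_λ`. -/
def ofGerm (lam : JetAction m r EH H EF F) {x : M} (w : FrameGerm B x) (f : F) :
    GaugeNaturalBundle B lam :=
  ⟨x, GaugeFiber.mk lam (WFiber.mk r w) f⟩

/-- The base points are allowed to be merely provably equal: they will occur as φ_{t+s}(x) and
φ_t(φ_s(x)), over which the types of frame germs differ. -/
theorem ofGerm_eq {x y : M} {w : FrameGerm B x} {w' : FrameGerm B y} (hxy : x = y)
    (h₁ : w.ε =ᶠ[𝓝 0] w'.ε) (h₂ : w.σ =ᶠ[𝓝 x] w'.σ) (f : F) :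
    ofGerm lam w f = ofGerm lam w' f := by
  subst hxy
  rw [ofGerm, ofGerm, WFiber.mk_eq h₁ h₂]

theorem exists_ofGerm (q : GaugeNaturalBundle B lam) :
    ∃ (w : FrameGerm B q.proj) (f : F), ofGerm lam w f = q :=
  ⟨B.frameGermAt (B.mem_dom q.proj), q.2.coord (B.mem_dom q.proj), by
    rw [ofGerm, GaugeFiber.mk_coord]⟩

theorem ofGerm_frameGermAt {x₀ x : M} (hx : x ∈ B.dom x₀) (f₀ f : F) :
    ofGerm lam (B.frameGermAt hx) f = ofCoord B lam x₀ f₀ x f := by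
  rw [ofCoord, dif_pos hx, ofGerm]

theorem ofGerm_eq_smul_ratio {x : M} (w w' : FrameGerm B x) (f : F) :
    ofGerm lam w' f = ofGerm lam w (lam.smul (JetGroup.mk r (w.ratio w')) f) := by
  rw [ofGerm, ofGerm, ← GaugeFiber.mk_act, WFiber.act_ratio]

end GaugeNaturalBundle

/-! ### Functoriality of the induced maps -/

namespace LocalAutomorphism

open GaugeNaturalBundle

variable (A : LocalAutomorphism B)

theorem induced_ofGerm {x : M} (hx : x ∈ A.base.source) (w : FrameGerm B x) (f : F) :
    A.induced (ofGerm lam w f) = ofGerm lam (A.mapGerm hx w) f := by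
  rw [induced, dif_pos (show (ofGerm lam w f).proj ∈ A.base.source from hx)]
  rfl

theorem induced_of_notMem {q : GaugeNaturalBundle B lam} (hq : q.proj ∉ A.base.source) :
    A.induced q = q := by
  rw [induced, dif_neg hq]

theorem induced_proj {q : GaugeNaturalBundle B lam} (hq : q.proj ∈ A.base.source) :
    (A.induced q).proj = A.base q.proj := by
  rw [induced, dif_pos hq]

/-- The condition on sections is Φ ∘ σ = σ' ∘ φ near `x`, which avoids φ⁻¹ and is turned into the
prolonged section by substituting φ⁻¹. Dependence on the automorphism, composition and identity are
all reduced to this criterion. -/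
theorem induced_ofGerm_eq {x y : M} (hx : x ∈ A.base.source) {w : FrameGerm B x}
    {w' : FrameGerm B y} (hxy : A.base x = y) (h₁ : ∀ᶠ z in 𝓝 0, A.base (w.ε z) = w'.ε z)
    (h₂ : ∀ᶠ z in 𝓝 x, A.total (w.σ z) = w'.σ (A.base z)) (f : F) :
    A.induced (ofGerm lam w f) = ofGerm lam w' f := by
  rw [A.induced_ofGerm hx]
  refine ofGerm_eq (w := A.mapGerm hx w) hxy h₁ ?_ f
  filter_upwards [A.base_symm hx, (A.tendsto_base_symm hx).eventually h₂] with z h3 h4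
  rw [h3.2] at h4
  exact h4

theorem eventually_mem_source {x : M} (hx : x ∈ A.base.source) (w : FrameGerm B x) :
    ∀ᶠ z in 𝓝 x, z ∈ A.base.source ∧ w.σ z ∈ A.total.source := by
  filter_upwards [A.base.open_source.mem_nhds hx, w.σ_section] with z h1 h2
  refine ⟨h1, ?_⟩
  rw [A.source_eq, mem_preimage, h2]
  exact h1

/-- The induced map only depends on the automorphism over its domain. -/
theorem induced_congr {A A' : LocalAutomorphism B} (hs : A.base.source = A'.base.source)
    (hb : EqOn A.base A'.base A.base.source) (ht : EqOn A.total A'.total A.total.source)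
    (q : GaugeNaturalBundle B lam) : A.induced q = A'.induced q := by
  by_cases hq : q.proj ∈ A.base.source
  · obtain ⟨w, f, hw⟩ := exists_ofGerm q
    have hq' : q.proj ∈ A'.base.source := hs ▸ hq
    rw [← hw, A'.induced_ofGerm hq']
    refine A.induced_ofGerm_eq hq (hb hq) ?_ ?_ f
    · filter_upwards [w.tendsto_ε.eventually (A.base.open_source.mem_nhds hq)] with z hz using hb hz
    · filter_upwards [A.eventually_mem_source hq w] with z hz
      show _ = A'.total (w.σ (A'.base.symm (A.base z)))
      rw [ht hz.2, hb hz.1, A'.symm_base (hs ▸ hz.1)]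
  · rw [A.induced_of_notMem hq, A'.induced_of_notMem (hs ▸ hq)]

/-- The map induced by a composition. -/
theorem induced_comp {A A' C : LocalAutomorphism B} {q : GaugeNaturalBundle B lam}
    (hA : q.proj ∈ A.base.source) (hA' : A.base q.proj ∈ A'.base.source)
    (hC : q.proj ∈ C.base.source) (hb : ∀ᶠ z in 𝓝 q.proj, C.base z = A'.base (A.base z))
    (ht : ∀ᶠ z in 𝓝 q.proj, ∀ u, B.proj u = z → C.total u = A'.total (A.total u)) :
    C.induced q = A'.induced (A.induced q) := by
  obtain ⟨w, f, hw⟩ := exists_ofGerm q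
  rw [← hw, A.induced_ofGerm hA, A'.induced_ofGerm hA']
  refine C.induced_ofGerm_eq hC hb.self_of_nhds (w.tendsto_ε.eventually hb) ?_ f
  have c := (A.smooth_base hA).contMDiffAt.continuousAt.eventually
    (A'.base.open_source.mem_nhds hA')
  filter_upwards [hb, ht, A.eventually_mem_source hA w, c, w.σ_section] with z h1 h2 h3 h4 h5
  show _ = A'.total (A.total (w.σ (A.base.symm (A'.base.symm (C.base z)))))
  rw [h1, A'.symm_base h4, A.symm_base h3.1, h2 _ h5]

/-- The map induced by the identity. -/
theorem induced_id {A : LocalAutomorphism B} {q : GaugeNaturalBundle B lam}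
    (hA : q.proj ∈ A.base.source) (hb : ∀ᶠ z in 𝓝 q.proj, A.base z = z)
    (ht : ∀ᶠ z in 𝓝 q.proj, ∀ u, B.proj u = z → A.total u = u) : A.induced q = q := by
  obtain ⟨w, f, hw⟩ := exists_ofGerm q
  have key : A.induced (ofGerm lam w f) = ofGerm lam w f := by
    refine A.induced_ofGerm_eq hA hb.self_of_nhds (w.tendsto_ε.eventually hb) ?_ f
    filter_upwards [hb, ht, w.σ_section] with z h1 h2 h3
    rw [h1, h2 _ h3]
  rwa [hw] at key

/-! ### Smooth families of automorphisms -/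

/-- The change of frames between the image under `A` of the frame over `x` given by a chart and a
local section, and such a frame over the image of `x`. -/
def transGerm {x₀ x₁ x : M} (h₀ : x ∈ B.dom x₀) (hx : x ∈ A.base.source)
    (h₁ : A.base x ∈ B.dom x₁) : GaugeGerm m EH H where
  α y := -chartAt (Eu m) x₁ (A.base x) + chartAt (Eu m) x₁ (A.base ((B.frameGermAt h₀).ε y))
  α_zero := by rw [(B.frameGermAt h₀).ε_zero, neg_add_cancel]
  α_diffeo := by
    have h : IsLocalDiffeomorphAt 𝓘(ℝ, Eu m) 𝓘(ℝ, Eu m) ∞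
        (chartAt (Eu m) x₁ ∘ (A.mapGerm hx (B.frameGermAt h₀)).ε) 0 :=
      IsLocalDiffeomorphAt.comp (K := 𝓘(ℝ, Eu m)) (P := Eu m)
        (A.mapGerm hx (B.frameGermAt h₀)).ε_diffeo
        (by rw [(A.mapGerm hx (B.frameGermAt h₀)).ε_zero]; exact chart_diffeo h₁.1)
    exact IsLocalDiffeomorphAt.comp (K := 𝓘(ℝ, Eu m)) (P := Eu m) h (translation_diffeo _ _)
  a := ((B.frameGermAt h₁).ratio (A.mapGerm hx (B.frameGermAt h₀))).a
  a_smooth := ((B.frameGermAt h₁).ratio (A.mapGerm hx (B.frameGermAt h₀))).a_smooth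

/-- In `ratio` the first component involves a chosen local inverse, whose dependence on parameters
is out of control. In `transGerm` it is the explicit translated chart; both have the same germ
because local inverses are unique as germs. -/
theorem mk_transGerm {x₀ x₁ x : M} (h₀ : x ∈ B.dom x₀) (hx : x ∈ A.base.source)
    (h₁ : A.base x ∈ B.dom x₁) : JetGroup.mk r (A.transGerm h₀ hx h₁) =
      JetGroup.mk r ((B.frameGermAt h₁).ratio (A.mapGerm hx (B.frameGermAt h₀))) := by
  refine JetGroup.mk_eq ?_ (.of_eq rfl)
  have e : (fun z => -chartAt (Eu m) x₁ (A.base x) + chartAt (Eu m) x₁ z) =ᶠ[𝓝 (A.base x)]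
      (B.frameGermAt h₁).inv := by
    refine (B.frameGermAt h₁).inv_unique ?_ ?_
    · have := (((chartAt (Eu m) x₁).continuousAt h₁.1).tendsto).const_add
        (-chartAt (Eu m) x₁ (A.base x))
      rwa [neg_add_cancel] at this
    · filter_upwards [(chartAt (Eu m) x₁).open_source.mem_nhds h₁.1] with z hz
      simp [PrincipalBundle.frameGermAt, (chartAt (Eu m) x₁).left_inv hz]
  filter_upwards [(A.mapGerm hx (B.frameGermAt h₀)).tendsto_ε.eventually e] with y hy using hy

/-- The induced map in coordinates. -/
theorem induced_ofCoord {x₀ x₁ x : M} (h₀ : x ∈ B.dom x₀) (hx : x ∈ A.base.source)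
    (h₁ : A.base x ∈ B.dom x₁) (f₀ f₁ f : F) :
    A.induced (ofCoord B lam x₀ f₀ x f) = ofCoord B lam x₁ f₁ (A.base x)
      (lam.smul (JetGroup.mk r (A.transGerm h₀ hx h₁)) f) := by
  rw [← ofGerm_frameGermAt h₀, ← ofGerm_frameGermAt h₁, A.induced_ofGerm hx, A.mk_transGerm,
    ← ofGerm_eq_smul_ratio]

/-- A family of local automorphisms which depends smoothly on a real parameter. -/
structure IsSmoothFamily (A : ℝ → LocalAutomorphism B) : Prop where
  isOpen_source : IsOpen {p : ℝ × M | p.2 ∈ (A p.1).base.source}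
  smooth_base : ∀ {t x}, x ∈ (A t).base.source →
    SmoothNear (𝓘(ℝ, ℝ).prod 𝓘(ℝ, Eu m)) 𝓘(ℝ, Eu m) (fun p : ℝ × M => (A p.1).base p.2) (t, x)
  smooth_total : ∀ {t u}, B.proj u ∈ (A t).base.source →
    SmoothNear (𝓘(ℝ, ℝ).prod 𝓘(ℝ, EQ)) 𝓘(ℝ, EQ) (fun p : ℝ × Q => (A p.1).total p.2) (t, u)

namespace IsSmoothFamily

variable {A : ℝ → LocalAutomorphism B} (hA : IsSmoothFamily A)
include hA

open Classical in
-- Smoothness of λ is a statement about families of germs indexed by a normed space, so the base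
-- point is replaced by its coordinate in a chart. The germs are then given by formulas in the base
-- maps, the total maps, charts and local sections, jointly smooth in time, coordinate and argument.
-- The unit germ in the other branch only makes the family total; it does not occur near the point
-- considered.
theorem exists_contMDiffAt_transGerm {t : ℝ} {x₀ x₁ x : M} (h₀ : x ∈ B.dom x₀)
    (hx : x ∈ (A t).base.source) (h₁ : (A t).base x ∈ B.dom x₁) (f : F) :
    ContMDiffAt ((𝓘(ℝ, ℝ).prod 𝓘(ℝ, Eu m)).prod 𝓘(ℝ, EF)) 𝓘(ℝ, EF) ∞
      (fun p : (ℝ × M) × F => lam.smul (JetGroup.mk r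
        (if h : p.1.2 ∈ B.dom x₀ ∧ p.1.2 ∈ (A p.1.1).base.source ∧ (A p.1.1).base p.1.2 ∈ B.dom x₁
          then (A p.1.1).transGerm h.1 h.2.1 h.2.2 else GaugeGerm.one)) p.2) ((t, x), f) := by
  set ψ₀ := chartAt (Eu m) x₀ with hψ₀
  set ψ₁ := chartAt (Eu m) x₁ with hψ₁
  let good : ℝ × M → Prop := fun p => p.2 ∈ B.dom x₀ ∧ p.2 ∈ (A p.1).base.source ∧
    (A p.1).base p.2 ∈ B.dom x₁
  let g' : ℝ × M → GaugeGerm m EH H := fun p =>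
    if h : good p then (A p.1).transGerm h.1 h.2.1 h.2.2 else GaugeGerm.one
  let g : ℝ × Eu m → GaugeGerm m EH H := fun c => g' (c.1, ψ₀.symm c.2)
  have hgood : ∀ᶠ p in 𝓝 (t, x), good p := by
    refine Eventually.and ?_ (Eventually.and ?_ ?_)
    · exact continuousAt_snd.eventually ((B.isOpen_dom x₀).mem_nhds h₀)
    · exact hA.isOpen_source.mem_nhds hx
    · exact (hA.smooth_base hx).contMDiffAt.continuousAt.eventually ((B.isOpen_dom x₁).mem_nhds h₁)
  have hc0 : ψ₀ x ∈ ψ₀.target := ψ₀.map_source h₀.1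
  have hsx : ψ₀.symm (ψ₀ x) = x := ψ₀.left_inv h₀.1
  have scs : SmoothNear 𝓘(ℝ, Eu m) 𝓘(ℝ, Eu m) ψ₀.symm (ψ₀ x) :=
    smoothNear_of_contMDiffOn (ψ₀.open_target.mem_nhds hc0) contMDiffOn_chart_symm
  have sc1 : SmoothNear 𝓘(ℝ, Eu m) 𝓘(ℝ, Eu m) ψ₁ ((A t).base x) :=
    smoothNear_of_contMDiffOn (ψ₁.open_source.mem_nhds h₁.1) contMDiffOn_chart
  let V := ℝ × Eu m
  have st : SmoothNear 𝓘(ℝ, V × Eu m) 𝓘(ℝ, ℝ) (fun p : V × Eu m => p.1.1) ((t, ψ₀ x), 0) :=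
    (contDiff_fst.comp contDiff_fst).contMDiff.smoothNear _
  have sadd : SmoothNear 𝓘(ℝ, V × Eu m) 𝓘(ℝ, Eu m)
      (fun p : V × Eu m => ψ₀.symm (p.1.2 + p.2)) ((t, ψ₀ x), 0) :=
    SmoothNear.comp (g := ψ₀.symm) (f := fun p : V × Eu m => p.1.2 + p.2) (by simpa using scs)
      (((contDiff_snd.comp contDiff_fst).add contDiff_snd).contMDiff.smoothNear _)
  have sfst : SmoothNear 𝓘(ℝ, V × Eu m) 𝓘(ℝ, Eu m)
      (fun p : V × Eu m => ψ₀.symm p.1.2) ((t, ψ₀ x), 0) :=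
    SmoothNear.comp (g := ψ₀.symm) (f := fun p : V × Eu m => p.1.2) scs
      ((contDiff_snd.comp contDiff_fst).contMDiff.smoothNear _)
  have tadd : SmoothNear 𝓘(ℝ, V × Eu m) (𝓘(ℝ, ℝ).prod 𝓘(ℝ, Eu m))
      (fun p : V × Eu m => (p.1.1, ψ₀.symm (p.1.2 + p.2))) ((t, ψ₀ x), 0) := st.prodMk sadd
  have tfst : SmoothNear 𝓘(ℝ, V × Eu m) (𝓘(ℝ, ℝ).prod 𝓘(ℝ, Eu m))
      (fun p : V × Eu m => (p.1.1, ψ₀.symm p.1.2)) ((t, ψ₀ x), 0) := st.prodMk sfst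
  have badd : SmoothNear 𝓘(ℝ, V × Eu m) 𝓘(ℝ, Eu m)
      (fun p : V × Eu m => (A p.1.1).base (ψ₀.symm (p.1.2 + p.2))) ((t, ψ₀ x), 0) :=
    SmoothNear.comp (g := fun p : ℝ × M => (A p.1).base p.2)
      (by simpa only [hsx, add_zero] using hA.smooth_base hx) tadd
  have bfst : SmoothNear 𝓘(ℝ, V × Eu m) 𝓘(ℝ, Eu m)
      (fun p : V × Eu m => (A p.1.1).base (ψ₀.symm p.1.2)) ((t, ψ₀ x), 0) :=
    SmoothNear.comp (g := fun p : ℝ × M => (A p.1).base p.2)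
      (by simpa only [hsx] using hA.smooth_base hx) tfst
  have gfst : ∀ᶠ p : V × Eu m in 𝓝 ((t, ψ₀ x), 0), good (p.1.1, ψ₀.symm p.1.2) ∧
      ψ₀ (ψ₀.symm p.1.2) = p.1.2 := by
    refine Eventually.and ?_ ?_
    · exact tfst.contMDiffAt.continuousAt.eventually (by simpa only [hsx] using hgood)
    · have : Tendsto (fun p : V × Eu m => p.1.2) (𝓝 ((t, ψ₀ x), 0)) (𝓝 (ψ₀ x)) :=
        (continuous_snd.comp continuous_fst).continuousAt
      filter_upwards [this.eventually (ψ₀.open_target.mem_nhds hc0)] with p hp using ψ₀.right_inv hp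
  have gadd : ∀ᶠ p : V × Eu m in 𝓝 ((t, ψ₀ x), 0), good (p.1.1, ψ₀.symm (p.1.2 + p.2)) :=
    tadd.contMDiffAt.continuousAt.eventually (by simpa only [hsx, add_zero] using hgood)
  have main := lam.smooth V g (t, ψ₀ x) ?_ ?_ f
  -- Back from coordinates to points of `M`, by composing with the chart.
  · have c1 : ContMDiffAt ((𝓘(ℝ, ℝ).prod 𝓘(ℝ, Eu m)).prod 𝓘(ℝ, EF)) 𝓘(ℝ, Eu m) ∞
        (fun p : (ℝ × M) × F => ψ₀ p.1.2) ((t, x), f) :=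
      ContMDiffAt.comp (g := ψ₀) (f := fun p : (ℝ × M) × F => p.1.2) ((t, x), f)
        (contMDiffOn_chart.contMDiffAt (ψ₀.open_source.mem_nhds h₀.1))
        (contMDiff_snd.comp contMDiff_fst).contMDiffAt
    have c2 : ContMDiffAt ((𝓘(ℝ, ℝ).prod 𝓘(ℝ, Eu m)).prod 𝓘(ℝ, EF)) 𝓘(ℝ, ℝ) ∞
        (fun p : (ℝ × M) × F => p.1.1) ((t, x), f) :=
      (contMDiff_fst.comp contMDiff_fst).contMDiffAt
    have c3 : ContMDiffAt ((𝓘(ℝ, ℝ).prod 𝓘(ℝ, Eu m)).prod 𝓘(ℝ, EF)) 𝓘(ℝ, EF) ∞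
        (fun p : (ℝ × M) × F => p.2) ((t, x), f) := contMDiffAt_snd
    have hcomp := (c2.prodMk_space c1).prodMk c3
    refine (ContMDiffAt.comp (g := fun p : V × F => lam.smul (JetGroup.mk r (g p.1)) p.2)
      ((t, x), f) main hcomp).congr_of_eventuallyEq ?_
    filter_upwards [(continuousAt_fst (p := ((t, x), f))).eventually hgood] with p hp
    have hp' : ψ₀.symm (ψ₀ p.1.2) = p.1.2 := ψ₀.left_inv hp.1.1
    show lam.smul (JetGroup.mk r (g' p.1)) p.2 = lam.smul (JetGroup.mk r
      (g' (p.1.1, ψ₀.symm (ψ₀ p.1.2)))) p.2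
    rw [hp']
  · have sα : SmoothNear 𝓘(ℝ, V × Eu m) 𝓘(ℝ, Eu m)
        (fun p : V × Eu m => -ψ₁ ((A p.1.1).base (ψ₀.symm p.1.2)) +
          ψ₁ ((A p.1.1).base (ψ₀.symm (p.1.2 + p.2)))) ((t, ψ₀ x), 0) := by
      have t1 := SmoothNear.comp (g := ψ₁) (by simpa only [hsx, add_zero] using sc1) badd
      have t2 := SmoothNear.comp (g := ψ₁) (by simpa only [hsx] using sc1) bfst
      filter_upwards [t1, t2] with p h1 h2
      exact h2.neg.add h1
    refine sα.congr ?_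
    filter_upwards [gfst] with p hp
    simp only [g, g', dif_pos hp.1, transGerm, PrincipalBundle.frameGermAt, ← hψ₀, ← hψ₁, hp.2]
  · have t0 : SmoothNear 𝓘(ℝ, V × Eu m) 𝓘(ℝ, EQ)
        (fun p : V × Eu m => B.sectionAt x₀ (ψ₀.symm (p.1.2 + p.2))) ((t, ψ₀ x), 0) :=
      SmoothNear.comp (g := B.sectionAt x₀)
        (by simpa only [hsx, add_zero] using B.sectionAt_smooth h₀) sadd
    have t1 : SmoothNear 𝓘(ℝ, V × Eu m) 𝓘(ℝ, EQ)
        (fun p : V × Eu m => (A p.1.1).total (B.sectionAt x₀ (ψ₀.symm (p.1.2 + p.2))))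
        ((t, ψ₀ x), 0) :=
      SmoothNear.comp (g := fun p : ℝ × Q => (A p.1).total p.2)
        (f := fun p : V × Eu m => (p.1.1, B.sectionAt x₀ (ψ₀.symm (p.1.2 + p.2))))
        (by
          simp only [hsx, add_zero]
          exact hA.smooth_total (by rwa [B.sectionAt_proj h₀])) (st.prodMk t0)
    have t2 : SmoothNear 𝓘(ℝ, V × Eu m) 𝓘(ℝ, EQ)
        (fun p : V × Eu m => B.sectionAt x₁ ((A p.1.1).base (ψ₀.symm (p.1.2 + p.2))))
        ((t, ψ₀ x), 0) :=
      SmoothNear.comp (g := B.sectionAt x₁)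
        (by simpa only [hsx, add_zero] using B.sectionAt_smooth h₁) badd
    -- The group component compares the moved section with the reference section over the image
    -- point; both lie over the same base point since the total map covers the base map.
    refine (B.smoothNear_div t2 t1 ?_).congr ?_
    · filter_upwards [gadd] with p hp
      rw [B.sectionAt_proj hp.2.2, (A p.1.1).proj_apply, B.sectionAt_proj hp.1]
      rw [(A p.1.1).source_eq, mem_preimage, B.sectionAt_proj hp.1]
      exact hp.2.1
    · filter_upwards [gfst, gadd] with p hp hp'
      simp only [g, g', dif_pos hp.1, transGerm, FrameGerm.ratio, mapGerm,
        PrincipalBundle.frameGermAt, ← hψ₀, hp.2, Function.comp_apply]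
      rw [(A p.1.1).symm_base hp'.2.1]

/-- The induced maps depend smoothly on the parameter and the point. -/
theorem contMDiffAt_induced {t : ℝ} {q : GaugeNaturalBundle B lam}
    (hq : q.proj ∈ (A t).base.source) :
    ContMDiffAt (𝓘(ℝ, ℝ).prod 𝓘(ℝ, Eu m × EF)) 𝓘(ℝ, Eu m × EF) ∞
      (fun p : ℝ × GaugeNaturalBundle B lam => (A p.1).induced p.2) (t, q) := by
  classical
  set x := q.proj with hx
  have h₀ : x ∈ B.dom x := B.mem_dom x
  have h₁ : (A t).base x ∈ B.dom ((A t).base x) := B.mem_dom _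
  let f₀ : F := q.2.coord h₀
  have s1 : ContMDiffAt (𝓘(ℝ, ℝ).prod 𝓘(ℝ, Eu m × EF)) (𝓘(ℝ, ℝ).prod 𝓘(ℝ, Eu m)) ∞
      (fun p : ℝ × GaugeNaturalBundle B lam => (p.1, p.2.proj)) (t, q) :=
    contMDiffAt_fst.prodMk (contMDiff_proj.comp contMDiff_snd).contMDiffAt
  have s2 : ContMDiffAt (𝓘(ℝ, ℝ).prod 𝓘(ℝ, Eu m × EF)) 𝓘(ℝ, EF) ∞
      (fun p : ℝ × GaugeNaturalBundle B lam => coordAt x f₀ p.2) (t, q) :=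
    ContMDiffAt.comp (g := coordAt x f₀) (t, q) (contMDiffAt_coordAt f₀ h₀) contMDiffAt_snd
  have s3 := ContMDiffAt.comp (t, q)
    (hA.exists_contMDiffAt_transGerm (lam := lam) h₀ hq h₁ (coordAt x f₀ q)) (s1.prodMk s2)
  have s4 : ContMDiffAt (𝓘(ℝ, ℝ).prod 𝓘(ℝ, Eu m × EF)) 𝓘(ℝ, Eu m) ∞
      (fun p : ℝ × GaugeNaturalBundle B lam => (A p.1).base p.2.proj) (t, q) :=
    ContMDiffAt.comp (g := fun p : ℝ × M => (A p.1).base p.2) (t, q)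
      (hA.smooth_base hq).contMDiffAt s1
  -- The reference charts at `x` and at its image are kept fixed: nearby times and points stay in
  -- their domains, where `induced_ofCoord` expresses the induced map through smooth ingredients.
  refine (ContMDiffAt.comp (g := fun p : M × F => ofCoord B lam ((A t).base x) f₀ p.1 p.2) (t, q)
    (contMDiffAt_ofCoord f₀ _ h₁) (s4.prodMk s3)).congr_of_eventuallyEq ?_
  filter_upwards [s1.continuousAt.eventually (hA.isOpen_source.mem_nhds hq),
    (continuousAt_snd.comp s1.continuousAt).eventually ((B.isOpen_dom x).mem_nhds h₀),
    s4.continuousAt.eventually ((B.isOpen_dom _).mem_nhds h₁)] with p h1 h2 h3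
  replace h2 : p.2.proj ∈ B.dom x := h2
  have e := (A p.1).induced_ofCoord (lam := lam) h2 h1 h3 f₀ f₀ (coordAt x f₀ p.2)
  rw [ofCoord_coordAt f₀ p.2 h2] at e
  simp only [Function.comp_apply]
  rw [dif_pos ⟨h2, h1, h3⟩]
  exact e

end IsSmoothFamily

end LocalAutomorphism

end GaugeCharts

/-- The derivative at time zero of a smooth family of maps is a smooth vector field along the map
at time zero. -/
theorem contMDiffAt_der_time {E₁ E₂ : Type*} [NormedAddCommGroup E₁] [NormedSpace ℝ E₁]
    [NormedAddCommGroup E₂] [NormedSpace ℝ E₂] {N₁ N₂ : Type*} [TopologicalSpace N₁]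
    [ChartedSpace E₁ N₁] [IsManifold 𝓘(ℝ, E₁) ∞ N₁] [TopologicalSpace N₂] [ChartedSpace E₂ N₂]
    [IsManifold 𝓘(ℝ, E₂) ∞ N₂] {L : ℝ × N₁ → N₂} {k : N₁ → N₂} {y₀ : N₁}
    (hL : SmoothNear (𝓘(ℝ, ℝ).prod 𝓘(ℝ, E₁)) 𝓘(ℝ, E₂) L (0, y₀))
    (hk : ∀ᶠ y in 𝓝 y₀, L (0, y) = k y) :
    ContMDiffAt 𝓘(ℝ, E₁) 𝓘(ℝ, E₂).tangent ∞
      (fun y => (⟨k y, der 𝓘(ℝ, ℝ) 𝓘(ℝ, E₂) (fun t => L (t, y)) 0 (1 : ℝ)⟩ :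
        TangentBundle 𝓘(ℝ, E₂) N₂)) y₀ := by
  have s1 : ContMDiffAt 𝓘(ℝ, E₁) 𝓘(ℝ, ℝ).tangent ∞
      (fun _ : N₁ => (⟨0, (1 : ℝ)⟩ : TangentBundle 𝓘(ℝ, ℝ) ℝ)) y₀ := contMDiffAt_const
  -- The time derivative is the total derivative of `L` in the direction (1, 0), a smooth field
  -- along the slice at time 0.
  have sV := contMDiffAt_vector_prodMk s1 (contMDiffAt_vector_zero (contMDiffAt_id (x := y₀)
    (I := 𝓘(ℝ, E₁)) (n := ∞)))
  have main := SmoothNear.contMDiffAt_mfderiv_apply (g := fun y => ((0 : ℝ), y)) hL sV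
  refine main.congr_of_eventuallyEq ?_
  have c : ContinuousAt (fun y : N₁ => ((0 : ℝ), y)) y₀ := by fun_prop
  filter_upwards [hk, c.eventually (eventually_eventually_nhds.2 hL)] with y h1 h2
  have h3 : SmoothNear (𝓘(ℝ, ℝ).prod 𝓘(ℝ, E₁)) 𝓘(ℝ, E₂) L (0, y) := h2
  have e := der_prod (I := 𝓘(ℝ, ℝ)) (J := 𝓘(ℝ, E₁)) h3.mdifferentiableAt (1 : ℝ) 0
  rw [map_zero, add_zero] at e
  have : ∀ (z : N₂) (v w : E₂), z = k y → v = w →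
      (⟨k y, w⟩ : TangentBundle 𝓘(ℝ, E₂) N₂) = ⟨z, v⟩ := by
    rintro _ _ _ rfl rfl; rfl
  exact this _ _ _ h1 e

/-! ### The induced one-parameter group -/

section InducedFlow

variable {m : ℕ} {EG EH EP EQ EF : Type*} [NormedAddCommGroup EG] [NormedSpace ℝ EG]
  [NormedAddCommGroup EH] [NormedSpace ℝ EH] [NormedAddCommGroup EP] [NormedSpace ℝ EP]
  [NormedAddCommGroup EQ] [NormedSpace ℝ EQ] [NormedAddCommGroup EF] [NormedSpace ℝ EF]
  {M : Type*} [TopologicalSpace M] [ChartedSpace (Eu m) M]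
  {G : Type*} [TopologicalSpace G] [ChartedSpace EG G] [Group G] [LieGroup 𝓘(ℝ, EG) ∞ G]
  {H : Type*} [TopologicalSpace H] [ChartedSpace EH H] [Group H] [LieGroup 𝓘(ℝ, EH) ∞ H]
  {P : Type*} [TopologicalSpace P] [ChartedSpace EP P]
  {Q : Type*} [TopologicalSpace Q] [ChartedSpace EQ Q]
  {F : Type*} [TopologicalSpace F] [ChartedSpace EF F] [IsManifold 𝓘(ℝ, EF) ∞ F]
  [IsManifold 𝓘(ℝ, Eu m) ∞ M] [IsManifold 𝓘(ℝ, EP) ∞ P]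
  [T2Space M] [T2Space P] [FiniteDimensional ℝ EP]
  {BP : PrincipalBundle m EG EP M G P} {BQ : PrincipalBundle m EH EQ M H Q}
  {R : ReductiveStructure BP BQ} {X : ∀ u : P, TangentSpace 𝓘(ℝ, EP) u}
  {ξ : ∀ x : M, TangentSpace 𝓘(ℝ, Eu m) x}
  {r : GaugeOrder} {lam : JetAction m r EH H EF F}

namespace ReductiveStructure

theorem IsExtension.mem_base_source {t : ℝ} {Φ : LocalAutomorphism BQ}
    (hΦ : R.IsExtension X ξ t Φ) {x : M} : x ∈ Φ.base.source ↔ (t, x) ∈ flowDomain ξ := by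
  rw [hΦ.1]
  rfl

variable (h : BP.IsInvariantLift X ξ)
include h

theorem IsExtension.unique {t : ℝ} {Φ Φ' : LocalAutomorphism BQ}
    (hΦ : R.IsExtension X ξ t Φ) (hΦ' : R.IsExtension X ξ t Φ') :
    EqOn Φ.base Φ'.base Φ.base.source ∧ EqOn Φ.total Φ'.total Φ.total.source := by
  refine ⟨fun x hx => ?_, fun q hq => ?_⟩
  · have := hΦ.mem_base_source.1 hx
    rw [hΦ.base_eq h this, hΦ'.base_eq h this]
  · have := hΦ.mem_source.1 hq
    rw [hΦ.total_eq h this, hΦ'.total_eq h this]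

variable {Φ : ℝ → LocalAutomorphism BQ} (hΦ : ∀ t, R.IsExtension X ξ t (Φ t))
include hΦ

/-- The extensions are given separately for each `t`, with no regularity in `t` assumed. Uniqueness
forces them to agree with the flow of ξ and with `extend`, which are jointly smooth. -/
theorem isSmoothFamily_of_isExtension : LocalAutomorphism.IsSmoothFamily Φ where
  isOpen_source := by
    convert h.smooth_base.isOpen_flowDomain using 1
    ext p
    exact (hΦ p.1).mem_base_source
  smooth_base {t x} hx := by
    have hx' := h.smooth_base.isOpen_flowDomain.mem_nhds ((hΦ t).mem_base_source.1 hx)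
    have s : SmoothNear (𝓘(ℝ, ℝ).prod 𝓘(ℝ, Eu m)) 𝓘(ℝ, Eu m)
        (fun p : ℝ × M => flow ξ p.1 p.2) (t, x) := by
      filter_upwards [hx'] with p hp using h.smooth_base.contMDiffAt_flow hp
    refine s.congr ?_
    filter_upwards [hx'] with p hp using (hΦ p.1).base_eq h hp
  smooth_total {t u} hu := by
    have hu' := (hΦ t).mem_base_source.1 hu
    refine (R.smoothNear_extend h hu').congr ?_
    have c : ContinuousAt (fun p : ℝ × Q => (p.1, BQ.proj p.2)) (t, u) :=
      (continuous_fst.prodMk (BQ.contMDiff_proj.continuous.comp continuous_snd)).continuousAt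
    filter_upwards [c.eventually (h.smooth_base.isOpen_flowDomain.mem_nhds hu')] with p hp
      using (hΦ p.1).total_eq h hp

theorem contMDiffAt_induced {t : ℝ} {q : GaugeNaturalBundle BQ lam}
    (hq : (t, q.proj) ∈ flowDomain ξ) :
    ContMDiffAt (𝓘(ℝ, ℝ).prod 𝓘(ℝ, Eu m × EF)) 𝓘(ℝ, Eu m × EF) ∞
      (fun p : ℝ × GaugeNaturalBundle BQ lam => (Φ p.1).induced p.2) (t, q) :=
  (isSmoothFamily_of_isExtension h hΦ).contMDiffAt_induced ((hΦ t).mem_base_source.2 hq)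

theorem induced_proj {t : ℝ} {q : GaugeNaturalBundle BQ lam} (hq : (t, q.proj) ∈ flowDomain ξ) :
    ((Φ t).induced q).proj = flow ξ t q.proj := by
  rw [(Φ t).induced_proj ((hΦ t).mem_base_source.2 hq), (hΦ t).base_eq h hq]

theorem induced_zero (q : GaugeNaturalBundle BQ lam) : (Φ 0).induced q = q := by
  have h0 := zero_mem_flowDomain h.smooth_base
  refine LocalAutomorphism.induced_id ((hΦ 0).mem_base_source.2 (h0 _)) ?_ ?_
  · exact Eventually.of_forall fun x => by rw [(hΦ 0).base_eq h (h0 x), h.smooth_base.flow_zero]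
  · exact Eventually.of_forall fun x u _ => by rw [(hΦ 0).total_eq h (h0 _), R.extend_zero h]

/-- Induced maps depend on jets, so the composition law is needed over a whole neighbourhood of the
base point; openness of the time domains of the base flow provides it. -/
theorem induced_add {s t : ℝ} {q : GaugeNaturalBundle BQ lam} (hs : (s, q.proj) ∈ flowDomain ξ)
    (ht : (t, flow ξ s q.proj) ∈ flowDomain ξ) :
    (Φ (t + s)).induced q = (Φ t).induced ((Φ s).induced q) := by
  have e1 : ∀ᶠ x in 𝓝 q.proj, (s, x) ∈ flowDomain ξ := (h.smooth_base.isOpen_time s).mem_nhds hs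
  have e2 : ∀ᶠ x in 𝓝 q.proj, (t, flow ξ s x) ∈ flowDomain ξ :=
    (h.smooth_base.contMDiffAt_flow_time hs).continuousAt.eventually
      ((h.smooth_base.isOpen_time t).mem_nhds ht)
  refine LocalAutomorphism.induced_comp ((hΦ s).mem_base_source.2 hs) ?_
    ((hΦ _).mem_base_source.2 (h.smooth_base.flow_add hs ht).1) ?_ ?_
  · rw [(hΦ s).base_eq h hs]
    exact (hΦ t).mem_base_source.2 ht
  · filter_upwards [e1, e2] with x h1 h2
    rw [(hΦ s).base_eq h h1, (hΦ t).base_eq h h2,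
      (hΦ _).base_eq h (h.smooth_base.flow_add h1 h2).1, (h.smooth_base.flow_add h1 h2).2]
  · filter_upwards [e1, e2] with x h1 h2
    rintro u rfl
    rw [(hΦ s).total_eq h h1, (hΦ t).total_eq h (by rwa [R.proj_extend h h1]),
      (hΦ _).total_eq h (h.smooth_base.flow_add h1 h2).1, R.extend_extend h h1 h2]

theorem induced_neg {t : ℝ} {q : GaugeNaturalBundle BQ lam} (hq : (t, q.proj) ∈ flowDomain ξ) :
    (-t, ((Φ t).induced q).proj) ∈ flowDomain ξ ∧ (Φ (-t)).induced ((Φ t).induced q) = q := by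
  have hn := h.smooth_base.flow_neg hq
  refine ⟨by rw [induced_proj h hΦ hq]; exact hn.1, ?_⟩
  rw [← induced_add h hΦ hq hn.1, neg_add_cancel, induced_zero h hΦ]

theorem isOneParameterGroup (lam : JetAction m r EH H EF F) : IsOneParameterGroup lam Φ ξ where
  isOpen_domain := h.smooth_base.isOpen_flowDomain.preimage
    (continuous_fst.prodMk (GaugeNaturalBundle.contMDiff_proj.continuous.comp continuous_snd))
  smooth p hp := (contMDiffAt_induced h hΦ hp).contMDiffWithinAt
  covers _ _ hq := induced_proj h hΦ hq
  zero q := ⟨zero_mem_flowDomain h.smooth_base _, induced_zero h hΦ q⟩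
  add s t q hs ht := by
    rw [induced_proj h hΦ hs] at ht
    exact ⟨(h.smooth_base.flow_add hs ht).1, induced_add h hΦ hs ht⟩
  neg _ _ hq := induced_neg h hΦ hq

theorem contMDiff_induced_of_complete (hc : flowDomain ξ = univ) (t : ℝ) :
    ContMDiff 𝓘(ℝ, Eu m × EF) 𝓘(ℝ, Eu m × EF) ∞
      (fun q : GaugeNaturalBundle BQ lam => (Φ t).induced q) := fun q =>
  ContMDiffAt.comp (g := fun p : ℝ × GaugeNaturalBundle BQ lam => (Φ p.1).induced p.2)
    (f := fun q => (t, q)) q (contMDiffAt_induced h hΦ (by rw [hc]; trivial))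
    (contMDiffAt_const.prodMk contMDiffAt_id)

theorem exists_diffeomorph_of_complete (lam : JetAction m r EH H EF F)
    (hc : flowDomain ξ = univ) (t : ℝ) :
    (Φ t).base.source = univ ∧ (Φ t).base.target = univ ∧
      ∃ Ψ : Diffeomorph 𝓘(ℝ, Eu m × EF) 𝓘(ℝ, Eu m × EF)
        (GaugeNaturalBundle BQ lam) (GaugeNaturalBundle BQ lam) ∞,
        ∀ q, Ψ q = (Φ t).induced q := by
  have hm : ∀ p, p ∈ flowDomain ξ := fun p => by rw [hc]; trivial
  have hs : (Φ t).base.source = univ := eq_univ_of_forall fun x => (hΦ t).mem_base_source.2 (hm _)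
  refine ⟨hs, eq_univ_of_forall fun y => ?_, ⟨⟨⟨(Φ t).induced, (Φ (-t)).induced, fun q => ?_,
    fun q => ?_⟩, contMDiff_induced_of_complete h hΦ hc t,
    contMDiff_induced_of_complete h hΦ hc (-t)⟩, fun _ => rfl⟩⟩
  -- Each `y` is the image of its own position at time `-t`.
  · have h1 := (Φ t).base.map_source (x := flow ξ (-t) y) (by rw [hs]; trivial)
    have h2 : (Φ t).base (flow ξ (-t) y) = y := by
      rw [(hΦ t).base_eq h (hm _), (h.smooth_base.flow_mem_neg (hm _)).2]
    exact h2 ▸ h1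
  · exact (induced_neg h hΦ (hm _)).2
  · have := (induced_neg h hΦ (t := -t) (q := q) (hm _)).2
    rwa [neg_neg] at this

theorem smoothNear_induced {t : ℝ} {q : GaugeNaturalBundle BQ lam}
    (hq : (t, q.proj) ∈ flowDomain ξ) :
    SmoothNear (𝓘(ℝ, ℝ).prod 𝓘(ℝ, Eu m × EF)) 𝓘(ℝ, Eu m × EF)
      (fun p : ℝ × GaugeNaturalBundle BQ lam => (Φ p.1).induced p.2) (t, q) := by
  filter_upwards [(isOneParameterGroup h hΦ lam).isOpen_domain.mem_nhds hq] with p hp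
    using contMDiffAt_induced h hΦ hp

theorem smoothField_generator (lam : JetAction m r EH H EF F) :
    SmoothField (generator lam Φ) := fun _ =>
  contMDiffAt_der_time (L := fun p : ℝ × GaugeNaturalBundle BQ lam => (Φ p.1).induced p.2)
    (k := fun q => q) (smoothNear_induced h hΦ (zero_mem_flowDomain h.smooth_base _))
    (Eventually.of_forall (induced_zero h hΦ))

/-! ### The Lie derivative -/

section Lie

variable {U : Set M} {σ : M → GaugeNaturalBundle BQ lam} (hU : IsOpen U)
  (hp : ∀ x ∈ U, (σ x).proj = x) (hσ : ContMDiffOn 𝓘(ℝ, Eu m) 𝓘(ℝ, Eu m × EF) ∞ σ U)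

omit hΦ in
theorem smoothNear_flow_zero (x : M) : SmoothNear (𝓘(ℝ, ℝ).prod 𝓘(ℝ, Eu m)) 𝓘(ℝ, Eu m)
    (fun p : ℝ × M => flow ξ p.1 p.2) (0, x) := by
  filter_upwards [h.smooth_base.isOpen_flowDomain.mem_nhds (zero_mem_flowDomain h.smooth_base x)]
    with p hp using h.smooth_base.contMDiffAt_flow hp

omit hΦ in
include hU hσ in
theorem smoothNear_section_flow {x : M} (hx : x ∈ U) :
    SmoothNear (𝓘(ℝ, ℝ).prod 𝓘(ℝ, Eu m)) 𝓘(ℝ, Eu m × EF)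
      (fun p : ℝ × M => σ (flow ξ p.1 p.2)) (0, x) :=
  SmoothNear.comp (g := σ) (f := fun p : ℝ × M => flow ξ p.1 p.2)
    (by
      simp only [h.smooth_base.flow_zero]
      exact smoothNear_of_contMDiffOn (hU.mem_nhds hx) hσ)
    (smoothNear_flow_zero h x)

omit h hΦ in
theorem smoothNear_time {E₁ N₁ N₂ E₂ : Type*} [NormedAddCommGroup E₁] [NormedSpace ℝ E₁]
    [TopologicalSpace N₁] [ChartedSpace E₁ N₁] [NormedAddCommGroup E₂] [NormedSpace ℝ E₂]
    [TopologicalSpace N₂] [ChartedSpace E₂ N₂] {L : ℝ × N₁ → N₂} {t : ℝ} {x : N₁}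
    (hL : SmoothNear (𝓘(ℝ, ℝ).prod 𝓘(ℝ, E₁)) 𝓘(ℝ, E₂) L (t, x)) :
    SmoothNear 𝓘(ℝ, ℝ) 𝓘(ℝ, E₂) (fun t => L (t, x)) t :=
  SmoothNear.comp (g := L) (f := fun t => (t, x)) hL
    ((contMDiff_id.prodMk contMDiff_const).smoothNear t)

include hU hσ in
theorem smoothNear_lieCurve {x : M} (hx : x ∈ U) :
    SmoothNear (𝓘(ℝ, ℝ).prod 𝓘(ℝ, Eu m)) 𝓘(ℝ, Eu m × EF)
      (fun p : ℝ × M => lieCurve Φ ξ σ p.2 p.1) (0, x) := by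
  have s1 : SmoothNear (𝓘(ℝ, ℝ).prod 𝓘(ℝ, Eu m)) 𝓘(ℝ, ℝ) (fun p : ℝ × M => -p.1) (0, x) :=
    SmoothNear.comp (g := fun t : ℝ => -t) (f := fun p : ℝ × M => p.1)
      (contDiff_neg.contMDiff.smoothNear _) (contMDiff_fst.smoothNear _)
  refine SmoothNear.comp (g := fun p : ℝ × GaugeNaturalBundle BQ lam => (Φ p.1).induced p.2)
    (f := fun p : ℝ × M => (-p.1, σ (flow ξ p.1 p.2))) ?_
    (s1.prodMk (smoothNear_section_flow h hU hσ hx))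
  simp only [neg_zero, h.smooth_base.flow_zero]
  exact smoothNear_induced h hΦ (zero_mem_flowDomain h.smooth_base _)

theorem lieCurve_zero (x : M) : lieCurve Φ ξ σ x 0 = σ x := by
  rw [lieCurve, neg_zero, h.smooth_base.flow_zero, induced_zero h hΦ]

include hU hp in
-- For small `t` the point φ_t(x) is still in `U`, where σ is a section; the map induced at time
-- `-t` then brings the fibre back to the one over `x`.
theorem eventually_lieCurve_proj {x : M} (hx : x ∈ U) :
    ∀ᶠ t in 𝓝 0, (lieCurve Φ ξ σ x t).proj = x := by
  have c : ContinuousAt (fun t : ℝ => (t, x)) 0 := by fun_prop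
  have c' : ContinuousAt (fun t : ℝ => flow ξ t x) 0 :=
    (smoothNear_time (smoothNear_flow_zero h x)).contMDiffAt.continuousAt
  have hx' : U ∈ 𝓝 (flow ξ 0 x) := by
    rw [h.smooth_base.flow_zero]
    exact hU.mem_nhds hx
  filter_upwards [c.eventually (h.smooth_base.isOpen_flowDomain.mem_nhds
    (zero_mem_flowDomain h.smooth_base x)), c'.eventually hx'] with t h1 h2
  have hn := h.smooth_base.flow_neg h1
  rw [lieCurve, induced_proj h hΦ (by rw [hp _ h2]; exact hn.1), hp _ h2, hn.2]

include hU hσ in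
-- Chain rule for `(s, y) ↦ (Φ_s)_λ(y)` along `t ↦ (-t, σ(φ_t(x)))`. The derivative in `y` at `s =
-- 0` is the identity because Φ_0 induces the identity, and the derivative in `s` enters with the
-- sign of `-t`.
theorem der_lieCurve {x : M} (hx : x ∈ U) :
    der 𝓘(ℝ, ℝ) 𝓘(ℝ, Eu m × EF) (lieCurve Φ ξ σ x) 0 (1 : ℝ) =
      der 𝓘(ℝ, Eu m) 𝓘(ℝ, Eu m × EF) σ x (ξ x) -
        der 𝓘(ℝ, ℝ) 𝓘(ℝ, Eu m × EF) (fun t => (Φ t).induced (σ x)) 0 (1 : ℝ) := by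
  have f0 := h.smooth_base.flow_zero x
  have s1 : SmoothNear 𝓘(ℝ, ℝ) 𝓘(ℝ, ℝ) (fun t : ℝ => -t) 0 := contDiff_neg.contMDiff.smoothNear _
  have s2 := smoothNear_time (smoothNear_section_flow h hU hσ hx)
  have s3 : SmoothNear (𝓘(ℝ, ℝ).prod 𝓘(ℝ, Eu m × EF)) 𝓘(ℝ, Eu m × EF)
      (fun p : ℝ × GaugeNaturalBundle BQ lam => (Φ p.1).induced p.2)
      (-(0 : ℝ), σ (flow ξ 0 x)) := by
    simp only [neg_zero, f0]
    exact smoothNear_induced h hΦ (zero_mem_flowDomain h.smooth_base _)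
  have s4 : SmoothNear 𝓘(ℝ, Eu m) 𝓘(ℝ, Eu m × EF) σ (flow ξ 0 x) := by
    rw [f0]
    exact smoothNear_of_contMDiffOn (hU.mem_nhds hx) hσ
  have s5 := smoothNear_time (smoothNear_flow_zero h x)
  have e1 := der_comp₂ (I := 𝓘(ℝ, ℝ))
    (F := fun p : ℝ × GaugeNaturalBundle BQ lam => (Φ p.1).induced p.2) (f := fun t : ℝ => -t)
    (g := fun t => σ (flow ξ t x)) s3.mdifferentiableAt s1.mdifferentiableAt s2.mdifferentiableAt
    (1 : ℝ)
  have e2 := der_comp (g := σ) (f := fun t => flow ξ t x) s4.mdifferentiableAt s5.mdifferentiableAt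
    (1 : ℝ)
  have e3 : der 𝓘(ℝ, ℝ) 𝓘(ℝ, Eu m) (fun t => flow ξ t x) 0 (1 : ℝ) = ξ x := by
    have := DFunLike.congr_fun (h.smooth_base.deriv_flow x).mfderiv (1 : ℝ)
    refine this.trans ?_
    exact one_smul ℝ (ξ x : Eu m)
  have e4 : der 𝓘(ℝ, ℝ) 𝓘(ℝ, ℝ) (fun t : ℝ => -t) 0 (1 : ℝ) = -1 :=
    DFunLike.congr_fun ((hasFDerivAt_id (0 : ℝ)).neg).hasMFDerivAt.mfderiv (1 : ℝ)
  have e5 : (fun z : GaugeNaturalBundle BQ lam => (Φ 0).induced z) = fun z => z :=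
    funext (induced_zero h hΦ)
  simp only [neg_zero, e5, der_id, e4, e2, e3, f0, map_neg] at e1
  rw [sub_eq_neg_add]
  exact e1

include hU hp hσ in
theorem lieDerivativeWellDefined : LieDerivativeWellDefined Φ ξ U σ where
  curve_zero x _ := lieCurve_zero h hΦ x
  curve_smooth x hx := smoothNear_time (smoothNear_lieCurve h hΦ hU hσ hx)
  curve_proj x hx := eventually_lieCurve_proj h hΦ hU hp hx
  vertical x hx := by
    have s1 := smoothNear_time (smoothNear_lieCurve h hΦ hU hσ hx)
    have e := der_comp (I := 𝓘(ℝ, ℝ)) (J := 𝓘(ℝ, Eu m × EF)) (K := 𝓘(ℝ, Eu m))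
      (g := fun q : GaugeNaturalBundle BQ lam => q.proj) (f := lieCurve Φ ξ σ x) (x := 0)
      ((GaugeNaturalBundle.contMDiff_proj _).mdifferentiableAt (by simp)) s1.mdifferentiableAt
      (1 : ℝ)
    -- The projected curve is constant near `t = 0`, so the projection of its velocity vanishes.
    rw [der_congr (g := fun _ => x) (eventually_lieCurve_proj h hΦ hU hp hx), der_const,
      lieCurve_zero h hΦ] at e
    exact e.symm
  eq_sub x hx := der_lieCurve h hΦ hU hσ hx
  smooth x hx := (contMDiffAt_der_time (k := σ) (smoothNear_lieCurve h hΦ hU hσ hx)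
    (Eventually.of_forall fun y => lieCurve_zero h hΦ y)).contMDiffWithinAt

end Lie

end ReductiveStructure

end InducedFlow

end

end GaugeNatural

/-! ### The main theorem, assembled from the preceding parts. -/

theorem mainTheorem7
    {m : ℕ} {EG EH EP EQ EF : Type*}
    [NormedAddCommGroup EG] [NormedSpace ℝ EG] [FiniteDimensional ℝ EG]
    [NormedAddCommGroup EH] [NormedSpace ℝ EH] [FiniteDimensional ℝ EH]
    [NormedAddCommGroup EP] [NormedSpace ℝ EP] [FiniteDimensional ℝ EP]
    [NormedAddCommGroup EQ] [NormedSpace ℝ EQ] [FiniteDimensional ℝ EQ]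
    [NormedAddCommGroup EF] [NormedSpace ℝ EF] [FiniteDimensional ℝ EF]
    {M : Type*} [TopologicalSpace M] [ChartedSpace (GaugeNatural.Eu m) M]
    [IsManifold 𝓘(ℝ, GaugeNatural.Eu m) ∞ M] [T2Space M]
    {G : Type*} [TopologicalSpace G] [ChartedSpace EG G] [Group G] [LieGroup 𝓘(ℝ, EG) ∞ G]
    {H : Type*} [TopologicalSpace H] [ChartedSpace EH H] [Group H] [LieGroup 𝓘(ℝ, EH) ∞ H]
    {P : Type*} [TopologicalSpace P] [ChartedSpace EP P] [IsManifold 𝓘(ℝ, EP) ∞ P] [T2Space P]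
    {Q : Type*} [TopologicalSpace Q] [ChartedSpace EQ Q] [IsManifold 𝓘(ℝ, EQ) ∞ Q] [T2Space Q]
    {F : Type*} [TopologicalSpace F] [ChartedSpace EF F] [IsManifold 𝓘(ℝ, EF) ∞ F] [T2Space F]
    (BP : GaugeNatural.PrincipalBundle m EG EP M G P)
    (BQ : GaugeNatural.PrincipalBundle m EH EQ M H Q)
    (R : GaugeNatural.ReductiveStructure BP BQ)
    (Ξ : ∀ u : Q, TangentSpace 𝓘(ℝ, EQ) u)
    (hΞ : GaugeNatural.SmoothField Ξ) (hinv : BQ.InvariantField Ξ)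
    (r : GaugeNatural.GaugeOrder) (lam : GaugeNatural.JetAction m r EH H EF F) :
    (∃! ξ : ∀ x : M, TangentSpace 𝓘(ℝ, GaugeNatural.Eu m) x, BQ.ProjectsOn Ξ ξ) ∧
    (∃! ΞK : ∀ u : P, TangentSpace 𝓘(ℝ, EP) u, R.IsKosmannField Ξ ΞK) ∧
    ∀ (ξ : ∀ x : M, TangentSpace 𝓘(ℝ, GaugeNatural.Eu m) x)
      (ΞK : ∀ u : P, TangentSpace 𝓘(ℝ, EP) u),
      BQ.ProjectsOn Ξ ξ → R.IsKosmannField Ξ ΞK →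
      -- the Kosmann field is a smooth invariant vector field over the same field on the base
      GaugeNatural.SmoothField ξ ∧ GaugeNatural.SmoothField ΞK ∧
      BP.InvariantField ΞK ∧ BP.ProjectsOn ΞK ξ ∧
      -- its flow covers the flow on the base, and is defined as long as the latter is
      (∀ t u, (t, u) ∈ GaugeNatural.flowDomain ΞK ↔
        (t, BP.proj u) ∈ GaugeNatural.flowDomain ξ) ∧
      (∀ t u, (t, u) ∈ GaugeNatural.flowDomain Ξ ↔
        (t, BQ.proj u) ∈ GaugeNatural.flowDomain ξ) ∧
      (∀ t u, (t, u) ∈ GaugeNatural.flowDomain ΞK →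
        BP.proj (GaugeNatural.flow ΞK t u) = GaugeNatural.flow ξ t (BP.proj u)) ∧
      -- it extends to equivariant automorphisms of `Q`, in one way only
      (∃ Φ : ℝ → GaugeNatural.LocalAutomorphism BQ, ∀ t, R.IsExtension ΞK ξ t (Φ t)) ∧
      (∀ t Φ Φ', R.IsExtension ΞK ξ t Φ → R.IsExtension ΞK ξ t Φ' →
        EqOn Φ.base Φ'.base Φ.base.source ∧ EqOn Φ.total Φ'.total Φ.total.source ∧
        ∀ q : GaugeNatural.GaugeNaturalBundle BQ lam, Φ.induced q = Φ'.induced q) ∧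
      ∀ Φ : ℝ → GaugeNatural.LocalAutomorphism BQ, (∀ t, R.IsExtension ΞK ξ t (Φ t)) →
        -- the induced one-parameter group of the gauge-natural bundle
        GaugeNatural.IsOneParameterGroup lam Φ ξ ∧
        (∀ t, (GaugeNatural.flowDomain ΞK = univ ∨ GaugeNatural.flowDomain ξ = univ ∨
            GaugeNatural.flowDomain Ξ = univ) →
          (Φ t).base.source = univ ∧ (Φ t).base.target = univ ∧
          ∃ Ψ : Diffeomorph 𝓘(ℝ, GaugeNatural.Eu m × EF) 𝓘(ℝ, GaugeNatural.Eu m × EF)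
              (GaugeNatural.GaugeNaturalBundle BQ lam) (GaugeNatural.GaugeNaturalBundle BQ lam) ∞,
            ∀ q, Ψ q = (Φ t).induced q) ∧
        -- the reductive Lie derivative of sections
        ContMDiff 𝓘(ℝ, GaugeNatural.Eu m × EF) 𝓘(ℝ, GaugeNatural.Eu m) ∞
          (fun q : GaugeNatural.GaugeNaturalBundle BQ lam => q.proj) ∧
        GaugeNatural.SmoothField (GaugeNatural.generator lam Φ) ∧
        ∀ (U : Set M) (σ : M → GaugeNatural.GaugeNaturalBundle BQ lam), IsOpen U →
          (∀ x ∈ U, (σ x).proj = x) →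
          ContMDiffOn 𝓘(ℝ, GaugeNatural.Eu m) 𝓘(ℝ, GaugeNatural.Eu m × EF) ∞ σ U →
          GaugeNatural.LieDerivativeWellDefined Φ ξ U σ := by
  have lifts : ∀ (ξ : ∀ x : M, TangentSpace 𝓘(ℝ, GaugeNatural.Eu m) x)
      (ΞK : ∀ u : P, TangentSpace 𝓘(ℝ, EP) u), BQ.ProjectsOn Ξ ξ → R.IsKosmannField Ξ ΞK →
      BP.IsInvariantLift ΞK ξ ∧ BQ.IsInvariantLift Ξ ξ := fun ξ ΞK hξ hK =>
    ⟨⟨R.smoothField_kosmann hΞ hK, BQ.smoothField_of_projectsOn hΞ hξ,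
      R.invariantField_kosmann hinv hK, R.projectsOn_kosmann hξ hK⟩,
      ⟨hΞ, BQ.smoothField_of_projectsOn hΞ hξ, hinv, hξ⟩⟩
  refine ⟨BQ.existsUnique_projectsOn hinv, R.existsUnique_isKosmannField Ξ,
    fun ξ ΞK hξ hK => ?_⟩
  obtain ⟨h, h'⟩ := lifts ξ ΞK hξ hK
  refine ⟨h.smooth_base, h.smooth, h.invariant, h.projects, fun t u => h.mem_flowDomain_iff,
    fun t u => h'.mem_flowDomain_iff, fun t u hu => (h.flow_proj hu).2,
    ⟨R.extension h, R.isExtension_extension h⟩, fun t Φ Φ' hΦ hΦ' => ?_, fun Φ hΦ => ?_⟩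
  · have hu := hΦ.unique h hΦ'
    exact ⟨hu.1, hu.2, GaugeNatural.LocalAutomorphism.induced_congr (hΦ.1.trans hΦ'.1.symm)
      hu.1 hu.2⟩
  · refine ⟨GaugeNatural.ReductiveStructure.isOneParameterGroup h hΦ lam, fun t hc => ?_,
      GaugeNatural.GaugeNaturalBundle.contMDiff_proj,
      GaugeNatural.ReductiveStructure.smoothField_generator h hΦ lam, fun U σ hU hp hσ =>
      GaugeNatural.ReductiveStructure.lieDerivativeWellDefined h hΦ hU hp hσ⟩
    refine GaugeNatural.ReductiveStructure.exists_diffeomorph_of_complete h hΦ lam ?_ t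
    -- Completeness upstairs gives completeness of ξ: every base point lies under a point of the
    -- bundle, with the same life time.
    rcases hc with hc | hc | hc
    · refine eq_univ_of_forall fun ⟨s, x⟩ => ?_
      obtain ⟨u, rfl⟩ := BP.proj_surjective x
      exact h.mem_flowDomain_iff.1 (by rw [hc]; trivial)
    · exact hc
    · refine eq_univ_of_forall fun ⟨s, x⟩ => ?_
      obtain ⟨u, rfl⟩ := BQ.proj_surjective x
      exact h'.mem_flowDomain_iff.1 (by rw [hc]; trivial)
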